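/- **Setting.** $\mathsf{Catt}$ is the type theory with types $\star$ and $s\to_A t$, and terms that are variables or coherences $\mathrm{Coh}(\Delta,A,\sigma)$ ($\Delta$ a context, $A$ a type in $\Delta$, $\sigma:\Delta\to\Gamma$ a substitution, that is, a map from the variables of $\Delta$ to terms of $\Gamma$). Write $[\![\sigma]\!]$ for the action of a substitution and $\equiv$ for syntactic equality. A finite planar rooted tree $T=[T_1,\dots,T_n]$ is identified with the pasting context $\Sigma T_1\vee\dots\vee\Sigma T_n$ (suspensions, wedge sum), the empty list with $(x:\star)$, and the linear tree of dimension $n$ with the disc $D^n$. The term $\mathrm{Coh}(\Delta,s\to_A t,\sigma)$ has type $(s\to_A t)[\![\sigma]\!]$ in $\Gamma$ when $\Delta$ is a pasting context, $s\to_At$ is a valid type in $\Delta$, $\Gamma\vdash\sigma:\Delta$, and either $s,t$ have the supports of the source and target $(\dim\Delta-1)$-boundaries of $\Delta$, or both have full support. Types of terms may be converted along definitional equality. For a tree $T$ with boundary inclusions $\delta_n^\pm:\partial_nT\to T$, put $\mathcal U_T^0=\star$, $\mathcal U_T^{n+1}=\mathcal T_{\partial_nT}^n[\![\delta_n^-]\!]\to_{\mathcal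 U_T^n}\mathcal T_{\partial_nT}^n[\![\delta_n^+]\!]$, $\mathcal C_T^n=\mathrm{Coh}(T,\mathcal U_T^n,\mathrm{id})$, and let $\mathcal T_T^n$ be the top variable $d_n$ if $T=D^n$ and $\mathcal C_T^n$ otherwise. $\mathcal C_T^n$ is an unbiased composite if $n=\dim T$; an identity is a term of the form $\mathcal C_{D^n}^{n+1}[\![\rho]\!]$. A branch $P$ of a tree $S$ is a non-empty list of indices leading to a linear subtree. It determines a locally maximal variable of $S$, also written $P$, whose dimension is the leaf height $\mathrm{lh}(P)$; the branch height $\mathrm{bh}(P)$ is one less than the length of the list. The trunk height is $\mathrm{th}([T_1])=1+\mathrm{th}(T_1)$, and $0$ for any other tree. If $\mathrm{bh}(P)\le\mathrm{th}(T)$, the inserted tree $S\triangleleft_PT$ is defined by recursion on $P$: for $P=[k]$, replace the entry $S_k$ of the list $S$ by the list of entries of $T$; for $P=k::P'$ with $P'$ non-empty one has $T=[T_1]$, and $S_k$ is replaced by $S_k\triangleleft_{P'}T_1$. The exterior substitution $\kappa:S\to S\triangleleft_PT$ is, by recursion on $P$, $\{\mathcal U_T^{\mathrm{lh}(P)},\mathcal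 C_T^{\mathrm{lh}(P)}\}$ on the disc $\Sigma S_k$ if $P=[k]$ and $\Sigma\kappa_{S_k,P',T_1}$ on $\Sigma S_k$ if $P=k::P'$, and the inclusion on the other summands; here $\{A,t\}:D^{\dim A}\to\Gamma$ is the substitution classifying a term $t$ and a type $A$. For $\sigma:S\to\Gamma$ and $\tau:T\to\Gamma$, the inserted substitution $\sigma\triangleleft_P\tau:S\triangleleft_PT\to\Gamma$ takes the values of $\tau$ on the variables coming from $T$ and the values of $\sigma$ on the remaining ones. An insertion redex is $(S,P,T,\Gamma,\sigma,\tau)$ with $S,T$ trees, $P$ a branch of $S$, $\mathrm{bh}(P)\le\mathrm{th}(T)$, $\sigma:S\to\Gamma$, $\tau:T\to\Gamma$, and $P[\![\sigma]\!]\equiv\mathcal C_T^{\mathrm{lh}(P)}[\![\tau]\!]$. $\mathsf{Catt}_{\mathsf{sua}}$ is $\mathsf{Catt}$ with the definitional equality that is the congruence generated (mutually with typing) by the following equations, each whenever its left-hand side is well typed in $\Gamma$: * disc removal: $\mathcal C_{D^n}^n[\![\{A,s\}]\!]=s$, where $n=\dim A$; * endo-coherence removal: $\mathrm{Coh}(\Delta,s\to_As,\sigma)=\mathcal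 C_{D^n}^{n+1}[\![\{A[\![\sigma]\!],s[\![\sigma]\!]\}]\!]$, where $n=\dim A$, if the left-hand side is not an identity; * insertion: $\mathrm{Coh}(S,A,\sigma)=\mathrm{Coh}(S\triangleleft_PT,A[\![\kappa]\!],\sigma\triangleleft_P\tau)$ for insertion redexes such that $\mathcal C_T^{\mathrm{lh}(P)}$ is an unbiased composite or an identity and $\mathrm{Coh}(S,A,\sigma)$ is not an identity. **Theorem.** Let $(S,P,T,\Gamma,\sigma,\tau)$ be any insertion redex and $A$ a type in $S$ such that $\mathrm{Coh}(S,A,\sigma)$ is well typed in $\Gamma$ in $\mathsf{Catt}_{\mathsf{sua}}$. Then $$\Gamma\vdash\mathrm{Coh}(S,A,\sigma)=\mathrm{Coh}(S\triangleleft_PT,\;A[\![\kappa]\!],\;\sigma\triangleleft_P\tau)$$ holds in $\mathsf{Catt}_{\mathsf{sua}}$, even when $\mathcal C_T^{\mathrm{lh}(P)}$ is neither an unbiased composite nor an identity, and also when $\mathrm{Coh}(S,A,\sigma)$ is itself an identity. -/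

import Mathlib

namespace Catt

/-! ## Syntax

Variables are de Bruijn levels: the variables of a context `x₀ : A₀, …, xₙ₋₁ : Aₙ₋₁` are the
elements of `Fin n`, numbered from the left.  A type or a term is indexed by the number of variables
of its context of definition. -/

mutual
/-- Contexts with `n` variables. -/
inductive Ctx : ℕ → Type
  | nil : Ctx 0
  | snoc {n : ℕ} (Γ : Ctx n) (A : Ty n) : Ctx (n + 1)
/-- Types over `n` variables: `⋆` and `s →_A t`. -/
inductive Ty : ℕ → Type
  | star {n : ℕ} : Ty n
  | arr {n : ℕ} (s : Tm n) (A : Ty n) (t : Tm n) : Ty n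
/-- Terms over `n` variables: variables and coherences `Coh(Δ, A, σ)`, where `A` is a type in `Δ`
and the substitution `σ` assigns a term to every variable of `Δ`. -/
inductive Tm : ℕ → Type
  | var {n : ℕ} (i : Fin n) : Tm n
  | coh {m n : ℕ} (Δ : Ctx m) (A : Ty m) (σ : Fin m → Tm n) : Tm n
end

/-- Substitutions from a context with `m` variables to a context with `n` variables. -/
abbrev Sub (m n : ℕ) : Type := Fin m → Tm n

/-- The identity substitution. -/
def Sub.id (n : ℕ) : Sub n n := Tm.var

/-- The substitution `⟨σ, x ↦ t⟩`. -/
def Sub.snoc {m n : ℕ} (σ : Sub m n) (t : Tm n) : Sub (m + 1) n :=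
  Fin.lastCases t σ

mutual
/-- The type `A⟦σ⟧`. -/
def Ty.sub {m n : ℕ} (σ : Sub m n) : Ty m → Ty n
  | .star => .star
  | .arr s A t => .arr (s.sub σ) (A.sub σ) (t.sub σ)
/-- The term `t⟦σ⟧`. -/
def Tm.sub {m n : ℕ} (σ : Sub m n) : Tm m → Tm n
  | .var i => σ i
  | .coh Δ A τ => .coh Δ A (fun i => (τ i).sub σ)
end

/-- Action on types of the substitution that sends variables to variables by `f`. -/
def Ty.rename {m n : ℕ} (f : Fin m → Fin n) (A : Ty m) : Ty n := A.sub (fun i => .var (f i))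

/-- Action on terms of the substitution that sends variables to variables by `f`. -/
def Tm.rename {m n : ℕ} (f : Fin m → Fin n) (t : Tm m) : Tm n := t.sub (fun i => .var (f i))

/-- The type of a variable, as a type over the whole context. -/
def Ctx.ty : {n : ℕ} → Ctx n → Fin n → Ty n
  | _, .nil => fun i => i.elim0
  | _, .snoc Γ A =>
      Fin.lastCases (A.rename Fin.castSucc) (fun i => (Γ.ty i).rename Fin.castSucc)

/-- The dimension of a type. -/
def Ty.dim {n : ℕ} : Ty n → ℕ
  | .star => 0
  | .arr _ A _ => A.dim + 1

/-! ## Support -/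

mutual
/-- Free variables of a type. -/
def Ty.fv {n : ℕ} : Ty n → Set (Fin n)
  | .star => ∅
  | .arr s A t => s.fv ∪ A.fv ∪ t.fv
/-- Free variables of a term. -/
def Tm.fv {n : ℕ} : Tm n → Set (Fin n)
  | .var i => {i}
  | .coh _ _ σ => {x | ∃ i, x ∈ (σ i).fv}
end

/-- A set of variables is downwards closed if it contains the free variables of the types of its
elements. -/
def Ctx.DownClosed {n : ℕ} (Γ : Ctx n) (X : Set (Fin n)) : Prop :=
  ∀ x ∈ X, (Γ.ty x).fv ⊆ X

/-- The downward closure of a set of variables. -/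
def Ctx.downClosure {n : ℕ} (Γ : Ctx n) (X : Set (Fin n)) : Set (Fin n) :=
  ⋂₀ {Y | Γ.DownClosed Y ∧ X ⊆ Y}

/-- The support of a term in a context. -/
def Tm.supp {n : ℕ} (Γ : Ctx n) (t : Tm n) : Set (Fin n) := Γ.downClosure t.fv

/-- The support, in the target context, of a substitution. -/
def Sub.supp {m n : ℕ} (Γ : Ctx n) (σ : Sub m n) : Set (Fin n) :=
  Γ.downClosure {x | ∃ i, x ∈ (σ i).fv}

/-! ## Suspension

The poles are `N = 0` and `S = 1`; a variable `i` becomes `i + 2`. -/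

/-- Suspension of a substitution, given the suspensions of its terms. -/
def Sub.suspOf {m n : ℕ} (f : Sub m (n + 2)) : Sub (m + 2) (n + 2) :=
  Fin.cases (.var 0) (Fin.cases (.var 1) f)

mutual
/-- Suspension of a context. -/
def Ctx.susp : {n : ℕ} → Ctx n → Ctx (n + 2)
  | _, .nil => .snoc (.snoc .nil .star) .star
  | _, .snoc Γ A => .snoc Γ.susp A.susp
/-- Suspension of a type. -/
def Ty.susp : {n : ℕ} → Ty n → Ty (n + 2)
  | _, .star => .arr (.var 0) .star (.var 1)
  | _, .arr s A t => .arr s.susp A.susp t.susp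
/-- Suspension of a term. -/
def Tm.susp : {n : ℕ} → Tm n → Tm (n + 2)
  | _, .var i => .var (i.addNat 2)
  | _, .coh Δ A σ => .coh Δ.susp A.susp (Sub.suspOf (fun i => (σ i).susp))
end

/-- Suspension of a substitution. -/
def Sub.susp {m n : ℕ} (σ : Sub m n) : Sub (m + 2) (n + 2) :=
  Sub.suspOf (fun i => (σ i).susp)

/-! ## Wedge sums

`Γ ∨ Δ` glues the variable `0` of `Δ` to the variable `p` of `Γ`; the remaining variables of `Δ`
are listed after those of `Γ`. -/

/-- The inclusion of the variables of `Γ` in those of `Γ ∨ Δ`. -/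
def wedgeInl {n m : ℕ} (i : Fin n) : Fin (n + (m - 1)) := i.castAdd (m - 1)

/-- The inclusion of the variables of `Δ` in those of `Γ ∨ Δ`. -/
def wedgeInr {n m : ℕ} (p : Fin n) : Fin m → Fin (n + (m - 1))
  | ⟨0, _⟩ => p.castAdd (m - 1)
  | ⟨j + 1, h⟩ => ⟨n + j, by omega⟩

/-- The map out of the variables of `Γ ∨ Δ` given by `f` on those of `Γ` and by `g` on those of `Δ`
other than the glued one. -/
def wedgeCases {n m : ℕ} {α : Type} (f : Fin n → α) (g : Fin m → α) : Fin (n + (m - 1)) → α :=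
  Fin.addCases f (fun j => g ⟨j.1 + 1, by omega⟩)

/-- The wedge sum of two contexts. -/
def Ctx.wedge {n : ℕ} (Γ : Ctx n) (p : Fin n) : {m : ℕ} → Ctx m → Ctx (n + (m - 1))
  | _, .nil => Γ
  | _, .snoc (n := 0) _ _ => Γ
  | _, .snoc (n := _ + 1) Δ A => .snoc (Γ.wedge p Δ) (A.rename (wedgeInr p))

/-! ## Trees -/

/-- Planar rooted trees, that is lists of trees: `nil` is the empty list and `cons T Ts` is the list
with first element `T` and tail `Ts`. -/
inductive Tree : Type
  | nil : Tree
  | cons (T Ts : Tree) : Tree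
  deriving DecidableEq

namespace Tree

/-- Concatenation of lists of trees. -/
def append : Tree → Tree → Tree
  | nil, U => U
  | cons T Ts, U => cons T (append Ts U)

/-- The dimension of a tree. -/
def dim : Tree → ℕ
  | nil => 0
  | cons T Ts => max (T.dim + 1) Ts.dim

/-- The trunk height of a tree. -/
def th : Tree → ℕ
  | cons T nil => T.th + 1
  | _ => 0

/-- The linear tree of dimension `n`; its context is the disc `Dⁿ`. -/
def disc : ℕ → Tree
  | 0 => nil
  | n + 1 => cons (disc n) nil

/-- The number of variables of the context generated by a tree. -/
def size : Tree → ℕ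
  | nil => 1
  | cons T Ts => (T.size + 2) + (Ts.size - 1)

theorem size_pos : (T : Tree) → 0 < T.size
  | nil => Nat.one_pos
  | cons _ _ => by simp only [size]; omega

/-- The context generated by a tree: `⌊[T₁, …, Tₙ]⌋ = Σ⌊T₁⌋ ∨ … ∨ Σ⌊Tₙ⌋`.  Every `Σ⌊Tᵢ⌋` is glued
along its south pole, which is its last variable of type `⋆`. -/
def ctx : (T : Tree) → Ctx T.size
  | nil => .snoc .nil .star
  | cons T Ts => T.ctx.susp.wedge 1 Ts.ctx

/-- The first variable of `⌊T⌋`. -/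
def first (T : Tree) : Fin T.size := ⟨0, T.size_pos⟩

/-- The last variable of `⌊T⌋`; if `T` is linear of dimension `n`, this is the top-dimensional
variable `dₙ` of the disc. -/
def top (T : Tree) : Fin T.size := ⟨T.size - 1, Nat.sub_lt T.size_pos Nat.one_pos⟩

/-- The variable of `⌊[T₁, …, Tₙ]⌋ = Σ⌊T₁⌋ ∨ ⌊[T₂, …, Tₙ]⌋` given by a variable of `⌊T₁⌋`. -/
def inner {T Ts : Tree} (i : Fin T.size) : Fin (cons T Ts).size := wedgeInl (i.addNat 2)

/-- The variable of `⌊[T₁, …, Tₙ]⌋ = Σ⌊T₁⌋ ∨ ⌊[T₂, …, Tₙ]⌋` given by a variable of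
`⌊[T₂, …, Tₙ]⌋`. -/
def right {T Ts : Tree} (i : Fin Ts.size) : Fin (cons T Ts).size :=
  wedgeInr (n := T.size + 2) 1 i

/-- Maps out of the variables of `⌊[T₁, …, Tₙ]⌋`: the first variable is sent to `a`, the variables of
`⌊T₁⌋` are mapped by `f`, and those of `⌊[T₂, …, Tₙ]⌋` by `g`. -/
def varCases {α : Type} {T Ts : Tree} (a : α) (f : Fin T.size → α) (g : Fin Ts.size → α) :
    Fin (cons T Ts).size → α :=
  wedgeCases (n := T.size + 2) (Fin.cases a (Fin.cases (g Ts.first) f)) g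

/-- The last variable of type `⋆` of `⌊T⌋`. -/
def lastObj : (T : Tree) → Fin T.size
  | nil => first nil
  | cons _ Ts => right Ts.lastObj

/-- The inclusion of the variables of `⌊T⌋` in those of `⌊T ++ U⌋ = ⌊T⌋ ∨ ⌊U⌋`. -/
def appendInl : (T U : Tree) → Fin T.size → Fin (T.append U).size
  | nil, U => fun _ => U.first
  | cons _ Ts, U => varCases (first _) inner (fun i => right (appendInl Ts U i))

/-- The inclusion of the variables of `⌊U⌋` in those of `⌊T ++ U⌋ = ⌊T⌋ ∨ ⌊U⌋`. -/
def appendInr : (T U : Tree) → Fin U.size → Fin (T.append U).size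
  | nil, _ => fun i => i
  | cons _ Ts, U => fun i => right (appendInr Ts U i)

/-- The `n`-dimensional boundary `∂ₙ T`. -/
def bdry : ℕ → Tree → Tree
  | 0, _ => nil
  | _ + 1, nil => nil
  | n + 1, cons T Ts => cons (bdry n T) (bdry (n + 1) Ts)

/-- The inclusion `δₙ^ε : ∂ₙ T → T` on variables; `ε = false` is the source inclusion and
`ε = true` the target inclusion. -/
def bdryInc (ε : Bool) : (n : ℕ) → (T : Tree) → Fin (bdry n T).size → Fin T.size
  | 0, T => fun _ => if ε then T.lastObj else T.first
  | _ + 1, nil => fun i => i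
  | n + 1, cons T Ts =>
      varCases (first _) (fun i => inner (bdryInc ε n T i)) (fun i => right (bdryInc ε (n + 1) Ts i))

end Tree

/-! ## Discs and unbiased operations -/

/-- The substitution `{A, t} : Dⁿ → Γ` given by a type `A` of dimension `n` and a term `t`: it sends
`dₙ` to `t`, and `dₖ⁻`, `dₖ⁺` to the iterated sources and targets recorded in `A`.  The value is
arbitrary if `A` does not have dimension `n`. -/
def discSub {k : ℕ} : (n : ℕ) → Ty k → Tm k → Sub (Tree.disc n).size k
  | 0, _, t => fun _ => t
  | n + 1, .arr s A u, t => Sub.snoc (Sub.snoc (discSub n A s) u) t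
  | _ + 1, .star, t => fun _ => t

/-- The unbiased term `𝒯ⁿ` of a tree, given its unbiased type `𝒰ⁿ`. -/
def unbiasedTmOf (n : ℕ) (T : Tree) (U : Ty T.size) : Tm T.size :=
  if T = Tree.disc n then .var T.top else .coh T.ctx U (Sub.id T.size)

/-- The unbiased type `𝒰ⁿ` of a tree. -/
def unbiasedTy : (n : ℕ) → (T : Tree) → Ty T.size
  | 0, _ => .star
  | n + 1, T =>
      .arr ((unbiasedTmOf n (T.bdry n) (unbiasedTy n (T.bdry n))).rename (T.bdryInc false n))
        (unbiasedTy n T)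
        ((unbiasedTmOf n (T.bdry n) (unbiasedTy n (T.bdry n))).rename (T.bdryInc true n))

/-- The unbiased coherence `𝒞ⁿ` of a tree. -/
def unbiasedCoh (n : ℕ) (T : Tree) : Tm T.size :=
  .coh T.ctx (unbiasedTy n T) (Sub.id T.size)

/-- A term is an identity if it is `𝒞ⁿ⁺¹` of the disc `Dⁿ` under some substitution. -/
def IsIdentity {k : ℕ} (t : Tm k) : Prop :=
  ∃ (n : ℕ) (σ : Sub (Tree.disc n).size k), t = (unbiasedCoh (n + 1) (Tree.disc n)).sub σ

/-! ## Branches and insertion -/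

/-- Branches of a tree: non-empty lists of indices (starting from `0`) that lead to a linear subtree.
`here` is the list `[0]`, `skip` turns `k :: P` into `(k + 1) :: P`, and `down` turns `P` into
`0 :: P`. -/
inductive Branch : Tree → Type
  | here {S Ss : Tree} (m : ℕ) (h : S = Tree.disc m) : Branch (.cons S Ss)
  | skip {S Ss : Tree} (P : Branch Ss) : Branch (.cons S Ss)
  | down {S Ss : Tree} (P : Branch S) : Branch (.cons S Ss)

namespace Branch

/-- The branch height: one less than the length of the list. -/
def bh : {S : Tree} → Branch S → ℕ
  | _, here _ _ => 0
  | _, skip P => P.bh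
  | _, down P => P.bh + 1

/-- The leaf height: the dimension of the locally maximal variable of the branch. -/
def lh : {S : Tree} → Branch S → ℕ
  | _, here m _ => m + 1
  | _, skip P => P.lh
  | _, down P => P.lh + 1

/-- The locally maximal variable `⌊P⌋` of a branch `P`. -/
def var : {S : Tree} → Branch S → Fin S.size
  | _, here (S := S) _ _ => Tree.inner S.top
  | _, skip P => Tree.right P.var
  | _, down P => Tree.inner P.var

end Branch

/-- The inserted tree, for a branch `P` of `S` and a tree `T` with `bh(P) ≤ th(T)`. -/
def insTree : {S : Tree} → (P : Branch S) → (T : Tree) → P.bh ≤ T.th → Tree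
  | _, .here (Ss := Ss) _ _, T, _ => T.append Ss
  | _, .skip (S := S) P, T, h => .cons S (insTree P T h)
  | _, .down (Ss := Ss) P, .cons T .nil, h =>
      .cons (insTree P T (Nat.le_of_succ_le_succ h)) Ss
  | _, .down _, .nil, h => absurd h (Nat.not_succ_le_zero _)
  | _, .down _, .cons _ (.cons _ _), h => absurd h (Nat.not_succ_le_zero _)

/-- The interior substitution `ι` from `T` to the inserted tree. -/
def interior : {S : Tree} → (P : Branch S) → (T : Tree) → (h : P.bh ≤ T.th) →
    Sub T.size (insTree P T h).size
  | _, .here (Ss := Ss) _ _, T, _ => fun i => .var (T.appendInl Ss i)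
  | _, .skip P, T, h => fun i => (interior P T h i).rename Tree.right
  | _, .down P, .cons T .nil, h => fun i =>
      (Sub.susp (interior P T (Nat.le_of_succ_le_succ h)) i).rename wedgeInl
  | _, .down _, .nil, h => absurd h (Nat.not_succ_le_zero _)
  | _, .down _, .cons _ (.cons _ _), h => absurd h (Nat.not_succ_le_zero _)

/-- The exterior substitution `κ` from `S` to the inserted tree. -/
def exterior : {S : Tree} → (P : Branch S) → (T : Tree) → (h : P.bh ≤ T.th) →
    Sub S.size (insTree P T h).size
  | _, .here (Ss := Ss) m rfl, T, _ =>
      wedgeCases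
        (fun i => (discSub (m + 1) (unbiasedTy (m + 1) T) (unbiasedCoh (m + 1) T) i).rename
          (T.appendInl Ss))
        (fun j => .var (T.appendInr Ss j))
  | _, .skip P, T, h =>
      Tree.varCases (.var (Tree.first _)) (fun i => .var (Tree.inner i))
        (fun j => (exterior P T h j).rename Tree.right)
  | _, .down P, .cons T .nil, h =>
      wedgeCases
        (fun i => (Sub.susp (exterior P T (Nat.le_of_succ_le_succ h)) i).rename wedgeInl)
        (fun j => .var (Tree.right j))
  | _, .down _, .nil, h => absurd h (Nat.not_succ_le_zero _)
  | _, .down _, .cons _ (.cons _ _), h => absurd h (Nat.not_succ_le_zero _)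

/-- Labellings `t₀ L₁ t₁ ⋯ Lₙ tₙ` of a tree `[T₁, …, Tₙ]` by terms over `k` variables. -/
inductive Lab (k : ℕ) : Tree → Type
  | nil (t : Tm k) : Lab k .nil
  | cons {T Ts : Tree} (t : Tm k) (L : Lab k T) (M : Lab k Ts) : Lab k (.cons T Ts)

namespace Lab

/-- The first term of a labelling. -/
def first {k : ℕ} : {T : Tree} → Lab k T → Tm k
  | _, nil t => t
  | _, cons t _ _ => t

/-- Replace the first term of a labelling. -/
def setFirst {k : ℕ} (u : Tm k) : {T : Tree} → Lab k T → Lab k T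
  | _, nil _ => nil u
  | _, cons _ L M => cons u L M

/-- The labelling of `T ++ U` by a labelling of `T` followed by one of `U` without its first term. -/
def append {k : ℕ} : {T U : Tree} → Lab k T → Lab k U → Lab k (T.append U)
  | _, _, nil t, N => N.setFirst t
  | _, _, cons t L M, N => cons t L (M.append N)

/-- The substitution given by a labelling. -/
def toSub {k : ℕ} : {T : Tree} → Lab k T → Sub T.size k
  | _, nil t => fun _ => t
  | _, cons t L M => Tree.varCases t L.toSub M.toSub

/-- The labelling given by a substitution. -/
def ofSub {k : ℕ} : (T : Tree) → Sub T.size k → Lab k T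
  | .nil, σ => nil (σ (Tree.first _))
  | .cons T Ts, σ =>
      cons (σ (Tree.first _)) (ofSub T (fun i => σ (Tree.inner i)))
        (ofSub Ts (fun i => σ (Tree.right i)))

/-- The inserted labelling. -/
def ins {k : ℕ} : {S : Tree} → (P : Branch S) → (T : Tree) → (h : P.bh ≤ T.th) →
    Lab k S → Lab k T → Lab k (insTree P T h)
  | _, .here _ _, _, _, cons _ _ R, M => M.append R
  | _, .skip P, T, h, cons s L R, M => cons s L (ins P T h R M)
  | _, .down P, .cons T .nil, h, cons _ L R, cons t M (nil u) =>
      cons t (ins P T (Nat.le_of_succ_le_succ h) L M) (R.setFirst u)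
  | _, .down _, .nil, h, _, _ => absurd h (Nat.not_succ_le_zero _)
  | _, .down _, .cons _ (.cons _ _), h, _, _ => absurd h (Nat.not_succ_le_zero _)

end Lab

/-- The inserted substitution from the inserted tree to `Γ`, for `σ : S → Γ` and `τ : T → Γ`. -/
def insSub {k : ℕ} {S : Tree} (P : Branch S) (T : Tree) (h : P.bh ≤ T.th) (σ : Sub S.size k)
    (τ : Sub T.size k) : Sub (insTree P T h).size k :=
  (Lab.ins P T h (Lab.ofSub S σ) (Lab.ofSub T τ)).toSub

/-- `(S, P, T, Γ, σ, τ)` is an insertion redex, where `Γ` has `k` variables. -/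
structure IsInsertionRedex {k : ℕ} (S : Tree) (P : Branch S) (T : Tree) (σ : Sub S.size k)
    (τ : Sub T.size k) : Prop where
  /-- `(S, P, T)` is an insertion point. -/
  height : P.bh ≤ T.th
  /-- The argument at `P` is an unbiased coherence over `T`. -/
  arg : σ P.var = (unbiasedCoh P.lh T).sub τ

/-! ## Typing and equality, relative to a set of equality generators -/

/-- A set of equality generators `(Γ, s, t)`. -/
abbrev Rules : Type := ∀ {n : ℕ}, Ctx n → Tm n → Tm n → Prop

mutual
/-- `Γ ⊢`. -/
inductive CtxOk (R : Rules) : {n : ℕ} → Ctx n → Prop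
  | nil : CtxOk R .nil
  | snoc {n : ℕ} {Γ : Ctx n} {A : Ty n} : CtxOk R Γ → TyOk R Γ A → CtxOk R (.snoc Γ A)

/-- `Γ ⊢ A`. -/
inductive TyOk (R : Rules) : {n : ℕ} → Ctx n → Ty n → Prop
  | star {n : ℕ} {Γ : Ctx n} : TyOk R Γ .star
  | arr {n : ℕ} {Γ : Ctx n} {s t : Tm n} {A : Ty n} :
      TyOk R Γ A → HasType R Γ s A → HasType R Γ t A → TyOk R Γ (.arr s A t)

/-- `Γ ⊢ t : A`.  The pasting contexts are the contexts generated by trees. -/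
inductive HasType (R : Rules) : {n : ℕ} → Ctx n → Tm n → Ty n → Prop
  | var {n : ℕ} {Γ : Ctx n} (i : Fin n) : CtxOk R Γ → HasType R Γ (.var i) (Γ.ty i)
  | comp {n : ℕ} {Γ : Ctx n} {T : Tree} {d : ℕ} {s t : Tm T.size} {A : Ty T.size}
      {σ : Sub T.size n} :
      T.dim = d + 1 →
      TyOk R T.ctx (.arr s A t) →
      SubOk R Γ T.ctx σ →
      s.supp T.ctx = Sub.supp T.ctx (fun i => .var (T.bdryInc false d i)) →
      t.supp T.ctx = Sub.supp T.ctx (fun i => .var (T.bdryInc true d i)) →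
      HasType R Γ (.coh T.ctx (.arr s A t) σ) (.arr (s.sub σ) (A.sub σ) (t.sub σ))
  | full {n : ℕ} {Γ : Ctx n} {T : Tree} {s t : Tm T.size} {A : Ty T.size} {σ : Sub T.size n} :
      TyOk R T.ctx (.arr s A t) →
      SubOk R Γ T.ctx σ →
      s.supp T.ctx = Set.univ →
      t.supp T.ctx = Set.univ →
      HasType R Γ (.coh T.ctx (.arr s A t) σ) (.arr (s.sub σ) (A.sub σ) (t.sub σ))
  | conv {n : ℕ} {Γ : Ctx n} {t : Tm n} {A B : Ty n} :
      HasType R Γ t A → TyEq R Γ A B → HasType R Γ t B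

/-- `SubOk R Γ Δ σ` is the judgement `Γ ⊢ σ : Δ`. -/
inductive SubOk (R : Rules) : {m n : ℕ} → Ctx n → Ctx m → Sub m n → Prop
  | nil {n : ℕ} {Γ : Ctx n} {σ : Sub 0 n} : SubOk R Γ .nil σ
  | snoc {m n : ℕ} {Γ : Ctx n} {Δ : Ctx m} {A : Ty m} {σ : Sub m n} {t : Tm n} :
      SubOk R Γ Δ σ → TyOk R Δ A → HasType R Γ t (A.sub σ) →
      SubOk R Γ (.snoc Δ A) (Sub.snoc σ t)

/-- `Γ ⊢ A = B`. -/
inductive TyEq (R : Rules) : {n : ℕ} → Ctx n → Ty n → Ty n → Prop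
  | star {n : ℕ} {Γ : Ctx n} : TyEq R Γ .star .star
  | arr {n : ℕ} {Γ : Ctx n} {s s' t t' : Tm n} {A A' : Ty n} :
      TmEq R Γ s s' → TmEq R Γ t t' → TyEq R Γ A A' → TyEq R Γ (.arr s A t) (.arr s' A' t')

/-- `Γ ⊢ s = t`.  Equality of substitutions is equality of their terms. -/
inductive TmEq (R : Rules) : {n : ℕ} → Ctx n → Tm n → Tm n → Prop
  | var {n : ℕ} {Γ : Ctx n} (i : Fin n) : TmEq R Γ (.var i) (.var i)
  | symm {n : ℕ} {Γ : Ctx n} {s t : Tm n} : TmEq R Γ s t → TmEq R Γ t s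
  | trans {n : ℕ} {Γ : Ctx n} {s t u : Tm n} : TmEq R Γ s t → TmEq R Γ t u → TmEq R Γ s u
  | coh {m n : ℕ} {Γ : Ctx n} {Δ : Ctx m} {A B : Ty m} {σ τ : Sub m n} :
      TyEq R Δ A B → (∀ i, TmEq R Γ (σ i) (τ i)) → TmEq R Γ (.coh Δ A σ) (.coh Δ B τ)
  | rule {n : ℕ} {Γ : Ctx n} {s t : Tm n} {A : Ty n} :
      R Γ s t → HasType R Γ s A → TmEq R Γ s t
end

/-! ## The generators of `Catt_sua` -/

/-- Disc removal, endo-coherence removal and insertion. -/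
inductive Sua : {n : ℕ} → Ctx n → Tm n → Tm n → Prop
  | discRemoval {n : ℕ} {Γ : Ctx n} (A : Ty n) (s : Tm n) :
      Sua Γ ((unbiasedCoh A.dim (Tree.disc A.dim)).sub (discSub A.dim A s)) s
  | endo {m n : ℕ} {Γ : Ctx n} (Δ : Ctx m) (s : Tm m) (A : Ty m) (σ : Sub m n) :
      ¬ IsIdentity (.coh Δ (.arr s A s) σ) →
      Sua Γ (.coh Δ (.arr s A s) σ)
        ((unbiasedCoh (A.dim + 1) (Tree.disc A.dim)).sub (discSub A.dim (A.sub σ) (s.sub σ)))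
  | insertion {n : ℕ} {Γ : Ctx n} (S : Tree) (P : Branch S) (T : Tree) (σ : Sub S.size n)
      (τ : Sub T.size n) (h : IsInsertionRedex S P T σ τ) (A : Ty S.size) :
      (P.lh = T.dim ∨ IsIdentity (unbiasedCoh P.lh T)) →
      ¬ IsIdentity (.coh S.ctx A σ) →
      Sua Γ (.coh S.ctx A σ)
        (.coh (insTree P T h.height).ctx (A.sub (exterior P T h.height))
          (insSub P T h.height σ τ))

end Catt

/-!
Write `n` for the leaf height of the branch `P`, so that the argument of `Coh(S, A, σ)` at the
variable `P` is `𝒞_T^n⟦τ⟧`. The theorem holds because insertion into such an argument is either the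
insertion rule itself or can be routed through the insertion of a disc. The proof is an induction on
`n`.

Inverting the typing of `Coh(S, A, σ)` shows that `𝒞_T^n⟦τ⟧` is well typed, hence `𝒰_T^n` is a valid
type in `T` satisfying the support condition, which forces `dim T ≤ n` (`dim_le_of_suppOk`).

If `Coh(S, A, σ)` is an identity, `S` is a disc, `S ◁ T` is `T` (`insTree_disc`) and the type
`A⟦κ⟧` has both ends equal to `𝒞_T^n`. The reduct is then an endo-coherence, whose removal yields
the identity on `𝒞_T^n⟦τ⟧`; this is `Coh(S, A, σ)` again, since a substitution from a disc is
determined by the image of the top variable and its type (`insertion_of_isIdentity`). If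
`dim T = n` or `T = D^{n-1}`, the insertion rule applies.

Otherwise let `N = n - 1`. Now `𝒰_T^n` has both ends equal to `𝒞_T^N`, so removing the
endo-coherence `𝒞_T^n⟦τ⟧` turns the argument into the identity on `𝒞_T^N⟦τ⟧`
(`tmEq_unbiasedCoh_succ`). The rule permits the insertion of an identity, that is, of the disc
`D^N`. In the resulting tree the branch `P` is replaced by its pruning (`prune`), of the same branch
height and of leaf height `N`, and the argument there is `𝒞_T^N⟦τ⟧`. By induction `T` can be
inserted at this shorter branch. (The pruned branch exists because `bh(P) < N`: as `bh(P) ≤ th(T)`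
and `dim T ≤ N`, equality would make `T` the disc `D^N`.) The outcome is the direct insertion of `T`
at `P`:

* the trees coincide (`insTree_prune`);
* the inserted substitutions coincide (`insSub_prune`);
* the exterior substitutions, and with them the types, agree up to definitional equality
  (`tmEq_exterior_prune`); they differ at `P`, where one has the endo-coherence `𝒞_T^n` and the
  other the identity on `𝒞_T^N`.

The induction hypothesis needs the intermediate coherence to be well typed. The exterior and
inserted substitutions are therefore shown to be well typed (`subTy_exterior_disc`, `subTy_insSub`),
the exterior substitution to preserve the support condition (`suppOk_exterior_disc`), and the
definitional equality and typing to be stable under substitution (`Sua.stable`, `HasType.sub`).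
-/

namespace Catt

/-! ### Calculus of substitutions -/

mutual
theorem Ty.sub_sub {l m n : ℕ} (σ : Sub l m) (τ : Sub m n) :
    (A : Ty l) → (A.sub σ).sub τ = A.sub (fun i => (σ i).sub τ)
  | .star => by simp only [Ty.sub]
  | .arr s A t => by
      simp only [Ty.sub, Ty.sub_sub σ τ A, Tm.sub_sub σ τ s, Tm.sub_sub σ τ t]
theorem Tm.sub_sub {l m n : ℕ} (σ : Sub l m) (τ : Sub m n) :
    (t : Tm l) → (t.sub σ).sub τ = t.sub (fun i => (σ i).sub τ)
  | .var i => by simp only [Tm.sub]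
  | .coh Δ A ρ => by
      simp only [Tm.sub, fun i => Tm.sub_sub σ τ (ρ i)]
end

mutual
theorem Ty.sub_var {n : ℕ} : (A : Ty n) → A.sub Tm.var = A
  | .star => by simp only [Ty.sub]
  | .arr s A t => by simp only [Ty.sub, Ty.sub_var A, Tm.sub_var s, Tm.sub_var t]
theorem Tm.sub_var {n : ℕ} : (t : Tm n) → t.sub Tm.var = t
  | .var i => by simp only [Tm.sub]
  | .coh Δ A ρ => by simp only [Tm.sub, fun i => Tm.sub_var (ρ i)]
end

theorem Ty.rename_sub {l m n : ℕ} (f : Fin l → Fin m) (τ : Sub m n) (A : Ty l) :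
    (A.rename f).sub τ = A.sub (fun i => τ (f i)) := by
  simp only [Ty.rename, Ty.sub_sub, Tm.sub]

theorem Tm.rename_sub {l m n : ℕ} (f : Fin l → Fin m) (τ : Sub m n) (t : Tm l) :
    (t.rename f).sub τ = t.sub (fun i => τ (f i)) := by
  simp only [Tm.rename, Tm.sub_sub, Tm.sub]

theorem Ty.sub_rename {l m n : ℕ} (σ : Sub l m) (f : Fin m → Fin n) (A : Ty l) :
    (A.sub σ).rename f = A.sub (fun i => (σ i).rename f) := by
  simp only [Ty.rename, Ty.sub_sub, Tm.rename]

theorem Tm.sub_rename {l m n : ℕ} (σ : Sub l m) (f : Fin m → Fin n) (t : Tm l) :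
    (t.sub σ).rename f = t.sub (fun i => (σ i).rename f) := by
  simp only [Tm.rename, Tm.sub_sub]

theorem Ty.rename_rename {l m n : ℕ} (f : Fin l → Fin m) (g : Fin m → Fin n) (A : Ty l) :
    (A.rename f).rename g = A.rename (fun i => g (f i)) := by
  simp only [Ty.rename, Ty.sub_sub, Tm.sub]

theorem Tm.rename_var {m n : ℕ} (f : Fin m → Fin n) (i : Fin m) :
    (Tm.var i).rename f = .var (f i) := by
  simp only [Tm.rename, Tm.sub]

theorem Ty.rename_star {m n : ℕ} (f : Fin m → Fin n) : (Ty.star).rename f = .star := by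
  simp only [Ty.rename, Ty.sub]

theorem Ty.rename_arr {m n : ℕ} (f : Fin m → Fin n) (s t : Tm m) (A : Ty m) :
    (Ty.arr s A t).rename f = .arr (s.rename f) (A.rename f) (t.rename f) := by
  simp only [Ty.rename, Ty.sub, Tm.rename]

theorem Ty.dim_sub {m n : ℕ} (σ : Sub m n) : (A : Ty m) → (A.sub σ).dim = A.dim
  | .star => by simp only [Ty.sub, Ty.dim]
  | .arr s A t => by simp only [Ty.sub, Ty.dim, Ty.dim_sub σ A]

theorem Ty.dim_rename {m n : ℕ} (f : Fin m → Fin n) (A : Ty m) : (A.rename f).dim = A.dim :=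
  A.dim_sub _

/-! ### Suspension and substitution -/

theorem Sub.susp_zero {m n : ℕ} (σ : Sub m n) : σ.susp 0 = .var 0 := rfl

theorem Sub.susp_one {m n : ℕ} (σ : Sub m n) : σ.susp 1 = .var 1 := rfl

theorem Sub.susp_addNat {m n : ℕ} (σ : Sub m n) (i : Fin m) :
    σ.susp (i.addNat 2) = (σ i).susp := rfl

/-- Every variable of a suspension is a pole or a suspended variable. -/
theorem susp_var_cases {m : ℕ} (i : Fin (m + 2)) :
    i = 0 ∨ i = 1 ∨ ∃ j : Fin m, i = j.addNat 2 := by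
  refine Fin.cases (Or.inl rfl) (fun i => Fin.cases (Or.inr (Or.inl rfl)) (fun i => ?_) i) i
  exact Or.inr (Or.inr ⟨i, rfl⟩)

theorem Sub.suspOf_sub {l m n : ℕ} (f : Sub l (m + 2)) (ρ : Sub m n) :
    (fun i => (Sub.suspOf f i).sub ρ.susp) = Sub.suspOf (fun i => (f i).sub ρ.susp) := by
  funext i
  rcases susp_var_cases i with rfl | rfl | ⟨j, rfl⟩ <;> rfl

mutual
theorem Ty.susp_sub {m n : ℕ} (σ : Sub m n) :
    (A : Ty m) → (A.sub σ).susp = A.susp.sub σ.susp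
  | .star => by
      simp only [Ty.sub, Ty.susp, Tm.sub, Sub.susp_zero, Sub.susp_one]
  | .arr s A t => by
      simp only [Ty.sub, Ty.susp, Ty.susp_sub σ A, Tm.susp_sub σ s, Tm.susp_sub σ t]
theorem Tm.susp_sub {m n : ℕ} (σ : Sub m n) :
    (t : Tm m) → (t.sub σ).susp = t.susp.sub σ.susp
  | .var i => by simp only [Tm.sub, Tm.susp, Sub.susp_addNat]
  | .coh Δ A ρ => by
      simp only [Tm.sub, Tm.susp, fun i => Tm.susp_sub σ (ρ i)]
      rw [Sub.suspOf_sub]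
end

/-- Suspension of a renaming. -/
def suspMap {m n : ℕ} (f : Fin m → Fin n) : Fin (m + 2) → Fin (n + 2) :=
  Fin.cases 0 (Fin.cases 1 (fun i => (f i).addNat 2))

theorem Sub.susp_var {m n : ℕ} (f : Fin m → Fin n) :
    Sub.susp (fun i => .var (f i)) = fun i => .var (suspMap f i) := by
  funext i
  rcases susp_var_cases i with rfl | rfl | ⟨j, rfl⟩ <;> rfl

theorem Ty.susp_rename {m n : ℕ} (f : Fin m → Fin n) (A : Ty m) :
    (A.rename f).susp = A.susp.rename (suspMap f) := by
  rw [Ty.rename, Ty.susp_sub, Sub.susp_var, Ty.rename]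

theorem Tm.susp_rename {m n : ℕ} (f : Fin m → Fin n) (t : Tm m) :
    (t.rename f).susp = t.susp.rename (suspMap f) := by
  rw [Tm.rename, Tm.susp_sub, Sub.susp_var, Tm.rename]

theorem Ty.dim_susp {m : ℕ} : (A : Ty m) → A.susp.dim = A.dim + 1
  | .star => by simp only [Ty.susp, Ty.dim]
  | .arr s A t => by simp only [Ty.susp, Ty.dim, Ty.dim_susp A]

/-! ### Free variables and support -/

mutual
theorem Ty.mem_fv_sub {m n : ℕ} (σ : Sub m n) (x : Fin n) :
    (A : Ty m) → (x ∈ (A.sub σ).fv ↔ ∃ i ∈ A.fv, x ∈ (σ i).fv)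
  | .star => by simp [Ty.sub, Ty.fv]
  | .arr s A t => by
      simp only [Ty.sub, Ty.fv, Set.mem_union, Ty.mem_fv_sub σ x A, Tm.mem_fv_sub σ x s,
        Tm.mem_fv_sub σ x t, or_and_right, exists_or]
theorem Tm.mem_fv_sub {m n : ℕ} (σ : Sub m n) (x : Fin n) :
    (t : Tm m) → (x ∈ (t.sub σ).fv ↔ ∃ i ∈ t.fv, x ∈ (σ i).fv)
  | .var i => by simp [Tm.sub, Tm.fv]
  | .coh Δ A ρ => by
      simp only [Tm.sub, Tm.fv, Set.mem_ofPred_eq, fun i => Tm.mem_fv_sub σ x (ρ i)]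
      constructor
      · rintro ⟨i, j, hj, hx⟩
        exact ⟨j, ⟨i, hj⟩, hx⟩
      · rintro ⟨j, ⟨i, hj⟩, hx⟩
        exact ⟨i, j, hj, hx⟩
end

theorem Ctx.subset_downClosure {n : ℕ} (Γ : Ctx n) (X : Set (Fin n)) : X ⊆ Γ.downClosure X :=
  fun _ hx _ hY => hY.2 hx

theorem Ctx.downClosed_downClosure {n : ℕ} (Γ : Ctx n) (X : Set (Fin n)) :
    Γ.DownClosed (Γ.downClosure X) :=
  fun _ hx _ hy Y hY => hY.1 _ (hx Y hY) hy

theorem Ctx.downClosure_subset {n : ℕ} {Γ : Ctx n} {X Y : Set (Fin n)} (hY : Γ.DownClosed Y)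
    (h : X ⊆ Y) : Γ.downClosure X ⊆ Y :=
  fun _ hx => hx Y ⟨hY, h⟩

theorem Ctx.downClosure_mono {n : ℕ} (Γ : Ctx n) {X Y : Set (Fin n)} (h : X ⊆ Y) :
    Γ.downClosure X ⊆ Γ.downClosure Y :=
  Ctx.downClosure_subset (Γ.downClosed_downClosure Y) (h.trans (Γ.subset_downClosure Y))

/-! ### Variables of suspensions, wedge sums and trees -/

theorem Ctx.ty_snoc_castSucc {n : ℕ} (Γ : Ctx n) (A : Ty n) (i : Fin n) :
    (Ctx.snoc Γ A).ty i.castSucc = (Γ.ty i).rename Fin.castSucc := by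
  simp only [Ctx.ty, Fin.lastCases_castSucc]

theorem Ctx.ty_snoc_last {n : ℕ} (Γ : Ctx n) (A : Ty n) :
    (Ctx.snoc Γ A).ty (Fin.last n) = A.rename Fin.castSucc := by
  simp only [Ctx.ty, Fin.lastCases_last]

theorem suspMap_castSucc {n : ℕ} (i : Fin (n + 2)) :
    suspMap (Fin.castSucc (n := n)) i = i.castSucc := by
  rcases susp_var_cases i with rfl | rfl | ⟨j, rfl⟩ <;> rfl

theorem Ctx.ty_susp : {n : ℕ} → (Γ : Ctx n) →
    Γ.susp.ty 0 = .star ∧ Γ.susp.ty 1 = .star ∧ ∀ i, Γ.susp.ty (i.addNat 2) = (Γ.ty i).susp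
  | _, .nil => by
      refine ⟨?_, ?_, fun i => i.elim0⟩
      · simp only [Ctx.susp]
        exact (Ctx.ty_snoc_castSucc _ _ (0 : Fin 1)).trans
          (congrArg _ (Ctx.ty_snoc_last _ _))
      · simp only [Ctx.susp]
        exact Ctx.ty_snoc_last _ _
  | _, .snoc (n := n) Γ A => by
      obtain ⟨h0, h1, h2⟩ := Ctx.ty_susp Γ
      simp only [Ctx.susp]
      refine ⟨?_, ?_, fun i => ?_⟩
      · refine (Ctx.ty_snoc_castSucc _ _ (0 : Fin (n + 2))).trans ?_
        rw [h0, Ty.rename_star]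
      · refine (Ctx.ty_snoc_castSucc _ _ (1 : Fin (n + 2))).trans ?_
        rw [h1, Ty.rename_star]
      · refine Fin.lastCases ?_ (fun i => ?_) i
        · refine (Ctx.ty_snoc_last _ _).trans ?_
          rw [Ctx.ty_snoc_last, Ty.susp_rename, funext suspMap_castSucc]
        · refine (Ctx.ty_snoc_castSucc _ _ (i.addNat 2)).trans ?_
          rw [Ctx.ty_snoc_castSucc, Ty.susp_rename, funext suspMap_castSucc, h2]

theorem Ctx.ty_wedge_inl {n : ℕ} (Γ : Ctx n) (p : Fin n) : {m : ℕ} → (Δ : Ctx m) → (i : Fin n) →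
    (Γ.wedge p Δ).ty (wedgeInl i) = (Γ.ty i).rename (wedgeInl (m := m))
  | _, .nil, i => (Ty.sub_var _).symm
  | _, .snoc (n := 0) _ _, i => (Ty.sub_var _).symm
  | _, .snoc (n := m + 1) Δ A, i => by
      simp only [Ctx.wedge]
      refine (Ctx.ty_snoc_castSucc _ _ (wedgeInl i)).trans ?_
      rw [Ctx.ty_wedge_inl Γ p Δ i, Ty.rename_rename]
      rfl

theorem wedgeInr_zero {n m : ℕ} (p : Fin n) :
    wedgeInr (m := m + 1) p 0 = wedgeInl p := rfl

theorem wedgeInr_castSucc {n m : ℕ} (p : Fin n) (i : Fin (m + 1)) :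
    wedgeInr p i.castSucc = (wedgeInr p i).castSucc := by
  refine Fin.cases rfl (fun i => rfl) i

theorem Ctx.ty_wedge_inr {n : ℕ} (Γ : Ctx n) (p : Fin n) (hp : Γ.ty p = .star) :
    {m : ℕ} → (Δ : Ctx (m + 1)) → Δ.ty 0 = .star → (i : Fin (m + 1)) →
    (Γ.wedge p Δ).ty (wedgeInr p i) = (Δ.ty i).rename (wedgeInr p)
  | 0, Δ, h0, i => by
      obtain rfl : i = 0 := Fin.ext (by omega)
      rw [wedgeInr_zero, Ctx.ty_wedge_inl, hp, h0, Ty.rename_star, Ty.rename_star]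
  | m + 1, .snoc Δ A, h0, i => by
      have h0' : Δ.ty 0 = .star := by
        have h : (Ctx.snoc Δ A).ty (Fin.castSucc 0) = .star := h0
        rw [Ctx.ty_snoc_castSucc] at h
        cases hB : Δ.ty 0 with
        | star => rfl
        | arr s B t => rw [hB, Ty.rename_arr] at h; cases h
      refine Fin.lastCases ?_ (fun i => ?_) i
      · simp only [Ctx.wedge]
        refine (Ctx.ty_snoc_last _ _).trans ?_
        rw [Ctx.ty_snoc_last, Ty.rename_rename, Ty.rename_rename]
        congr 1
        funext i
        exact (wedgeInr_castSucc p i).symm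
      · simp only [Ctx.wedge]
        rw [wedgeInr_castSucc]
        refine (Ctx.ty_snoc_castSucc _ _ (wedgeInr p i)).trans ?_
        rw [Ctx.ty_snoc_castSucc, Ctx.ty_wedge_inr Γ p hp Δ h0' i, Ty.rename_rename,
          Ty.rename_rename]
        congr 1
        funext i
        exact (wedgeInr_castSucc p i).symm

theorem wedgeCases_inl {n m : ℕ} {α : Type} (f : Fin n → α) (g : Fin m → α) (i : Fin n) :
    wedgeCases f g (wedgeInl i) = f i :=
  Fin.addCases_left _

theorem wedgeCases_inr {n m : ℕ} {α : Type} (p : Fin n) (f : Fin n → α) (g : Fin m → α)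
    (hm : 0 < m) (h : f p = g ⟨0, hm⟩) (j : Fin m) : wedgeCases f g (wedgeInr p j) = g j := by
  obtain ⟨j, hj⟩ := j
  cases j with
  | zero => exact (wedgeCases_inl f g p).trans h
  | succ j => exact Fin.addCases_right (m := n) (n := m - 1) ⟨j, by omega⟩

namespace Tree

theorem varCases_first {α : Type} {T Ts : Tree} (a : α) (f : Fin T.size → α)
    (g : Fin Ts.size → α) : varCases a f g (first (cons T Ts)) = a :=
   wedgeCases_inl (n := T.size + 2) _ _ 0

theorem varCases_inner {α : Type} {T Ts : Tree} (a : α) (f : Fin T.size → α)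
    (g : Fin Ts.size → α) (i : Fin T.size) : varCases a f g (inner i) = f i :=
   wedgeCases_inl (n := T.size + 2) _ _ (i.addNat 2)

theorem varCases_right {α : Type} {T Ts : Tree} (a : α) (f : Fin T.size → α)
    (g : Fin Ts.size → α) (j : Fin Ts.size) : varCases a f g (right j) = g j :=
   wedgeCases_inr (n := T.size + 2) 1 _ _ Ts.size_pos rfl j

/-- Every variable of `⌊[T₁, …, Tₙ]⌋` is the first one, or comes from `⌊T₁⌋`, or comes from
`⌊[T₂, …, Tₙ]⌋`. -/
theorem var_cases {T Ts : Tree} (i : Fin (cons T Ts).size) :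
    i = first _ ∨ (∃ j, i = inner j) ∨ ∃ j, i = right j := by
  obtain ⟨i, hi⟩ := i
  have hi' : i < T.size + 2 + (Ts.size - 1) := hi
  rcases i with _ | _ | i
  · exact Or.inl rfl
  · exact Or.inr (Or.inr ⟨Ts.first, rfl⟩)
  · by_cases h : i < T.size
    · exact Or.inr (Or.inl ⟨⟨i, h⟩, rfl⟩)
    · refine Or.inr (Or.inr ⟨⟨i - T.size + 1, by omega⟩, Fin.ext ?_⟩)
      simp only [right, wedgeInr]
      omega

theorem inner_injective {T Ts : Tree} : Function.Injective (inner (T := T) (Ts := Ts)) := by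
  intro i j h
  have := congrArg Fin.val h
  simp only [inner, wedgeInl, Fin.val_castAdd, Fin.val_addNat] at this
  exact Fin.ext (by omega)

theorem right_injective {T Ts : Tree} : Function.Injective (right (T := T) (Ts := Ts)) := by
  intro i j h
  have h1 := congrFun (congrArg (fun k => fun g : Fin Ts.size → ℕ =>
    varCases (T := T) 0 (fun _ => 0) g k) h) (fun k => k.val)
  simp only [varCases_right] at h1
  exact Fin.ext h1

theorem first_ne_inner {T Ts : Tree} (i : Fin T.size) : first (cons T Ts) ≠ inner i := by
  intro h
  have := congrArg (varCases (T := T) (Ts := Ts) 0 (fun _ => 1) (fun _ => 2)) h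
  simp [varCases_first, varCases_inner] at this

theorem first_ne_right {T Ts : Tree} (i : Fin Ts.size) : first (cons T Ts) ≠ right i := by
  intro h
  have := congrArg (varCases (T := T) (Ts := Ts) 0 (fun _ => 1) (fun _ => 2)) h
  simp [varCases_first, varCases_right] at this

theorem inner_ne_right {T Ts : Tree} (i : Fin T.size) (j : Fin Ts.size) :
    inner i ≠ right j := by
  intro h
  have := congrArg (varCases (T := T) (Ts := Ts) 0 (fun _ => 1) (fun _ => 2)) h
  simp [varCases_inner, varCases_right] at this

theorem varCases_ext {α : Type} {T Ts : Tree} {F G : Fin (cons T Ts).size → α}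
    (h1 : F (first _) = G (first _)) (h2 : ∀ i, F (inner i) = G (inner i))
    (h3 : ∀ i, F (right i) = G (right i)) : F = G := by
  funext i
  rcases var_cases i with rfl | ⟨j, rfl⟩ | ⟨j, rfl⟩
  exacts [h1, h2 j, h3 j]

/-- The variable of `⌊[T₁, …, Tₙ]⌋` given by a variable of `Σ⌊T₁⌋`. -/
def inl {T Ts : Tree} (i : Fin (T.size + 2)) : Fin (cons T Ts).size := wedgeInl i

theorem ty_inl {T Ts : Tree} (i : Fin (T.size + 2)) :
    (cons T Ts).ctx.ty (inl i) = (T.ctx.susp.ty i).rename inl :=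
  Ctx.ty_wedge_inl _ _ _ _

theorem ty_first : (T : Tree) → T.ctx.ty T.first = .star
  | nil => Ctx.ty_snoc_last _ _
  | cons T Ts => by
      refine (ty_inl (T := T) (Ts := Ts) 0).trans ?_
      exact (congrArg _ (Ctx.ty_susp _).1).trans (Ty.rename_star _)

theorem ty_inner {T Ts : Tree} (i : Fin T.size) :
    (cons T Ts).ctx.ty (inner i) = (T.ctx.ty i).susp.rename inl := by
  refine (ty_inl (i.addNat 2)).trans ?_
  rw [(Ctx.ty_susp _).2.2]

theorem ty_right {T Ts : Tree} (i : Fin Ts.size) :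
    (cons T Ts).ctx.ty (right i) = (Ts.ctx.ty i).rename right := by
  obtain ⟨m, hm⟩ : ∃ m, Ts.size = m + 1 := ⟨Ts.size - 1, by have := Ts.size_pos; omega⟩
  have h0 := ty_first Ts
  have key : ∀ {m' : ℕ} (Δ : Ctx m') (hm' : m' = m + 1) (z : Fin m'), z.val = 0 →
      Δ.ty z = .star → ∀ i, (T.ctx.susp.wedge 1 Δ).ty (wedgeInr 1 i) =
        (Δ.ty i).rename (wedgeInr 1) := by
    intro m' Δ hm' z hz h0 i
    subst hm'
    obtain rfl : z = 0 := Fin.ext hz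
    exact Ctx.ty_wedge_inr _ _ (Ctx.ty_susp _).2.1 _ h0 i
  exact key Ts.ctx hm Ts.first rfl h0 i

end Tree

/-! ### Globular contexts -/

/-- A type over `Γ` is globular if it is `⋆`, or an arrow between two variables whose type in `Γ` is
the globular type recorded in the arrow. -/
inductive Glob {n : ℕ} (Γ : Ctx n) : Ty n → Prop
  | star : Glob Γ .star
  | arr {A : Ty n} (a b : Fin n) : Γ.ty a = A → Γ.ty b = A → Glob Γ A →
      Glob Γ (.arr (.var a) A (.var b))

/-- A map of variables that respects the types of two contexts. -/
def TyCompat {m n : ℕ} (Γ : Ctx m) (Δ : Ctx n) (f : Fin m → Fin n) : Prop :=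
  ∀ i, Δ.ty (f i) = (Γ.ty i).rename f

theorem Glob.rename {m n : ℕ} {Γ : Ctx m} {Δ : Ctx n} {f : Fin m → Fin n}
    (hf : TyCompat Γ Δ f) {A : Ty m} (hA : Glob Γ A) : Glob Δ (A.rename f) := by
  induction hA with
  | star => rw [Ty.rename_star]; exact .star
  | arr a b ha hb _ ih =>
      rw [Ty.rename_arr, Tm.rename_var, Tm.rename_var]
      exact .arr _ _ (by rw [hf, ha]) (by rw [hf, hb]) ih

theorem Glob.susp {n : ℕ} {Γ : Ctx n} {A : Ty n} (hA : Glob Γ A) : Glob Γ.susp A.susp := by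
  induction hA with
  | star =>
      exact .arr _ _ Γ.ty_susp.1 Γ.ty_susp.2.1 .star
  | arr a b ha hb _ ih =>
      exact .arr _ _ (by rw [Γ.ty_susp.2.2, ha]) (by rw [Γ.ty_susp.2.2, hb]) ih

theorem Tree.tyCompat_inl {T Ts : Tree} :
    TyCompat T.ctx.susp (Tree.cons T Ts).ctx Tree.inl := fun i => Tree.ty_inl i

theorem Tree.tyCompat_right {T Ts : Tree} :
    TyCompat Ts.ctx (Tree.cons T Ts).ctx Tree.right := fun i => Tree.ty_right i

theorem Tree.glob : (T : Tree) → (i : Fin T.size) → Glob T.ctx (T.ctx.ty i)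
  | .nil, i => by
      obtain rfl : i = Tree.first _ := Fin.ext (Nat.lt_one_iff.1 i.2)
      rw [Tree.ty_first]
      exact .star
  | .cons T Ts, i => by
      rcases Tree.var_cases i with rfl | ⟨j, rfl⟩ | ⟨j, rfl⟩
      · rw [Tree.ty_first]
        exact .star
      · rw [Tree.ty_inner]
        exact (Tree.glob T j).susp.rename Tree.tyCompat_inl
      · rw [Tree.ty_right]
        exact (Tree.glob Ts j).rename Tree.tyCompat_right

theorem Glob.dim_lt {n : ℕ} {Γ : Ctx n} {A : Ty n} (hA : Glob Γ A) :
    ∀ x ∈ A.fv, (Γ.ty x).dim < A.dim := by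
  induction hA with
  | star => intro x hx; simp [Ty.fv] at hx
  | arr a b ha hb _ ih =>
      intro x hx
      simp only [Ty.fv, Tm.fv, Set.mem_union, Set.mem_singleton_iff] at hx
      rcases hx with (rfl | hx) | rfl
      · rw [ha]; exact Nat.lt_succ_self _
      · exact (ih x hx).trans (Nat.lt_succ_self _)
      · rw [hb]; exact Nat.lt_succ_self _

theorem Tree.downClosed_dim_le (T : Tree) (d : ℕ) :
    T.ctx.DownClosed {x | (T.ctx.ty x).dim ≤ d} :=
  fun x hx y hy => (((T.glob x).dim_lt y hy).le).trans hx

theorem Tm.eq_var_of_rename {m n : ℕ} {f : Fin m → Fin n} {s : Tm m} {a : Fin n}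
    (h : s.rename f = .var a) : ∃ b, s = .var b ∧ f b = a := by
  cases s with
  | var b =>
      rw [Tm.rename_var] at h
      exact ⟨b, rfl, Tm.var.inj h⟩
  | coh Δ A σ => simp only [Tm.rename, Tm.sub, reduceCtorEq] at h

theorem Ty.rename_castSucc_injective {n : ℕ} (z : Tm n) {A B : Ty n}
    (h : A.rename Fin.castSucc = B.rename Fin.castSucc) : A = B := by
  have key : ∀ C : Ty n, (C.rename Fin.castSucc).sub (Sub.snoc Tm.var z) = C := by
    intro C
    rw [Ty.rename_sub]
    simp only [Sub.snoc, Fin.lastCases_castSucc]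
    exact C.sub_var
  rw [← key A, h, key B]

theorem Glob.of_snoc {n : ℕ} {Γ : Ctx n} {B : Ty n} : (A : Ty n) →
    Glob (Γ.snoc B) (A.rename Fin.castSucc) → Glob Γ A
  | .star, _ => .star
  | .arr s A t, h => by
      rw [Ty.rename_arr] at h
      generalize hs : s.rename Fin.castSucc = s' at h
      generalize ht : t.rename Fin.castSucc = t' at h
      generalize hA' : A.rename Fin.castSucc = A' at h
      cases h with
      | arr a b ha hb hA =>
        obtain ⟨a, rfl, rfl⟩ := Tm.eq_var_of_rename hs
        obtain ⟨b, rfl, rfl⟩ := Tm.eq_var_of_rename ht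
        subst hA'
        rw [Ctx.ty_snoc_castSucc] at ha hb
        exact .arr a b (Ty.rename_castSucc_injective (.var a) ha)
          (Ty.rename_castSucc_injective (.var a) hb) (Glob.of_snoc A hA)

theorem TyOk.of_glob {R : Rules} {n : ℕ} {Γ : Ctx n} (hΓ : CtxOk R Γ) {A : Ty n}
    (hA : Glob Γ A) : TyOk R Γ A := by
  induction hA with
  | star => exact .star
  | arr a b ha hb _ ih =>
      exact .arr ih (ha ▸ HasType.var a hΓ) (hb ▸ HasType.var b hΓ)

/-- A context whose types are globular is well formed for any set of generators. -/
theorem CtxOk.of_glob {R : Rules} : {n : ℕ} → (Γ : Ctx n) → (∀ i, Glob Γ (Γ.ty i)) → CtxOk R Γ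
  | _, .nil, _ => .nil
  | _, .snoc Γ A, h => by
      have hΓ : CtxOk R Γ := CtxOk.of_glob Γ (fun i =>
        Glob.of_snoc _ (Ctx.ty_snoc_castSucc Γ A i ▸ h i.castSucc))
      exact .snoc hΓ (.of_glob hΓ (Glob.of_snoc _ (Ctx.ty_snoc_last Γ A ▸ h (Fin.last _))))

theorem Tree.ctxOk (R : Rules) (T : Tree) : CtxOk R T.ctx := .of_glob _ T.glob

/-! ### Trees are determined by their contexts -/

/-- The list of dimensions of the variables of a context. -/
def Ctx.dims : {n : ℕ} → Ctx n → List ℕ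
  | _, .nil => []
  | _, .snoc Γ A => Γ.dims ++ [A.dim]

theorem Ctx.dims_susp : {n : ℕ} → (Γ : Ctx n) → Γ.susp.dims = 0 :: 0 :: Γ.dims.map (· + 1)
  | _, .nil => rfl
  | _, .snoc Γ A => by
      simp only [Ctx.susp, Ctx.dims, Ctx.dims_susp Γ, Ty.dim_susp, List.map_append, List.map_cons,
        List.map_nil, List.cons_append]

theorem Ctx.dims_wedge {n : ℕ} (Γ : Ctx n) (p : Fin n) : {m : ℕ} → (Δ : Ctx m) →
    (Γ.wedge p Δ).dims = Γ.dims ++ Δ.dims.tail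
  | _, .nil => (List.append_nil _).symm
  | _, .snoc (n := 0) .nil _ => (List.append_nil _).symm
  | _, .snoc (n := m + 1) Δ A => by
      have hne : Δ.dims ≠ [] := by
        cases Δ with
        | snoc Δ B => simp [Ctx.dims]
      simp only [Ctx.wedge, Ctx.dims, Ctx.dims_wedge Γ p Δ, Ty.dim_rename]
      rw [List.tail_append_of_ne_nil hne, List.append_assoc]

namespace Tree

theorem dims_cons (T Ts : Tree) :
    (cons T Ts).ctx.dims = 0 :: 0 :: (T.ctx.dims.map (· + 1) ++ Ts.ctx.dims.tail) := by
  refine (Ctx.dims_wedge _ _ _).trans ?_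
  rw [Ctx.dims_susp]
  rfl

theorem dims_eq_cons : (T : Tree) → T.ctx.dims = 0 :: T.ctx.dims.tail
  | nil => rfl
  | cons T Ts => by rw [dims_cons]; rfl

theorem tail_dims (T : Tree) : T.ctx.dims.tail = [] ∨ ∃ l, T.ctx.dims.tail = 0 :: l := by
  cases T with
  | nil => exact Or.inl rfl
  | cons T Ts => exact Or.inr ⟨_, by rw [dims_cons]; rfl⟩

/-- A list of positive numbers followed by a list that is empty or starts with `0` determines
both. -/
theorem append_succ_cancel : {l l' r r' : List ℕ} → (r = [] ∨ ∃ u, r = 0 :: u) →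
    (r' = [] ∨ ∃ u, r' = 0 :: u) → l.map (· + 1) ++ r = l'.map (· + 1) ++ r' → l = l' ∧ r = r'
  | [], [], _, _, _, _, h => ⟨rfl, h⟩
  | [], a :: l', r, r', hr, _, h => by
      rcases hr with rfl | ⟨u, rfl⟩ <;> simp at h
  | a :: l, [], r, r', _, hr, h => by
      rcases hr with rfl | ⟨u, rfl⟩ <;> simp at h
  | a :: l, b :: l', r, r', hr, hr', h => by
      simp only [List.map_cons, List.cons_append, List.cons.injEq, Nat.add_right_cancel_iff] at h
      obtain ⟨h1, h2⟩ := append_succ_cancel hr hr' h.2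
      exact ⟨by rw [h.1, h1], h2⟩

/-- A list entry `T₁` contributes positive dimensions, and the next entry starts with a `0`, so the
list of dimensions can be parsed. -/
theorem dims_injective : (T U : Tree) → T.ctx.dims = U.ctx.dims → T = U
  | nil, nil, _ => rfl
  | nil, cons U Us, h => by rw [dims_cons] at h; cases h
  | cons T Ts, nil, h => by rw [dims_cons] at h; cases h
  | cons T Ts, cons U Us, h => by
      rw [dims_cons, dims_cons] at h
      simp only [List.cons.injEq, true_and] at h
      obtain ⟨h1, h2⟩ := append_succ_cancel (tail_dims Ts) (tail_dims Us) h
      rw [dims_injective T U h1,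
        dims_injective Ts Us (by rw [dims_eq_cons Ts, dims_eq_cons Us, h2])]

/-- The dimensions of the variables determine a tree, so its context does. This identifies the tree
of a coherence that is an identity or to which the typing rules apply. -/
theorem ctx_injective {T U : Tree} (hs : T.size = U.size) (h : HEq T.ctx U.ctx) : T = U := by
  refine dims_injective T U ?_
  have key : ∀ {m n : ℕ} (Γ : Ctx m) (Δ : Ctx n), m = n → HEq Γ Δ → Γ.dims = Δ.dims := by
    intro m n Γ Δ hmn hh
    subst hmn
    rw [eq_of_heq hh]
  exact key _ _ hs h

/-! ### Boundaries of trees -/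

theorem dim_ty_inner {T Ts : Tree} (i : Fin T.size) :
    ((cons T Ts).ctx.ty (inner i)).dim = (T.ctx.ty i).dim + 1 := by
  rw [ty_inner, Ty.dim_rename, Ty.dim_susp]

theorem dim_ty_right {T Ts : Tree} (i : Fin Ts.size) :
    ((cons T Ts).ctx.ty (right i)).dim = (Ts.ctx.ty i).dim := by
  rw [ty_right, Ty.dim_rename]

theorem ty_lastObj : (T : Tree) → T.ctx.ty T.lastObj = .star
  | nil => ty_first nil
  | cons T Ts => by rw [lastObj, ty_right, ty_lastObj Ts, Ty.rename_star]

theorem nil_var (i : Fin nil.size) : i = first nil := Fin.ext (Nat.lt_one_iff.1 i.2)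

theorem bdryInc_false_zero (T : Tree) (i : Fin (bdry 0 T).size) :
    bdryInc false 0 T i = T.first := by
  simp [bdryInc]

theorem bdryInc_true_zero (T : Tree) (i : Fin (bdry 0 T).size) :
    bdryInc true 0 T i = T.lastObj := by
  simp [bdryInc]

theorem bdry_zero (T : Tree) : bdry 0 T = nil := by
  simp [bdry]

theorem dim_ty_bdryInc_le (ε : Bool) : (n : ℕ) → (T : Tree) → (i : Fin (bdry n T).size) →
    (T.ctx.ty (bdryInc ε n T i)).dim ≤ n
  | 0, T, i => by
      cases ε
      · rw [bdryInc_false_zero, ty_first]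
        exact le_rfl
      · rw [bdryInc_true_zero, ty_lastObj]
        exact le_rfl
  | n + 1, nil, i => by
      rw [nil_var (bdryInc ε (n + 1) nil i), ty_first]
      exact Nat.zero_le _
  | n + 1, cons T Ts, i => by
      rcases var_cases (T := bdry n T) (Ts := bdry (n + 1) Ts) i with rfl | ⟨j, rfl⟩ | ⟨j, rfl⟩
      · rw [bdryInc, varCases_first, ty_first]
        exact Nat.zero_le _
      · rw [bdryInc, varCases_inner, dim_ty_inner]
        exact Nat.succ_le_succ (dim_ty_bdryInc_le ε n T j)
      · rw [bdryInc, varCases_right, dim_ty_right]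
        exact dim_ty_bdryInc_le ε (n + 1) Ts j

/-- The `d`-dimensional boundary of a tree of dimension at least `d` has a variable of
dimension `d`. -/
theorem exists_dim_ty_bdryInc_eq (ε : Bool) : (d : ℕ) → (T : Tree) → d ≤ T.dim →
    ∃ i, (T.ctx.ty (bdryInc ε d T i)).dim = d
  | 0, T, _ => ⟨first _, Nat.le_zero.1 (dim_ty_bdryInc_le ε 0 T _)⟩
  | d + 1, nil, h => absurd h (Nat.not_succ_le_zero _)
  | d + 1, cons T Ts, h => by
      rw [dim, le_max_iff] at h
      rcases h with h | h
      · obtain ⟨i, hi⟩ := exists_dim_ty_bdryInc_eq ε d T (Nat.le_of_succ_le_succ h)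
        refine ⟨inner (T := bdry d T) (Ts := bdry (d + 1) Ts) i, ?_⟩
        rw [bdryInc, varCases_inner, dim_ty_inner, hi]
      · obtain ⟨i, hi⟩ := exists_dim_ty_bdryInc_eq ε (d + 1) Ts h
        refine ⟨right (T := bdry d T) (Ts := bdry (d + 1) Ts) i, ?_⟩
        rw [bdryInc, varCases_right, dim_ty_right, hi]

/-- In dimension at least `dim T`, the boundary of `T` is `T`, included by the identity. -/
theorem bdry_of_dim_le (ε : Bool) : (n : ℕ) → (T : Tree) → T.dim ≤ n →
    (⟨bdry n T, bdryInc ε n T⟩ : Σ X : Tree, Fin X.size → Fin T.size) = ⟨T, id⟩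
  | 0, nil, _ => by
      have : bdryInc ε 0 nil = id := by
        funext i
        exact (nil_var _).trans (nil_var _).symm
      rw [this]
      rfl
  | n + 1, nil, _ => rfl
  | 0, cons T Ts, h => by simp [dim] at h
  | n + 1, cons T Ts, h => by
      rw [dim, max_le_iff] at h
      have h1 := bdry_of_dim_le ε n T (Nat.le_of_succ_le_succ h.1)
      have h2 := bdry_of_dim_le ε (n + 1) Ts h.2
      let G : (Σ X : Tree, Fin X.size → Fin T.size) → (Σ X : Tree, Fin X.size → Fin Ts.size) →
          Σ X : Tree, Fin X.size → Fin (cons T Ts).size := fun X Y =>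
        ⟨cons X.1 Y.1, varCases (first _) (fun i => inner (X.2 i)) (fun i => right (Y.2 i))⟩
      have h3 := congrArg₂ G h1 h2
      refine Eq.trans h3 ?_
      have : varCases (first (cons T Ts)) (fun i => inner i) (fun i => right i) = id :=
        varCases_ext (varCases_first _ _ _) (fun i => varCases_inner _ _ _ i)
          (fun i => varCases_right _ _ _ i)
      exact congrArg (Sigma.mk (cons T Ts)) this

theorem range_bdryInc_of_dim_le (ε : Bool) {n : ℕ} {T : Tree} (h : T.dim ≤ n) :
    Set.range (bdryInc ε n T) = Set.univ := by
  have key : ∀ X : (Σ X : Tree, Fin X.size → Fin T.size), X = ⟨T, id⟩ →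
      Set.range X.2 = Set.univ := by
    rintro _ rfl
    exact Set.range_id
  exact key _ (bdry_of_dim_le ε n T h)

theorem mem_range_bdryInc_first (ε : Bool) (d : ℕ) (T : Tree) :
    T.first ∈ Set.range (bdryInc ε (d + 1) T) := by
  cases T with
  | nil => exact ⟨first nil, rfl⟩
  | cons T Ts =>
      refine ⟨first (cons (bdry d T) (bdry (d + 1) Ts)), ?_⟩
      rw [bdryInc, varCases_first]

theorem mem_range_bdryInc_inner {ε : Bool} {d : ℕ} {T Ts : Tree} {i : Fin T.size} :
    inner i ∈ Set.range (bdryInc ε (d + 1) (cons T Ts)) ↔ i ∈ Set.range (bdryInc ε d T) := by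
  constructor
  · rintro ⟨j, hj⟩
    rcases var_cases (T := bdry d T) (Ts := bdry (d + 1) Ts) j with rfl | ⟨k, rfl⟩ | ⟨k, rfl⟩
    · rw [bdryInc, varCases_first] at hj
      exact absurd hj (first_ne_inner _)
    · rw [bdryInc, varCases_inner] at hj
      exact ⟨k, inner_injective hj⟩
    · rw [bdryInc, varCases_right] at hj
      exact absurd hj.symm (inner_ne_right _ _)
  · rintro ⟨k, rfl⟩
    exact ⟨inner (T := bdry d T) (Ts := bdry (d + 1) Ts) k, by rw [bdryInc, varCases_inner]⟩

theorem mem_range_bdryInc_right {ε : Bool} {d : ℕ} {T Ts : Tree} {i : Fin Ts.size} :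
    right i ∈ Set.range (bdryInc ε (d + 1) (cons T Ts)) ↔
      i ∈ Set.range (bdryInc ε (d + 1) Ts) := by
  constructor
  · rintro ⟨j, hj⟩
    rcases var_cases (T := bdry d T) (Ts := bdry (d + 1) Ts) j with rfl | ⟨k, rfl⟩ | ⟨k, rfl⟩
    · rw [bdryInc, varCases_first] at hj
      exact absurd hj (first_ne_right _)
    · rw [bdryInc, varCases_inner] at hj
      exact absurd hj (inner_ne_right _ _)
    · rw [bdryInc, varCases_right] at hj
      exact ⟨k, right_injective hj⟩
  · rintro ⟨k, rfl⟩
    exact ⟨right (T := bdry d T) (Ts := bdry (d + 1) Ts) k, by rw [bdryInc, varCases_right]⟩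

theorem dim_disc : (n : ℕ) → (disc n).dim = n
  | 0 => rfl
  | n + 1 => by simp [disc, dim, dim_disc n]

theorem th_disc : (n : ℕ) → (disc n).th = n
  | 0 => rfl
  | n + 1 => by simp [disc, th, th_disc n]

theorem th_le_dim : (T : Tree) → T.th ≤ T.dim
  | nil => le_rfl
  | cons T nil => by
      have := th_le_dim T
      simp only [th, dim]
      omega
  | cons T (cons U Us) => Nat.zero_le _

theorem eq_disc_of_dim_le_th : (T : Tree) → T.dim ≤ T.th → T = disc T.dim
  | nil, _ => rfl
  | cons T nil, h => by
      simp only [th, dim] at h ⊢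
      rw [Nat.max_eq_left (Nat.zero_le _)] at h ⊢
      rw [disc, ← eq_disc_of_dim_le_th T (by omega)]
  | cons T (cons U Us), h => by
      simp [th, dim] at h

end Tree

/-! ### Discs -/

namespace Tree

theorem ty_inner_nil {T : Tree} (i : Fin T.size) :
    (cons T nil).ctx.ty (inner i) = (T.ctx.ty i).susp :=
  T.ctx.ty_susp.2.2 i

theorem top_disc_succ (n : ℕ) : (disc (n + 1)).top = inner (disc n).top := by
  refine Fin.ext ?_
  have := (disc n).size_pos
  change (disc n).size + 2 - 1 = (disc n).size - 1 + 2
  omega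

/-- The disc `Dⁿ⁺¹` extends `Dⁿ` by a variable parallel to the top variable of `Dⁿ` and by an arrow
between these two. -/
theorem ctx_disc_succ : (n : ℕ) → (disc (n + 1)).ctx =
    ((disc n).ctx.snoc ((disc n).ctx.ty (disc n).top)).snoc
      (.arr (.var (disc n).top.castSucc) (((disc n).ctx.ty (disc n).top).rename Fin.castSucc)
        (.var (Fin.last _)))
  | 0 => by
      have h : (disc 0).ctx.ty (disc 0).top = .star := ty_first nil
      rw [h, Ty.rename_star]
      rfl
  | n + 1 => by
      have h : (disc (n + 1)).ctx.susp = _ := congrArg Ctx.susp (ctx_disc_succ n)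
      refine Eq.trans h ?_
      rw [top_disc_succ]
      have h2 : (disc (n + 1)).ctx.ty (inner (disc n).top) = _ := ty_inner_nil _
      rw [h2]
      simp only [Ctx.susp, Ty.susp, Tm.susp, Ty.susp_rename, funext suspMap_castSucc]
      rfl

/-- The inclusion of `Dⁿ` in `Dⁿ⁺¹` whose top variable is the source of the top variable of
`Dⁿ⁺¹`. -/
def discSrc (n : ℕ) (i : Fin (disc n).size) : Fin (disc (n + 1)).size :=
  Fin.castSucc (n := (disc n).size + 1) (Fin.castSucc i)

/-- The target of the top variable of `Dⁿ⁺¹`. -/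
def discTgt (n : ℕ) : Fin (disc (n + 1)).size :=
  Fin.castSucc (n := (disc n).size + 1) (Fin.last _)

theorem disc_var_cases {n : ℕ} (x : Fin (disc (n + 1)).size) :
    x = (disc (n + 1)).top ∨ x = discTgt n ∨ ∃ y, x = discSrc n y := by
  have key : ∀ x : Fin ((disc n).size + 2), x = Fin.last _ ∨ x = (Fin.last _).castSucc ∨
      ∃ y : Fin (disc n).size, x = y.castSucc.castSucc := by
    intro x
    refine Fin.lastCases (Or.inl rfl) (fun x => Or.inr ?_) x
    exact Fin.lastCases (Or.inl rfl) (fun x => Or.inr ⟨x, rfl⟩) x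
  exact key x

theorem ty_disc_top_succ (n : ℕ) : (disc (n + 1)).ctx.ty (disc (n + 1)).top =
    .arr (.var (discSrc n (disc n).top)) (((disc n).ctx.ty (disc n).top).rename (discSrc n))
      (.var (discTgt n)) := by
  have h : (disc (n + 1)).top = Fin.last ((disc n).size + 1) := rfl
  rw [h]
  refine (congrArg (fun Γ : Ctx ((disc n).size + 2) => Γ.ty (Fin.last _)) (ctx_disc_succ n)).trans
    ((Ctx.ty_snoc_last _ _).trans ?_)
  rw [Ty.rename_arr, Ty.rename_rename, Tm.rename_var, Tm.rename_var]
  rfl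

theorem ty_discSrc (n : ℕ) (i : Fin (disc n).size) :
    (disc (n + 1)).ctx.ty (discSrc n i) = ((disc n).ctx.ty i).rename (discSrc n) := by
  refine (congrArg (fun Γ : Ctx ((disc n).size + 2) => Γ.ty (discSrc n i))
    (ctx_disc_succ n)).trans ((Ctx.ty_snoc_castSucc _ _ _).trans ?_)
  rw [Ctx.ty_snoc_castSucc, Ty.rename_rename]
  rfl

theorem ty_discTgt (n : ℕ) : (disc (n + 1)).ctx.ty (discTgt n) =
    ((disc n).ctx.ty (disc n).top).rename (discSrc n) := by
  refine (congrArg (fun Γ : Ctx ((disc n).size + 2) => Γ.ty (discTgt n))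
    (ctx_disc_succ n)).trans ((Ctx.ty_snoc_castSucc _ _ _).trans ?_)
  rw [Ctx.ty_snoc_last, Ty.rename_rename]
  rfl

theorem dim_ty_disc_top : (n : ℕ) → ((disc n).ctx.ty (disc n).top).dim = n
  | 0 => congrArg Ty.dim (ty_first nil)
  | n + 1 => by
      rw [ty_disc_top_succ, Ty.dim, Ty.dim_rename, dim_ty_disc_top n]

/-- The top variable of a disc has full support. -/
theorem mem_fv_ty_disc_top : (n : ℕ) → (x : Fin (disc n).size) →
    x = (disc n).top ∨ x ∈ ((disc n).ctx.ty (disc n).top).fv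
  | 0, x => Or.inl ((nil_var x).trans (nil_var _).symm)
  | n + 1, x => by
      rw [ty_disc_top_succ]
      simp only [Ty.fv, Tm.fv, Ty.rename, Set.mem_union, Ty.mem_fv_sub, Set.mem_singleton_iff]
      rcases disc_var_cases x with rfl | rfl | ⟨y, rfl⟩
      · exact Or.inl rfl
      · exact Or.inr (Or.inr rfl)
      · rcases mem_fv_ty_disc_top n y with rfl | h
        · exact Or.inr (Or.inl (Or.inl rfl))
        · exact Or.inr (Or.inl (Or.inr ⟨y, h, rfl⟩))

end Tree

open Catt.Tree

theorem Sub.snoc_last {m n : ℕ} (σ : Sub m n) (t : Tm n) : Sub.snoc σ t (Fin.last m) = t :=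
  Fin.lastCases_last

theorem Sub.snoc_castSucc {m n : ℕ} (σ : Sub m n) (t : Tm n) (i : Fin m) :
    Sub.snoc σ t i.castSucc = σ i :=
  Fin.lastCases_castSucc i

/-- Every substitution is obtained by extension from its restriction. -/
theorem Sub.eq_snoc {m n : ℕ} (σ : Sub (m + 1) n) :
    Sub.snoc (fun i => σ i.castSucc) (σ (Fin.last m)) = σ := by
  funext i
  refine Fin.lastCases ?_ (fun i => ?_) i
  · exact Sub.snoc_last _ _
  · exact Sub.snoc_castSucc _ _ _

theorem discSub_succ_src {k n : ℕ} (s u t : Tm k) (A : Ty k) (i : Fin (disc n).size) :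
    discSub (n + 1) (.arr s A u) t (discSrc n i) = discSub n A s i :=
  (Sub.snoc_castSucc _ _ _).trans (Sub.snoc_castSucc _ _ _)

theorem discSub_succ_tgt {k n : ℕ} (s u t : Tm k) (A : Ty k) :
    discSub (n + 1) (.arr s A u) t (discTgt n) = u :=
  (Sub.snoc_castSucc _ _ _).trans (Sub.snoc_last _ _)

theorem discSub_top {k : ℕ} : {n : ℕ} → {A : Ty k} → (t : Tm k) → A.dim = n →
    discSub n A t (disc n).top = t
  | 0, _, _, _ => rfl
  | _ + 1, .arr _ _ _, _, _ => Sub.snoc_last _ _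
  | _ + 1, .star, _, _ => rfl

/-- A substitution from a disc is determined by the image of the top variable and of its type. -/
theorem discSub_eq {k : ℕ} : (n : ℕ) → (θ : Sub (disc n).size k) →
    discSub n (((disc n).ctx.ty (disc n).top).sub θ) (θ (disc n).top) = θ
  | 0, θ => by
      funext i
      rw [nil_var i]
      rfl
  | n + 1, θ => by
      have hd : (((disc (n + 1)).ctx.ty (disc (n + 1)).top).sub θ).dim = n + 1 := by
        rw [Ty.dim_sub, dim_ty_disc_top]
      have h1 := discSub_top (θ (disc (n + 1)).top) hd
      rw [ty_disc_top_succ] at h1 ⊢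
      simp only [Ty.sub, Tm.sub, Ty.rename_sub] at h1 ⊢
      funext x
      rcases disc_var_cases x with rfl | rfl | ⟨y, rfl⟩
      · exact h1
      · exact discSub_succ_tgt _ _ _ _
      · rw [discSub_succ_src]
        exact congrFun (discSub_eq n (fun i => θ (discSrc n i))) y

theorem ty_disc_top_sub_discSub {k : ℕ} : {n : ℕ} → {A : Ty k} → (t : Tm k) → A.dim = n →
    ((disc n).ctx.ty (disc n).top).sub (discSub n A t) = A
  | 0, .star, _, _ => by
      have h : (disc 0).ctx.ty (disc 0).top = .star := ty_first nil
      rw [h, Ty.sub]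
  | 0, .arr _ _ _, _, h => by simp [Ty.dim] at h
  | _ + 1, .star, _, h => by simp [Ty.dim] at h
  | n + 1, .arr s A u, t, h => by
      have h' : A.dim = n := Nat.succ.inj h
      rw [ty_disc_top_succ]
      simp only [Ty.sub, Tm.sub, Ty.rename_sub, discSub_succ_src, discSub_succ_tgt,
        discSub_top s h']
      exact congrArg (fun A => Ty.arr s A u) (ty_disc_top_sub_discSub s h')

theorem discSub_sub {k l : ℕ} (ρ : Sub k l) {n : ℕ} {A : Ty k} (t : Tm k) (h : A.dim = n) :
    (fun i => (discSub n A t i).sub ρ) = discSub n (A.sub ρ) (t.sub ρ) := by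
  have := discSub_eq n (fun i => (discSub n A t i).sub ρ)
  rw [← this, ← Ty.sub_sub, ty_disc_top_sub_discSub t h, discSub_top t h]

/-! ### Unbiased types and coherences -/

theorem dim_unbiasedTy : (n : ℕ) → (T : Tree) → (unbiasedTy n T).dim = n
  | 0, _ => rfl
  | n + 1, T => by rw [unbiasedTy, Ty.dim, dim_unbiasedTy n T]

theorem unbiasedCoh_sub {k : ℕ} (n : ℕ) (T : Tree) (τ : Sub T.size k) :
    (unbiasedCoh n T).sub τ = .coh T.ctx (unbiasedTy n T) τ := by
  simp only [unbiasedCoh, Tm.sub, Sub.id]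

theorem Sub.susp_id (n : ℕ) : (Sub.id n).susp = Sub.id (n + 2) := by
  funext i
  rcases susp_var_cases i with rfl | rfl | ⟨j, rfl⟩ <;> rfl

theorem unbiasedTmOf_disc (n : ℕ) (U : Ty (disc n).size) :
    unbiasedTmOf n (disc n) U = .var (disc n).top :=
  if_pos rfl

theorem unbiasedTmOf_of_ne {n : ℕ} {T : Tree} (h : T ≠ disc n) (U : Ty T.size) :
    unbiasedTmOf n T U = .coh T.ctx U (Sub.id T.size) :=
  if_neg h

theorem unbiasedTmOf_susp (n : ℕ) (T : Tree) (U : Ty T.size) :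
    (unbiasedTmOf n T U).susp = unbiasedTmOf (n + 1) (cons T nil) U.susp := by
  by_cases h : T = disc n
  · subst h
    rw [unbiasedTmOf_disc]
    exact (congrArg Tm.var (top_disc_succ n)).symm.trans (unbiasedTmOf_disc (n + 1) _).symm
  · have h' : cons T nil ≠ disc (n + 1) := fun e => h (Tree.cons.inj e).1
    rw [unbiasedTmOf_of_ne h]
    exact (congrArg (Tm.coh T.ctx.susp U.susp) (Sub.susp_id T.size)).trans
      (unbiasedTmOf_of_ne h' _).symm

theorem bdryInc_cons_nil (ε : Bool) (n : ℕ) (T : Tree) :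
    bdryInc ε (n + 1) (cons T nil) = suspMap (bdryInc ε n T) := by
  refine varCases_ext (T := bdry n T) (Ts := nil) ?_ (fun i => ?_) (fun i => ?_)
  · rw [bdryInc]
    exact varCases_first _ _ _
  · rw [bdryInc]
    exact varCases_inner _ _ _ i
  · rw [bdryInc, nil_var i]
    exact varCases_right _ _ _ _

theorem unbiasedTy_one (T : Tree) :
    unbiasedTy 1 T = .arr (.var T.first) .star (.var T.lastObj) := by
  -- Stated for any tree equal to `nil`, since `bdry 0 T` is so only propositionally.
  have h : ∀ (X : Tree) (f : Fin X.size → Fin T.size) (U : Ty X.size), X = nil →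
      (unbiasedTmOf 0 X U).rename f = .var (f X.first) := by
    rintro _ f U rfl
    exact (congrArg _ (unbiasedTmOf_disc 0 U)).trans (Tm.rename_var _ _)
  rw [unbiasedTy, h _ _ _ (bdry_zero _), h _ _ _ (bdry_zero _), bdryInc_false_zero,
    bdryInc_true_zero]
  rfl

/-- The unbiased type of a suspension is the suspension of the unbiased type. -/
theorem unbiasedTy_susp : (n : ℕ) → (T : Tree) →
    (unbiasedTy n T).susp = unbiasedTy (n + 1) (cons T nil)
  | 0, T => by
      rw [unbiasedTy_one]
      rfl
  | n + 1, T => by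
      have key : ∀ ε, ((unbiasedTmOf n (bdry n T) (unbiasedTy n (bdry n T))).rename
          (bdryInc ε n T)).susp = (unbiasedTmOf (n + 1) (cons (bdry n T) nil)
          (unbiasedTy (n + 1) (cons (bdry n T) nil))).rename
            (bdryInc ε (n + 1) (cons T nil)) := by
        intro ε
        rw [Tm.susp_rename, unbiasedTmOf_susp, unbiasedTy_susp n (bdry n T), ← bdryInc_cons_nil]
        rfl
      have harr : ∀ {k : ℕ} {a a' b b' : Tm k} {A A' : Ty k}, a = a' → A = A' → b = b' →
          Ty.arr a A b = .arr a' A' b' := by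
        rintro k a _ b _ A _ rfl rfl rfl
        rfl
      exact harr (key false) (unbiasedTy_susp n T) (key true)

theorem unbiasedCoh_susp (n : ℕ) (T : Tree) :
    (unbiasedCoh n T).susp = unbiasedCoh (n + 1) (cons T nil) := by
  rw [unbiasedCoh, unbiasedCoh, ← unbiasedTy_susp]
  exact congrArg (Tm.coh T.ctx.susp _) (Sub.susp_id T.size)

/-- The unbiased type of a disc in its own dimension is the type of its top variable. -/
theorem unbiasedTy_disc : (n : ℕ) → unbiasedTy n (disc n) = (disc n).ctx.ty (disc n).top
  | 0 => (ty_first nil).symm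
  | n + 1 => by
      have h : (disc (n + 1)).ctx.ty (inner (disc n).top) = _ := ty_inner_nil _
      rw [top_disc_succ, h, ← unbiasedTy_disc n]
      exact (unbiasedTy_susp n (disc n)).symm

/-- Above the dimension of the tree, unbiased types are types of endomorphisms. -/
theorem unbiasedTy_succ_of_dim_le {n : ℕ} {T : Tree} (h : T.dim ≤ n) :
    unbiasedTy (n + 1) T =
      .arr (unbiasedTmOf n T (unbiasedTy n T)) (unbiasedTy n T)
        (unbiasedTmOf n T (unbiasedTy n T)) := by
  have key : ∀ X : (Σ X : Tree, Fin X.size → Fin T.size), X = ⟨T, id⟩ →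
      (unbiasedTmOf n X.1 (unbiasedTy n X.1)).rename X.2 = unbiasedTmOf n T (unbiasedTy n T) := by
    rintro _ rfl
    exact Tm.sub_var _
  rw [unbiasedTy, key _ (bdry_of_dim_le false n T h), key _ (bdry_of_dim_le true n T h)]

theorem unbiasedTy_succ_disc (n : ℕ) :
    unbiasedTy (n + 1) (disc n) =
      .arr (.var (disc n).top) ((disc n).ctx.ty (disc n).top) (.var (disc n).top) := by
  rw [unbiasedTy_succ_of_dim_le (dim_disc n).le, unbiasedTmOf_disc, unbiasedTy_disc]

theorem unbiasedTy_succ_of_ne {n : ℕ} {T : Tree} (h : T.dim ≤ n) (hT : T ≠ disc n) :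
    unbiasedTy (n + 1) T = .arr (unbiasedCoh n T) (unbiasedTy n T) (unbiasedCoh n T) := by
  rw [unbiasedTy_succ_of_dim_le h, unbiasedTmOf_of_ne hT, unbiasedCoh]

/-- The source of an unbiased type has its free variables in the source boundary. -/
theorem fv_unbiasedTmOf_rename_subset {n m : ℕ} (X : Tree) (U : Ty X.size)
    (f : Fin X.size → Fin m) : ((unbiasedTmOf n X U).rename f).fv ⊆ Set.range f := by
  intro x hx
  obtain ⟨i, _, hi⟩ := (Tm.mem_fv_sub _ _ _).1 hx
  exact ⟨i, (by simpa [Tm.fv] using hi : x = f i).symm⟩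

theorem isIdentity_coh {k : ℕ} (T : Tree) (A : Ty T.size) (σ : Sub T.size k)
    (h : IsIdentity (.coh T.ctx A σ)) :
    ∃ n, (⟨T, A⟩ : Σ X : Tree, Ty X.size) = ⟨disc n, unbiasedTy (n + 1) (disc n)⟩ := by
  obtain ⟨n, ρ, h⟩ := h
  rw [unbiasedCoh_sub] at h
  obtain ⟨h1, h2, h3, -⟩ := Tm.coh.inj h
  obtain rfl := ctx_injective h1 h2
  exact ⟨n, by rw [eq_of_heq h3]⟩

theorem isIdentity_unbiasedCoh_disc {k : ℕ} (n : ℕ) (σ : Sub (disc n).size k) :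
    IsIdentity (.coh (disc n).ctx (unbiasedTy (n + 1) (disc n)) σ) :=
  ⟨n, σ, (unbiasedCoh_sub _ _ _).symm⟩

/-- Being an identity does not depend on the substitution of a coherence. -/
theorem IsIdentity.congr {m k l : ℕ} {Δ : Ctx m} {A : Ty m} {σ : Sub m k}
    (h : IsIdentity (.coh Δ A σ)) (τ : Sub m l) : IsIdentity (.coh Δ A τ) := by
  obtain ⟨n, ρ, h⟩ := h
  rw [unbiasedCoh_sub] at h
  obtain ⟨h1, h2, h3, -⟩ := Tm.coh.inj h
  subst h1
  obtain rfl := eq_of_heq h2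
  obtain rfl := eq_of_heq h3
  exact isIdentity_unbiasedCoh_disc n τ

/-! ### Free variables of suspensions -/

mutual
theorem Ty.mem_fv_susp {n : ℕ} (y : Fin n) : (A : Ty n) → (y.addNat 2 ∈ A.susp.fv ↔ y ∈ A.fv)
  | .star => by
      have h0 : y.addNat 2 ≠ 0 := fun h => by simpa using congrArg Fin.val h
      have h1 : y.addNat 2 ≠ 1 := fun h => by simpa using congrArg Fin.val h
      simp [Ty.susp, Ty.fv, Tm.fv, h0, h1]
  | .arr s A t => by
      simp only [Ty.susp, Ty.fv, Set.mem_union, Ty.mem_fv_susp y A, Tm.mem_fv_susp y s,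
        Tm.mem_fv_susp y t]
theorem Tm.mem_fv_susp {n : ℕ} (y : Fin n) : (t : Tm n) → (y.addNat 2 ∈ t.susp.fv ↔ y ∈ t.fv)
  | .var i => by
      simp only [Tm.susp, Tm.fv, Set.mem_singleton_iff, Fin.ext_iff, Fin.val_addNat]
      omega
  | .coh Δ A σ => by
      simp only [Tm.susp, Tm.fv, Set.mem_ofPred_eq]
      constructor
      · rintro ⟨i, hi⟩
        rcases susp_var_cases i with rfl | rfl | ⟨j, rfl⟩
        · have h : y.addNat 2 ∈ (Tm.var (0 : Fin (n + 2))).fv := hi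
          simp only [Tm.fv, Set.mem_singleton_iff, Fin.ext_iff, Fin.val_addNat, Fin.val_zero] at h
          omega
        · have h : y.addNat 2 ∈ (Tm.var (1 : Fin (n + 2))).fv := hi
          simp only [Tm.fv, Set.mem_singleton_iff, Fin.ext_iff, Fin.val_addNat, Fin.val_one] at h
          omega
        · exact ⟨j, (Tm.mem_fv_susp y (σ j)).1 hi⟩
      · rintro ⟨j, hj⟩
        exact ⟨j.addNat 2, (Tm.mem_fv_susp y (σ j)).2 hj⟩
end

theorem Ty.poles_mem_fv_susp {n : ℕ} : (A : Ty n) → 0 ∈ A.susp.fv ∧ 1 ∈ A.susp.fv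
  | .star => by simp [Ty.susp, Ty.fv, Tm.fv]
  | .arr s A t => by
      have := Ty.poles_mem_fv_susp A
      simp [Ty.susp, Ty.fv, this]

theorem Ty.mem_fv_rename {m n : ℕ} (f : Fin m → Fin n) (A : Ty m) (y : Fin n) :
    y ∈ (A.rename f).fv ↔ ∃ x ∈ A.fv, f x = y := by
  simp only [Ty.rename, Ty.mem_fv_sub, Tm.fv, Set.mem_singleton_iff, eq_comm]

theorem Tm.mem_fv_rename {m n : ℕ} (f : Fin m → Fin n) (A : Tm m) (y : Fin n) :
    y ∈ (A.rename f).fv ↔ ∃ x ∈ A.fv, f x = y := by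
  simp only [Tm.rename, Tm.mem_fv_sub, Tm.fv, Set.mem_singleton_iff, eq_comm]

/-! ### Maps of variables between trees -/

namespace Tree

theorem inl_zero {T Ts : Tree} : inl (T := T) (Ts := Ts) 0 = first _ := rfl

theorem inl_one {T Ts : Tree} : inl (T := T) (Ts := Ts) 1 = right Ts.first := rfl

theorem inl_addNat {T Ts : Tree} (i : Fin T.size) : inl (Ts := Ts) (i.addNat 2) = inner i := rfl

theorem TyCompat.cons {T Ts X Xs : Tree} {f : Fin T.size → Fin X.size}
    {g : Fin Ts.size → Fin Xs.size} (hf : TyCompat T.ctx X.ctx f) (hg : TyCompat Ts.ctx Xs.ctx g)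
    (h : g Ts.first = Xs.first) :
    TyCompat (cons T Ts).ctx (cons X Xs).ctx
      (varCases (first _) (fun i => inner (f i)) (fun j => right (g j))) := by
  intro i
  have hl : ∀ i, varCases (first (Tree.cons X Xs)) (fun i => inner (f i)) (fun j => right (g j))
      (inl (T := T) (Ts := Ts) i) = inl (suspMap f i) := by
    intro i
    rcases susp_var_cases i with rfl | rfl | ⟨j, rfl⟩
    · rw [inl_zero, varCases_first]; rfl
    · rw [inl_one, varCases_right, h]; rfl
    · rw [inl_addNat, varCases_inner]; rfl
  rcases var_cases i with rfl | ⟨j, rfl⟩ | ⟨j, rfl⟩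
  · rw [varCases_first, ty_first, ty_first, Ty.rename_star]
  · rw [varCases_inner, ty_inner, ty_inner, hf, Ty.rename_rename, Ty.susp_rename,
      Ty.rename_rename]
    simp only [hl]
  · rw [varCases_right, ty_right, ty_right, hg, Ty.rename_rename, Ty.rename_rename]
    simp only [varCases_right]

theorem appendInl_first : (T U : Tree) → appendInl T U T.first = first _
  | nil, _ => rfl
  | cons _ _, _ => varCases_first _ _ _

theorem appendInl_inner {T Ts : Tree} (U : Tree) (i : Fin T.size) :
    appendInl (cons T Ts) U (inner i) = inner (T := T) (Ts := Ts.append U) i :=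
  varCases_inner _ _ _ i

theorem appendInl_right {T Ts : Tree} (U : Tree) (i : Fin Ts.size) :
    appendInl (cons T Ts) U (right i) = right (T := T) (appendInl Ts U i) :=
  varCases_right _ _ _ i

theorem tyCompat_id {n : ℕ} (Γ : Ctx n) : TyCompat Γ Γ (fun i => i) :=
  fun _ => (Ty.sub_var _).symm

theorem tyCompat_nil (U : Tree) : TyCompat nil.ctx U.ctx (fun _ => U.first) := by
  intro i
  rw [nil_var i, ty_first, ty_first, Ty.rename_star]

theorem tyCompat_appendInl : (T U : Tree) → TyCompat T.ctx (T.append U).ctx (appendInl T U)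
  | nil, U => tyCompat_nil U
  | cons T Ts, U => TyCompat.cons (tyCompat_id T.ctx) (tyCompat_appendInl Ts U)
      (appendInl_first Ts U)

theorem tyCompat_appendInr : (T U : Tree) → TyCompat U.ctx (T.append U).ctx (appendInr T U)
  | nil, U => tyCompat_id _
  | cons T Ts, U => by
      intro i
      have h : (cons T (Ts.append U)).ctx.ty (right (appendInr Ts U i)) = _ := ty_right _
      refine h.trans ?_
      rw [tyCompat_appendInr Ts U, Ty.rename_rename]
      rfl

theorem appendInl_lastObj : (T U : Tree) → appendInl T U T.lastObj = appendInr T U U.first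
  | nil, _ => rfl
  | cons T Ts, U =>
      (appendInl_right U Ts.lastObj).trans (congrArg (right (T := T)) (appendInl_lastObj Ts U))

theorem appendInr_lastObj : (T U : Tree) → appendInr T U U.lastObj = (T.append U).lastObj
  | nil, _ => rfl
  | cons T Ts, U => congrArg (right (T := T)) (appendInr_lastObj Ts U)

theorem append_var_cases : (T U : Tree) → (j : Fin (T.append U).size) →
    (∃ i, j = appendInl T U i) ∨ ∃ i, i ≠ U.first ∧ j = appendInr T U i
  | nil, U, j => by
      by_cases h : j = U.first
      · exact Or.inl ⟨first nil, h⟩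
      · exact Or.inr ⟨j, h, rfl⟩
  | cons T Ts, U, j => by
      rcases var_cases (T := T) (Ts := Ts.append U) j with rfl | ⟨k, rfl⟩ | ⟨k, rfl⟩
      · exact Or.inl ⟨first _, (varCases_first _ _ _).symm⟩
      · exact Or.inl ⟨inner k, (appendInl_inner U k).symm⟩
      · rcases append_var_cases Ts U k with ⟨i, rfl⟩ | ⟨i, hi, rfl⟩
        · exact Or.inl ⟨right i, (appendInl_right U i).symm⟩
        · exact Or.inr ⟨i, hi, rfl⟩

/-- Appending the empty list does nothing, and the inclusion is then the identity. -/
theorem append_nil : (T : Tree) →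
    (⟨T.append nil, appendInl T nil⟩ : Σ X : Tree, Fin T.size → Fin X.size) = ⟨T, id⟩
  | nil => by
      have : appendInl nil nil = id := by
        funext i
        exact (nil_var _).trans (nil_var _).symm
      rw [this]
      rfl
  | cons T Ts => by
      let G : (Σ X : Tree, Fin Ts.size → Fin X.size) →
          Σ X : Tree, Fin (cons T Ts).size → Fin X.size := fun X =>
        ⟨cons T X.1, varCases (first _) inner (fun i => right (X.2 i))⟩
      refine Eq.trans (congrArg G (append_nil Ts)) ?_
      have : varCases (first (cons T Ts)) (fun i => inner i) (fun i => right i) = id :=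
        varCases_ext (varCases_first _ _ _) (fun i => varCases_inner _ _ _ i)
          (fun i => varCases_right _ _ _ i)
      exact congrArg (Sigma.mk (cons T Ts)) this

end Tree

/-! ### Labellings -/

namespace Lab

theorem toSub_first {k : ℕ} : {T : Tree} → (L : Lab k T) → L.toSub T.first = L.first
  | _, nil _ => rfl
  | _, cons _ _ _ => varCases_first _ _ _

theorem toSub_ofSub {k : ℕ} : (T : Tree) → (σ : Sub T.size k) → (ofSub T σ).toSub = σ
  | .nil, σ => by
      funext i
      rw [nil_var i]
      rfl
  | .cons T Ts, σ => by
      refine varCases_ext ?_ (fun i => ?_) (fun i => ?_)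
      · exact varCases_first _ _ _
      · refine (varCases_inner _ _ _ i).trans ?_
        rw [toSub_ofSub T]
      · refine (varCases_right _ _ _ i).trans ?_
        rw [toSub_ofSub Ts]

theorem toSub_setFirst_first {k : ℕ} {T : Tree} (u : Tm k) (L : Lab k T) :
    (L.setFirst u).toSub T.first = u := by
  rw [toSub_first]
  cases L <;> rfl

theorem toSub_setFirst_of_ne {k : ℕ} {T : Tree} (u : Tm k) (L : Lab k T) {i : Fin T.size}
    (h : i ≠ T.first) : (L.setFirst u).toSub i = L.toSub i := by
  cases L with
  | nil t => exact absurd (nil_var i) h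
  | cons t L M =>
      rcases var_cases i with rfl | ⟨j, rfl⟩ | ⟨j, rfl⟩
      · exact absurd rfl h
      · exact (varCases_inner _ _ _ j).trans (varCases_inner _ _ _ j).symm
      · exact (varCases_right _ _ _ j).trans (varCases_right _ _ _ j).symm

theorem toSub_append_appendInl {k : ℕ} : {T U : Tree} → (M : Lab k T) → (N : Lab k U) →
    (i : Fin T.size) → (M.append N).toSub (appendInl T U i) = M.toSub i
  | _, _, nil t, N, i => toSub_setFirst_first t N
  | _, _, cons (T := T) (Ts := Ts) t L M, N, i => by
      rcases var_cases i with rfl | ⟨j, rfl⟩ | ⟨j, rfl⟩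
      · rw [appendInl_first, toSub_first, toSub_first]
        rfl
      · exact (congrArg _ (appendInl_inner _ j)).trans
          ((varCases_inner _ _ _ j).trans (varCases_inner _ _ _ j).symm)
      · exact (congrArg _ (appendInl_right _ j)).trans ((varCases_right _ _ _ _).trans
          ((toSub_append_appendInl M N j).trans (varCases_right _ _ _ j).symm))

theorem toSub_append_appendInr {k : ℕ} : {T U : Tree} → (M : Lab k T) → (N : Lab k U) →
    (i : Fin U.size) → i ≠ U.first → (M.append N).toSub (appendInr T U i) = N.toSub i
  | _, _, nil t, N, _, h => toSub_setFirst_of_ne t N h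
  | _, _, cons _ _ M, N, i, h =>
      (varCases_right _ _ _ _).trans (toSub_append_appendInr M N i h)

end Lab

/-! ### Values of the exterior and inserted substitutions -/

theorem Tm.rename_rename {l m n : ℕ} (f : Fin l → Fin m) (g : Fin m → Fin n) (t : Tm l) :
    (t.rename f).rename g = t.rename (fun i => g (f i)) := by
  simp only [Tm.rename, Tm.sub_sub, Tm.sub]

/-- The substitution from a disc classifying a term of unbiased type preserves the first and the
last object. -/
theorem discSub_unbiasedTy_objects : (n : ℕ) → (T : Tree) → (t : Tm T.size) →
    discSub (n + 1) (unbiasedTy (n + 1) T) t (disc (n + 1)).first = .var T.first ∧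
      discSub (n + 1) (unbiasedTy (n + 1) T) t (disc (n + 1)).lastObj = .var T.lastObj
  | 0, T, t => by
      rw [unbiasedTy_one]
      exact ⟨discSub_succ_src _ _ _ _ (disc 0).first, discSub_succ_tgt _ _ _ _⟩
  | n + 1, T, t => by
      rw [unbiasedTy]
      obtain ⟨h0, h1⟩ := discSub_unbiasedTy_objects n T
        ((unbiasedTmOf (n + 1) (T.bdry (n + 1)) (unbiasedTy (n + 1) (T.bdry (n + 1)))).rename
          (T.bdryInc false (n + 1)))
      exact ⟨(discSub_succ_src _ _ _ _ (disc (n + 1)).first).trans h0,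
        (discSub_succ_src _ _ _ _ (disc (n + 1)).lastObj).trans h1⟩

theorem discSub_susp {k n : ℕ} {A : Ty k} (t : Tm k) (h : A.dim = n) :
    Sub.susp (discSub n A t) = discSub (n + 1) A.susp t.susp := by
  refine (discSub_eq (n + 1) (Sub.susp (discSub n A t))).symm.trans ?_
  refine congrArg₂ (discSub (n + 1)) ?_ ?_
  · rw [top_disc_succ]
    have h2 : (disc (n + 1)).ctx.ty (inner (disc n).top) = _ := ty_inner_nil _
    rw [h2]
    refine (Ty.susp_sub _ _).symm.trans ?_
    rw [ty_disc_top_sub_discSub t h]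
  · rw [top_disc_succ]
    refine (Sub.susp_addNat _ _).trans ?_
    rw [discSub_top t h]

section Exterior

variable {S Ss : Tree}

theorem exterior_here_inl (m : ℕ) (T : Tree) (h : 0 ≤ T.th) (i : Fin (disc (m + 1)).size) :
    exterior (.here m rfl : Branch (cons (disc m) Ss)) T h (inl i) =
      (discSub (m + 1) (unbiasedTy (m + 1) T) (unbiasedCoh (m + 1) T) i).rename
        (T.appendInl Ss) :=
  wedgeCases_inl (n := (disc m).size + 2) _ _ i

theorem exterior_here_right (m : ℕ) (T : Tree) (h : 0 ≤ T.th) (j : Fin Ss.size) :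
    exterior (.here m rfl : Branch (cons (disc m) Ss)) T h (right j) =
      .var (T.appendInr Ss j) := by
  refine wedgeCases_inr (n := (disc m).size + 2) 1 _ _ Ss.size_pos ?_ j
  have h1 := (discSub_unbiasedTy_objects m T (unbiasedCoh (m + 1) T)).2
  refine (congrArg (Tm.rename (T.appendInl Ss)) h1).trans ?_
  rw [Tm.rename_var, appendInl_lastObj]
  rfl

theorem exterior_skip_first (P : Branch Ss) (T : Tree) (h : P.bh ≤ T.th) :
    exterior (.skip (S := S) P) T h (first _) = .var (first _) :=
  varCases_first _ _ _

theorem exterior_skip_inner (P : Branch Ss) (T : Tree) (h : P.bh ≤ T.th) (i : Fin S.size) :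
    exterior (.skip (S := S) P) T h (inner i) = .var (inner i) :=
  varCases_inner _ _ _ i

theorem exterior_skip_right (P : Branch Ss) (T : Tree) (h : P.bh ≤ T.th) (j : Fin Ss.size) :
    exterior (.skip (S := S) P) T h (right j) = (exterior P T h j).rename right :=
  varCases_right _ _ _ j

theorem exterior_down_inl (P : Branch S) (T : Tree) (h : P.bh ≤ T.th) (i : Fin (S.size + 2)) :
    exterior (.down (Ss := Ss) P) (cons T nil) (Nat.succ_le_succ h) (inl i) =
      (Sub.susp (exterior P T h) i).rename inl :=
  wedgeCases_inl (n := S.size + 2) _ _ i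

theorem exterior_down_first (P : Branch S) (T : Tree) (h : P.bh ≤ T.th) :
    exterior (.down (Ss := Ss) P) (cons T nil) (Nat.succ_le_succ h) (first _) =
      .var (first _) :=
  exterior_down_inl P T h 0

theorem exterior_down_inner (P : Branch S) (T : Tree) (h : P.bh ≤ T.th) (i : Fin S.size) :
    exterior (.down (Ss := Ss) P) (cons T nil) (Nat.succ_le_succ h) (inner i) =
      (exterior P T h i).susp.rename inl :=
  exterior_down_inl P T h (i.addNat 2)

theorem exterior_down_right (P : Branch S) (T : Tree) (h : P.bh ≤ T.th) (j : Fin Ss.size) :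
    exterior (.down (Ss := Ss) P) (cons T nil) (Nat.succ_le_succ h) (right j) =
      .var (right j) :=
  wedgeCases_inr (n := S.size + 2) 1 _ _ Ss.size_pos rfl j

end Exterior

theorem exterior_first : {S : Tree} → (P : Branch S) → (T : Tree) → (h : P.bh ≤ T.th) →
    exterior P T h S.first = .var (first _)
  | _, .here m rfl, T, h => by
      refine (exterior_here_inl m T h (disc (m + 1)).first).trans ?_
      rw [(discSub_unbiasedTy_objects m T _).1, Tm.rename_var, appendInl_first]
      rfl
  | _, .skip P, T, h => exterior_skip_first P T h
  | _, .down P, .cons T .nil, h => exterior_down_first P T (Nat.le_of_succ_le_succ h)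
  | _, .down _, .nil, h => absurd h (Nat.not_succ_le_zero _)
  | _, .down _, .cons _ (.cons _ _), h => absurd h (Nat.not_succ_le_zero _)

theorem exterior_lastObj : {S : Tree} → (P : Branch S) → (T : Tree) → (h : P.bh ≤ T.th) →
    exterior P T h S.lastObj = .var (insTree P T h).lastObj
  | _, .here (Ss := Ss) m rfl, T, h =>
      (exterior_here_right m T h Ss.lastObj).trans (congrArg Tm.var (appendInr_lastObj T Ss))
  | _, .skip (Ss := Ss) P, T, h => by
      refine (exterior_skip_right P T h Ss.lastObj).trans ?_
      rw [exterior_lastObj P T h, Tm.rename_var]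
      rfl
  | _, .down (Ss := Ss) P, .cons T .nil, h =>
      exterior_down_right P T (Nat.le_of_succ_le_succ h) Ss.lastObj
  | _, .down _, .nil, h => absurd h (Nat.not_succ_le_zero _)
  | _, .down _, .cons _ (.cons _ _), h => absurd h (Nat.not_succ_le_zero _)

/-- The inclusion of the variables of `T` in those of the inserted tree. -/
def intVar : {S : Tree} → (P : Branch S) → (T : Tree) → (h : P.bh ≤ T.th) →
    Fin T.size → Fin (insTree P T h).size
  | _, .here (Ss := Ss) _ _, T, _ => T.appendInl Ss
  | _, .skip P, T, h => fun i => right (intVar P T h i)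
  | _, .down (Ss := Ss) P, .cons T .nil, h =>
      varCases (Ts := .nil) (first (cons (insTree P T (Nat.le_of_succ_le_succ h)) Ss))
        (fun i => inner (intVar P T (Nat.le_of_succ_le_succ h) i)) (fun _ => right Ss.first)
  | _, .down _, .nil, h => absurd h (Nat.not_succ_le_zero _)
  | _, .down _, .cons _ (.cons _ _), h => absurd h (Nat.not_succ_le_zero _)

theorem tyCompat_intVar : {S : Tree} → (P : Branch S) → (T : Tree) → (h : P.bh ≤ T.th) →
    TyCompat T.ctx (insTree P T h).ctx (intVar P T h)
  | _, .here (Ss := Ss) _ _, T, _ => tyCompat_appendInl T Ss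
  | _, .skip (S := S) P, T, h => by
      intro i
      have h1 : (cons S (insTree P T h)).ctx.ty (right (intVar P T h i)) = _ := ty_right _
      refine h1.trans ?_
      rw [tyCompat_intVar P T h, Ty.rename_rename]
      rfl
  | _, .down (Ss := Ss) P, .cons T .nil, h =>
      TyCompat.cons (tyCompat_intVar P T (Nat.le_of_succ_le_succ h)) (tyCompat_nil Ss) rfl
  | _, .down _, .nil, h => absurd h (Nat.not_succ_le_zero _)
  | _, .down _, .cons _ (.cons _ _), h => absurd h (Nat.not_succ_le_zero _)

theorem intVar_down_first {S Ss : Tree} (P : Branch S) (T : Tree) (h : P.bh ≤ T.th) :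
    intVar (.down (Ss := Ss) P) (cons T nil) (Nat.succ_le_succ h) (first _) =
      first (cons (insTree P T h) Ss) :=
  varCases_first _ _ _

theorem intVar_down_inner {S Ss : Tree} (P : Branch S) (T : Tree) (h : P.bh ≤ T.th)
    (i : Fin T.size) :
    intVar (.down (Ss := Ss) P) (cons T nil) (Nat.succ_le_succ h) (inner i) =
      inner (Ts := Ss) (intVar P T h i) :=
  varCases_inner _ _ _ i

theorem intVar_down_right {S Ss : Tree} (P : Branch S) (T : Tree) (h : P.bh ≤ T.th) :
    intVar (.down (Ss := Ss) P) (cons T nil) (Nat.succ_le_succ h) (right nil.first) =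
      right (T := insTree P T h) Ss.first :=
  varCases_right (Ts := nil) (first (cons (insTree P T h) Ss)) (fun i => inner (intVar P T h i))
    (fun _ => right Ss.first) nil.first

theorem intVar_down {S Ss : Tree} (P : Branch S) (T : Tree) (h : P.bh ≤ T.th) :
    intVar (.down (Ss := Ss) P) (cons T nil) (Nat.succ_le_succ h) =
      fun i : Fin (T.size + 2) => inl (suspMap (intVar P T h) i) := by
  refine varCases_ext (T := T) (Ts := nil) ?_ (fun i => ?_) (fun i => ?_)
  · exact varCases_first _ _ _
  · exact varCases_inner _ _ _ i
  · rw [nil_var i]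
    exact varCases_right _ _ _ _

/-- The exterior substitution sends the variable of the branch to the unbiased coherence over the
inserted tree. -/
theorem exterior_var : {S : Tree} → (P : Branch S) → (T : Tree) → (h : P.bh ≤ T.th) →
    exterior P T h P.var = (unbiasedCoh P.lh T).rename (intVar P T h)
  | _, .here m rfl, T, h => by
      refine (exterior_here_inl m T h ((disc m).top.addNat 2)).trans ?_
      have h1 : discSub (m + 1) (unbiasedTy (m + 1) T) (unbiasedCoh (m + 1) T)
          (inner (disc m).top) = unbiasedCoh (m + 1) T := by
        have h2 := discSub_top (unbiasedCoh (m + 1) T) (dim_unbiasedTy (m + 1) T)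
        rwa [top_disc_succ] at h2
      exact congrArg _ h1
  | _, .skip P, T, h => by
      refine (exterior_skip_right P T h P.var).trans ?_
      rw [exterior_var P T h, Tm.rename_rename]
      rfl
  | _, .down (Ss := Ss) P, .cons T .nil, h => by
      have h' := Nat.le_of_succ_le_succ h
      refine (exterior_down_inner P T h' P.var).trans ?_
      rw [exterior_var P T h', Tm.susp_rename, Tm.rename_rename, unbiasedCoh_susp]
      exact congrArg (fun f => Tm.rename f (unbiasedCoh (P.lh + 1) (cons T nil)))
        (intVar_down (Ss := Ss) P T h').symm
  | _, .down _, .nil, h => absurd h (Nat.not_succ_le_zero _)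
  | _, .down _, .cons _ (.cons _ _), h => absurd h (Nat.not_succ_le_zero _)

/-- The exterior substitution sends the type of the variable of the branch to the unbiased type over
the inserted tree. -/
theorem ty_var_sub_exterior : {S : Tree} → (P : Branch S) → (T : Tree) → (h : P.bh ≤ T.th) →
    (S.ctx.ty P.var).sub (exterior P T h) = (unbiasedTy P.lh T).rename (intVar P T h)
  | _, .here (Ss := Ss) m rfl, T, h => by
      have h1 : (cons (disc m) Ss).ctx.ty (inner (disc m).top) = _ := ty_inner _
      refine (congrArg (Ty.sub _) h1).trans ?_
      rw [Ty.rename_sub]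
      have h2 : (disc (m + 1)).ctx.ty (disc (m + 1)).top = ((disc m).ctx.ty (disc m).top).susp := by
        rw [top_disc_succ]
        exact ty_inner_nil _
      refine (congrArg₂ Ty.sub (funext (exterior_here_inl (Ss := Ss) m T h)) h2.symm).trans ?_
      refine (Ty.sub_rename _ _ _).symm.trans ?_
      exact congrArg _ (ty_disc_top_sub_discSub _ (dim_unbiasedTy (m + 1) T))
  | _, .skip P, T, h => by
      refine (congrArg (Ty.sub _) (ty_right P.var)).trans ?_
      rw [Ty.rename_sub]
      refine (congrArg (fun f => Ty.sub f _) (funext (exterior_skip_right P T h))).trans ?_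
      refine (Ty.sub_rename _ _ _).symm.trans ?_
      rw [ty_var_sub_exterior P T h]
      exact Ty.rename_rename _ _ _
  | _, .down (Ss := Ss) P, .cons T .nil, h => by
      have h' := Nat.le_of_succ_le_succ h
      refine (congrArg (Ty.sub _) (ty_inner P.var)).trans ?_
      rw [Ty.rename_sub, funext (exterior_down_inl (Ss := Ss) P T h')]
      refine (Ty.sub_rename _ _ _).symm.trans ?_
      rw [← Ty.susp_sub, ty_var_sub_exterior P T h', Ty.susp_rename]
      refine (Ty.rename_rename _ _ _).trans ?_
      rw [unbiasedTy_susp]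
      exact congrArg (fun f => Ty.rename f (unbiasedTy (P.lh + 1) (cons T nil)))
        (intVar_down (Ss := Ss) P T h').symm
  | _, .down _, .nil, h => absurd h (Nat.not_succ_le_zero _)
  | _, .down _, .cons _ (.cons _ _), h => absurd h (Nat.not_succ_le_zero _)

section InsSub

variable {S Ss : Tree} {k : ℕ}

theorem insSub_here_appendInl (m : ℕ) (e : S = disc m) (T : Tree) (h : 0 ≤ T.th)
    (σ : Sub (cons S Ss).size k) (τ : Sub T.size k) (i : Fin T.size) :
    insSub (.here m e : Branch (cons S Ss)) T h σ τ (T.appendInl Ss i) = τ i := by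
  refine (Lab.toSub_append_appendInl (Lab.ofSub T τ) _ i).trans ?_
  rw [Lab.toSub_ofSub]

theorem insSub_here_appendInr (m : ℕ) (e : S = disc m) (T : Tree) (h : 0 ≤ T.th)
    (σ : Sub (cons S Ss).size k) (τ : Sub T.size k) (j : Fin Ss.size) (hj : j ≠ Ss.first) :
    insSub (.here m e : Branch (cons S Ss)) T h σ τ (T.appendInr Ss j) = σ (right j) := by
  refine (Lab.toSub_append_appendInr (Lab.ofSub T τ)
    (Lab.ofSub Ss (fun i => σ (right i))) j hj).trans ?_
  rw [Lab.toSub_ofSub]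

theorem insSub_skip_first (P : Branch Ss) (T : Tree) (h : P.bh ≤ T.th)
    (σ : Sub (cons S Ss).size k) (τ : Sub T.size k) :
    insSub (.skip (S := S) P) T h σ τ (first (cons S (insTree P T h))) = σ (first _) :=
  varCases_first (σ (first _)) (Lab.ofSub S (fun i => σ (inner i))).toSub
    (insSub P T h (fun i => σ (right i)) τ)

theorem insSub_skip_inner (P : Branch Ss) (T : Tree) (h : P.bh ≤ T.th)
    (σ : Sub (cons S Ss).size k) (τ : Sub T.size k) (i : Fin S.size) :
    insSub (.skip (S := S) P) T h σ τ (inner (Ts := insTree P T h) i) = σ (inner i) := by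
  refine (varCases_inner _ _ _ i).trans ?_
  rw [Lab.toSub_ofSub]

theorem insSub_skip_right (P : Branch Ss) (T : Tree) (h : P.bh ≤ T.th)
    (σ : Sub (cons S Ss).size k) (τ : Sub T.size k) (j : Fin (insTree P T h).size) :
    insSub (.skip (S := S) P) T h σ τ (right (T := S) j) =
      insSub P T h (fun i => σ (right i)) τ j :=
  varCases_right _ _ _ j

variable (P : Branch S) (T : Tree) (h : P.bh ≤ T.th) (σ : Sub (cons S Ss).size k)
  (τ : Sub (cons T nil).size k)

theorem insSub_down_first :
    insSub (.down (Ss := Ss) P) (cons T nil) (Nat.succ_le_succ h) σ τ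
      (first (cons (insTree P T h) Ss)) = τ (first _) :=
  varCases_first (τ (first _)) (insSub P T h (fun i => σ (inner i)) (fun i => τ (inner i)))
    ((Lab.ofSub Ss (fun i => σ (right i))).setFirst (τ (right nil.first))).toSub

theorem insSub_down_inner (i : Fin (insTree P T h).size) :
    insSub (.down (Ss := Ss) P) (cons T nil) (Nat.succ_le_succ h) σ τ (inner (Ts := Ss) i) =
      insSub P T h (fun i => σ (inner i)) (fun i => τ (inner i)) i :=
  varCases_inner _ _ _ i

theorem insSub_down_right_first :
    insSub (.down (Ss := Ss) P) (cons T nil) (Nat.succ_le_succ h) σ τ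
      (right (T := insTree P T h) Ss.first) = τ (right nil.first) :=
  (varCases_right (τ (first _)) (insSub P T h (fun i => σ (inner i)) (fun i => τ (inner i)))
    ((Lab.ofSub Ss (fun i => σ (right i))).setFirst (τ (right nil.first))).toSub _).trans
      (Lab.toSub_setFirst_first _ _)

theorem insSub_down_right (j : Fin Ss.size) (hj : j ≠ Ss.first) :
    insSub (.down (Ss := Ss) P) (cons T nil) (Nat.succ_le_succ h) σ τ
      (right (T := insTree P T h) j) = σ (right j) := by
  refine (varCases_right _ _ _ _).trans ((Lab.toSub_setFirst_of_ne _ _ hj).trans ?_)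
  rw [Lab.toSub_ofSub]

end InsSub

/-- The inserted substitution restricts to `τ` on the inserted tree. -/
theorem insSub_intVar {k : ℕ} : {S : Tree} → (P : Branch S) → (T : Tree) → (h : P.bh ≤ T.th) →
    (σ : Sub S.size k) → (τ : Sub T.size k) → (i : Fin T.size) →
    insSub P T h σ τ (intVar P T h i) = τ i
  | _, .here m e, T, h, σ, τ, i => insSub_here_appendInl m e T h σ τ i
  | _, .skip P, T, h, σ, τ, i =>
      (insSub_skip_right P T h σ τ _).trans (insSub_intVar P T h _ τ i)
  | _, .down (Ss := Ss) P, .cons T .nil, h, σ, τ, i => by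
      have h' := Nat.le_of_succ_le_succ h
      rcases var_cases i with rfl | ⟨j, rfl⟩ | ⟨j, rfl⟩
      · exact (congrArg _ (varCases_first _ _ _)).trans (insSub_down_first P T h' σ τ)
      · exact (congrArg _ (varCases_inner _ _ _ j)).trans
          ((insSub_down_inner P T h' σ τ _).trans (insSub_intVar P T h' _ _ j))
      · rw [nil_var j]
        exact (congrArg _ (varCases_right _ _ _ _)).trans (insSub_down_right_first P T h' σ τ)
  | _, .down _, .nil, h, _, _, _ => absurd h (Nat.not_succ_le_zero _)
  | _, .down _, .cons _ (.cons _ _), h, _, _, _ => absurd h (Nat.not_succ_le_zero _)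

/-- The variable `x` of `S` survives an insertion as the variable `j` of the inserted tree: the
exterior substitution sends `x` to `j`, respecting its type, and every inserted substitution agrees
at `j` with the substitution from `S` at `x`. -/
structure Survives {S : Tree} (P : Branch S) (T : Tree) (h : P.bh ≤ T.th) (x : Fin S.size)
    (j : Fin (insTree P T h).size) : Prop where
  exterior_eq : exterior P T h x = .var j
  ty_eq : (insTree P T h).ctx.ty j = (S.ctx.ty x).sub (exterior P T h)
  insSub_eq : ∀ {k : ℕ} (σ : Sub S.size k) (τ : Sub T.size k), insSub P T h σ τ j = σ x

section Survives

variable {S Ss : Tree}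

theorem Survives.here {m : ℕ} {T : Tree} (h : 0 ≤ T.th) {j : Fin Ss.size} (hj : j ≠ Ss.first) :
    Survives (.here m rfl : Branch (cons (disc m) Ss)) T h (right j) (T.appendInr Ss j) where
  exterior_eq := exterior_here_right m T h j
  ty_eq := by
    refine (tyCompat_appendInr T Ss j).trans ?_
    rw [ty_right, Ty.rename_sub, funext (exterior_here_right m T h)]
    rfl
  insSub_eq σ τ := insSub_here_appendInr m rfl T h σ τ j hj

variable {P : Branch Ss} {T : Tree} {h : P.bh ≤ T.th}

theorem Survives.skip_first : Survives (.skip (S := S) P) T h (first _)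
    (first (cons S (insTree P T h))) where
  exterior_eq := exterior_skip_first P T h
  ty_eq := by
    rw [ty_first (cons S Ss), Ty.sub]
    exact ty_first (cons S (insTree P T h))
  insSub_eq σ τ := insSub_skip_first P T h σ τ

theorem Survives.skip_inner (i : Fin S.size) : Survives (.skip (S := S) P) T h (inner i)
    (inner (Ts := insTree P T h) i) where
  exterior_eq := exterior_skip_inner P T h i
  ty_eq := by
    have hl : ∀ i, exterior (.skip (S := S) P) T h (inl i) =
        .var (inl (Ts := insTree P T h) i) := by
      intro i
      rcases susp_var_cases i with rfl | rfl | ⟨j, rfl⟩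
      · exact exterior_skip_first P T h
      · refine (exterior_skip_right P T h Ss.first).trans ?_
        rw [exterior_first, Tm.rename_var]
        rfl
      · exact exterior_skip_inner P T h j
    rw [ty_inner, Ty.rename_sub, funext hl]
    exact ty_inner i
  insSub_eq σ τ := insSub_skip_inner P T h σ τ i

theorem Survives.skip_right {x : Fin Ss.size} {j : Fin (insTree P T h).size}
    (hx : Survives P T h x j) : Survives (.skip (S := S) P) T h (right x) (right (T := S) j) where
  exterior_eq := by
    refine (exterior_skip_right P T h x).trans ?_
    rw [hx.exterior_eq, Tm.rename_var]
    rfl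
  ty_eq := by
    rw [ty_right, Ty.rename_sub]
    refine Eq.trans ?_ (congrArg (fun f => Ty.sub f _) (funext (exterior_skip_right P T h))).symm
    refine Eq.trans ?_ (Ty.sub_rename _ _ _)
    rw [← hx.ty_eq]
    exact ty_right j
  insSub_eq σ τ := (insSub_skip_right P T h σ τ j).trans (hx.insSub_eq _ τ)

variable {P : Branch S} {T : Tree} {h : P.bh ≤ T.th}

theorem Survives.down_inner {x : Fin S.size} {j : Fin (insTree P T h).size}
    (hx : Survives P T h x j) : Survives (.down (Ss := Ss) P) (cons T nil) (Nat.succ_le_succ h)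
      (inner x) (inner (Ts := Ss) j) where
  exterior_eq := by
    refine (exterior_down_inner P T h x).trans ?_
    rw [hx.exterior_eq]
    rfl
  ty_eq := by
    rw [ty_inner, Ty.rename_sub, funext (exterior_down_inl (Ss := Ss) P T h)]
    refine Eq.trans ?_ (Ty.sub_rename _ _ _)
    rw [← Ty.susp_sub, ← hx.ty_eq]
    exact ty_inner j
  insSub_eq σ τ := (insSub_down_inner P T h σ τ j).trans (hx.insSub_eq _ _)

theorem Survives.down_right {j : Fin Ss.size} (hj : j ≠ Ss.first) :
    Survives (.down (Ss := Ss) P) (cons T nil) (Nat.succ_le_succ h)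
      (right j) (right (T := insTree P T h) j) where
  exterior_eq := exterior_down_right P T h j
  ty_eq := by
    rw [ty_right, Ty.rename_sub, funext (exterior_down_right P T h)]
    exact ty_right j
  insSub_eq σ τ := insSub_down_right P T h σ τ j hj

end Survives

/-- Every variable of the inserted tree comes from `T` or survives from `S`. -/
theorem insTree_var_cases : {S : Tree} → (P : Branch S) → (T : Tree) → (h : P.bh ≤ T.th) →
    (j : Fin (insTree P T h).size) → (∃ i, j = intVar P T h i) ∨ ∃ x, Survives P T h x j
  | _, .here (Ss := Ss) m rfl, T, h, j => by
      rcases append_var_cases T Ss j with ⟨i, rfl⟩ | ⟨i, hi, rfl⟩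
      · exact Or.inl ⟨i, rfl⟩
      · exact Or.inr ⟨_, Survives.here h hi⟩
  | _, .skip (S := S) P, T, h, j => by
      rcases var_cases (T := S) (Ts := insTree P T h) j with rfl | ⟨i, rfl⟩ | ⟨i, rfl⟩
      · exact Or.inr ⟨_, Survives.skip_first⟩
      · exact Or.inr ⟨_, Survives.skip_inner i⟩
      · rcases insTree_var_cases P T h i with ⟨i, rfl⟩ | ⟨x, hx⟩
        · exact Or.inl ⟨i, rfl⟩
        · exact Or.inr ⟨_, hx.skip_right⟩
  | _, .down (Ss := Ss) P, .cons T .nil, h, j => by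
      have h' := Nat.le_of_succ_le_succ h
      rcases var_cases (T := insTree P T h') (Ts := Ss) j with rfl | ⟨i, rfl⟩ | ⟨i, rfl⟩
      · exact Or.inl ⟨first _, (intVar_down_first P T h').symm⟩
      · rcases insTree_var_cases P T h' i with ⟨i, rfl⟩ | ⟨x, hx⟩
        · exact Or.inl ⟨inner i, (intVar_down_inner P T h' i).symm⟩
        · exact Or.inr ⟨_, hx.down_inner⟩
      · by_cases hi : i = Ss.first
        · subst hi
          exact Or.inl ⟨right (first nil), (intVar_down_right P T h').symm⟩
        · exact Or.inr ⟨_, Survives.down_right hi⟩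
  | _, .down _, .nil, h, _ => absurd h (Nat.not_succ_le_zero _)
  | _, .down _, .cons _ (.cons _ _), h, _ => absurd h (Nat.not_succ_le_zero _)

section BranchSupport

variable {S Ss : Tree}

theorem inl_mem_fv_ty_here (m : ℕ) (i : Fin ((disc m).size + 2)) :
    inl (Ts := Ss) i = inner (disc m).top ∨
      inl (Ts := Ss) i ∈ ((cons (disc m) Ss).ctx.ty (inner (disc m).top)).fv := by
  rcases mem_fv_ty_disc_top (m + 1) i with h | h
  · rw [top_disc_succ] at h
    subst h
    exact Or.inl rfl
  · rw [top_disc_succ] at h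
    right
    rw [ty_inner, Ty.mem_fv_rename]
    have h2 : (disc (m + 1)).ctx.ty (inner (disc m).top) = _ := ty_inner_nil _
    rw [h2] at h
    exact ⟨i, h, rfl⟩

theorem first_mem_fv_ty_inner (i : Fin S.size) :
    first (cons S Ss) ∈ ((cons S Ss).ctx.ty (inner i)).fv := by
  rw [ty_inner, Ty.mem_fv_rename]
  exact ⟨0, (Ty.poles_mem_fv_susp _).1, rfl⟩

theorem right_first_mem_fv_ty_inner (i : Fin S.size) :
    right Ss.first ∈ ((cons S Ss).ctx.ty (inner i)).fv := by
  rw [ty_inner, Ty.mem_fv_rename]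
  exact ⟨1, (Ty.poles_mem_fv_susp _).2, rfl⟩

theorem inner_mem_fv_ty_inner {i x : Fin S.size} (hx : x ∈ (S.ctx.ty i).fv) :
    inner x ∈ ((cons S Ss).ctx.ty (inner i)).fv := by
  rw [ty_inner, Ty.mem_fv_rename]
  exact ⟨x.addNat 2, (Ty.mem_fv_susp _ _).2 hx, rfl⟩

theorem right_mem_fv_ty_right {i x : Fin Ss.size} (hx : x ∈ (Ss.ctx.ty i).fv) :
    right x ∈ ((cons S Ss).ctx.ty (right i)).fv := by
  rw [ty_right, Ty.mem_fv_rename]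
  exact ⟨x, hx, rfl⟩

end BranchSupport

/-- A variable of `S` is the branch, or occurs in its type, or survives the insertion. -/
theorem survives_cases : {S : Tree} → (P : Branch S) → (T : Tree) → (h : P.bh ≤ T.th) →
    (x : Fin S.size) → x = P.var ∨ x ∈ (S.ctx.ty P.var).fv ∨ ∃ j, Survives P T h x j
  | _, .here (Ss := Ss) m rfl, T, h, x => by
      rcases var_cases x with rfl | ⟨i, rfl⟩ | ⟨i, rfl⟩
      · exact Or.inr (Or.inl (first_mem_fv_ty_inner _))
      · exact (inl_mem_fv_ty_here m (i.addNat 2)).imp_right Or.inl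
      · by_cases hi : i = Ss.first
        · subst hi
          exact Or.inr (Or.inl (right_first_mem_fv_ty_inner _))
        · exact Or.inr (Or.inr ⟨_, Survives.here h hi⟩)
  | _, .skip (S := S) P, T, h, x => by
      rcases var_cases x with rfl | ⟨i, rfl⟩ | ⟨i, rfl⟩
      · exact Or.inr (Or.inr ⟨_, Survives.skip_first⟩)
      · exact Or.inr (Or.inr ⟨_, Survives.skip_inner i⟩)
      · rcases survives_cases P T h i with rfl | hx | ⟨j, hj⟩
        · exact Or.inl rfl
        · exact Or.inr (Or.inl (right_mem_fv_ty_right hx))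
        · exact Or.inr (Or.inr ⟨_, hj.skip_right⟩)
  | _, .down (Ss := Ss) P, .cons T .nil, h, x => by
      have h' := Nat.le_of_succ_le_succ h
      rcases var_cases x with rfl | ⟨i, rfl⟩ | ⟨i, rfl⟩
      · exact Or.inr (Or.inl (first_mem_fv_ty_inner _))
      · rcases survives_cases P T h' i with rfl | hx | ⟨j, hj⟩
        · exact Or.inl rfl
        · exact Or.inr (Or.inl (inner_mem_fv_ty_inner hx))
        · exact Or.inr (Or.inr ⟨_, hj.down_inner⟩)
      · by_cases hi : i = Ss.first
        · subst hi
          exact Or.inr (Or.inl (right_first_mem_fv_ty_inner _))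
        · exact Or.inr (Or.inr ⟨_, Survives.down_right hi⟩)
  | _, .down _, .nil, h, _ => absurd h (Nat.not_succ_le_zero _)
  | _, .down _, .cons _ (.cons _ _), h, _ => absurd h (Nat.not_succ_le_zero _)

/-! ### Inserting a disc of codimension one -/

/-- The branch of the tree obtained by inserting `Dᴺ` at a branch `P` of leaf height `N + 1` whose
branch height is less than `N`: the linear subtree at the end of `P` has lost its top variable. -/
def prune : {S : Tree} → (P : Branch S) → (N : ℕ) → (h : P.bh ≤ (disc N).th) → P.bh < N →
    Branch (insTree P (disc N) h)
  | _, .here _ _, N + 1, _, _ => .here N rfl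
  | _, .here _ _, 0, _, hb => absurd hb (Nat.not_lt_zero _)
  | _, .skip P, N, h, hb => .skip (prune P N h hb)
  | _, .down P, N + 1, h, hb =>
      .down (prune P N (Nat.le_of_succ_le_succ h) (Nat.lt_of_succ_lt_succ hb))
  | _, .down _, 0, _, hb => absurd hb (Nat.not_lt_zero _)

theorem bh_prune : {S : Tree} → (P : Branch S) → (N : ℕ) → (h : P.bh ≤ (disc N).th) →
    (hb : P.bh < N) → (prune P N h hb).bh = P.bh
  | _, .here _ _, _ + 1, _, _ => rfl
  | _, .here _ _, 0, _, hb => absurd hb (Nat.not_lt_zero _)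
  | _, .skip P, N, h, hb => bh_prune P N h hb
  | _, .down P, N + 1, h, hb =>
      congrArg (· + 1) (bh_prune P N (Nat.le_of_succ_le_succ h) (Nat.lt_of_succ_lt_succ hb))
  | _, .down _, 0, _, hb => absurd hb (Nat.not_lt_zero _)

theorem lh_prune : {S : Tree} → (P : Branch S) → (N : ℕ) → (h : P.bh ≤ (disc N).th) →
    (hb : P.bh < N) → (prune P N h hb).lh = N
  | _, .here _ _, _ + 1, _, _ => rfl
  | _, .here _ _, 0, _, hb => absurd hb (Nat.not_lt_zero _)
  | _, .skip P, N, h, hb => lh_prune P N h hb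
  | _, .down P, N + 1, h, hb =>
      congrArg (· + 1) (lh_prune P N (Nat.le_of_succ_le_succ h) (Nat.lt_of_succ_lt_succ hb))
  | _, .down _, 0, _, hb => absurd hb (Nat.not_lt_zero _)

theorem var_prune : {S : Tree} → (P : Branch S) → (N : ℕ) → (h : P.bh ≤ (disc N).th) →
    (hb : P.bh < N) → (prune P N h hb).var = intVar P (disc N) h (disc N).top
  | _, .here (Ss := Ss) _ _, N + 1, _, _ => by
      rw [top_disc_succ]
      exact (appendInl_inner (T := disc N) (Ts := nil) Ss (disc N).top).symm
  | _, .here _ _, 0, _, hb => absurd hb (Nat.not_lt_zero _)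
  | _, .skip P, N, h, hb => congrArg right (var_prune P N h hb)
  | _, .down P, N + 1, h, hb => by
      have h' := Nat.le_of_succ_le_succ h
      rw [top_disc_succ]
      exact (congrArg inner (var_prune P N h' (Nat.lt_of_succ_lt_succ hb))).trans
        (intVar_down_inner P (disc N) h' (disc N).top).symm
  | _, .down _, 0, _, hb => absurd hb (Nat.not_lt_zero _)

theorem dim_insTree_disc_le : {S : Tree} → (P : Branch S) → (N : ℕ) →
    (h : P.bh ≤ (disc N).th) → P.bh < N → P.lh = N + 1 → (insTree P (disc N) h).dim ≤ S.dim
  | _, .here (Ss := Ss) m rfl, N + 1, _, _, hl => by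
      have hm : m = N + 1 := Nat.succ.inj hl
      change max ((disc N).dim + 1) Ss.dim ≤ max ((disc m).dim + 1) Ss.dim
      rw [dim_disc, dim_disc]
      omega
  | _, .here _ _, 0, _, hb, _ => absurd hb (Nat.not_lt_zero _)
  | _, .skip (S := S) P, N, h, hb, hl =>
      max_le_max (le_refl (S.dim + 1)) (dim_insTree_disc_le P N h hb hl)
  | _, .down (Ss := Ss) P, N + 1, h, hb, hl =>
      max_le_max (Nat.succ_le_succ (dim_insTree_disc_le P N (Nat.le_of_succ_le_succ h)
        (Nat.lt_of_succ_lt_succ hb) (Nat.succ.inj hl))) (le_refl Ss.dim)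
  | _, .down _, 0, _, hb, _ => absurd hb (Nat.not_lt_zero _)

/-! ### Boundaries and the exterior substitution -/

/-- A substitution between trees is compatible with boundaries if the free variables of the images
of the variables of each boundary of the source are those of the same boundary of the target. -/
def BdryCompat {S X : Tree} (κ : Sub S.size X.size) : Prop :=
  ∀ ε d y, y ∈ Set.range (bdryInc ε d X) ↔ ∃ x ∈ Set.range (bdryInc ε d S), y ∈ (κ x).fv

theorem mem_range_bdryInc_false_zero {T : Tree} {y : Fin T.size} :
    y ∈ Set.range (bdryInc false 0 T) ↔ y = T.first :=
  ⟨fun ⟨_, h⟩ => h.symm.trans (bdryInc_false_zero T _),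
    fun h => ⟨Tree.first _, (bdryInc_false_zero T _).trans h.symm⟩⟩

theorem mem_range_bdryInc_true_zero {T : Tree} {y : Fin T.size} :
    y ∈ Set.range (bdryInc true 0 T) ↔ y = T.lastObj :=
  ⟨fun ⟨_, h⟩ => h.symm.trans (bdryInc_true_zero T _),
    fun h => ⟨Tree.first _, (bdryInc_true_zero T _).trans h.symm⟩⟩

theorem bdryCompat_zero {S X : Tree} {κ : Sub S.size X.size} (h0 : κ S.first = .var X.first)
    (h1 : κ S.lastObj = .var X.lastObj) (ε : Bool) (y : Fin X.size) :
    y ∈ Set.range (bdryInc ε 0 X) ↔ ∃ x ∈ Set.range (bdryInc ε 0 S), y ∈ (κ x).fv := by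
  cases ε
  · simp only [mem_range_bdryInc_false_zero, exists_eq_left, h0, Tm.fv, Set.mem_singleton_iff]
  · simp only [mem_range_bdryInc_true_zero, exists_eq_left, h1, Tm.fv, Set.mem_singleton_iff]

theorem inner_mem_fv_rename_inl {T Ts : Tree} {y : Fin T.size} {t : Tm T.size} :
    inner (Ts := Ts) y ∈ (t.susp.rename inl).fv ↔ y ∈ t.fv := by
  rw [Tm.mem_fv_rename]
  constructor
  · rintro ⟨x, hx, h⟩
    rcases susp_var_cases x with rfl | rfl | ⟨j, rfl⟩
    · exact absurd h (first_ne_inner _)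
    · rw [inl_one] at h
      exact absurd h.symm (inner_ne_right _ _)
    · rw [inner_injective h] at hx
      exact (Tm.mem_fv_susp _ _).1 hx
  · exact fun h => ⟨y.addNat 2, (Tm.mem_fv_susp _ _).2 h, rfl⟩

theorem eq_first_of_right_mem_fv_rename_inl {T Ts : Tree} {y : Fin Ts.size} {t : Tm T.size}
    (h : right y ∈ (t.susp.rename inl).fv) : y = Ts.first := by
  rw [Tm.mem_fv_rename] at h
  obtain ⟨x, -, h⟩ := h
  rcases susp_var_cases x with rfl | rfl | ⟨j, rfl⟩
  · exact absurd h (first_ne_right _)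
  · rw [inl_one] at h
    exact (right_injective h).symm
  · exact absurd h (inner_ne_right _ _)

theorem BdryCompat.cons {S X Ss : Tree} {κ₁ : Sub S.size X.size} (h : BdryCompat κ₁)
    {κ : Sub (cons S Ss).size (cons X Ss).size} (h0 : κ (first _) = .var (first _))
    (h1 : ∀ i, κ (inner i) = (κ₁ i).susp.rename inl) (h2 : ∀ j, κ (right j) = .var (right j)) :
    BdryCompat κ := by
  intro ε d y
  cases d with
  | zero => exact bdryCompat_zero h0 (h2 _) ε y
  | succ d =>
    constructor
    · intro hy
      rcases var_cases y with rfl | ⟨y, rfl⟩ | ⟨y, rfl⟩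
      · exact ⟨_, mem_range_bdryInc_first ε d _, by rw [h0, Tm.fv]; rfl⟩
      · obtain ⟨x, hx, hxy⟩ := (h ε d y).1 (mem_range_bdryInc_inner.1 hy)
        exact ⟨inner x, mem_range_bdryInc_inner.2 hx, by rwa [h1, inner_mem_fv_rename_inl]⟩
      · exact ⟨right y, mem_range_bdryInc_right.2 (mem_range_bdryInc_right.1 hy),
          by rw [h2, Tm.fv]; rfl⟩
    · rintro ⟨x, hx, hxy⟩
      rcases var_cases x with rfl | ⟨x, rfl⟩ | ⟨x, rfl⟩
      · rw [h0, Tm.fv, Set.mem_singleton_iff] at hxy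
        subst hxy
        exact mem_range_bdryInc_first ε d _
      · rw [h1] at hxy
        rcases var_cases y with rfl | ⟨y, rfl⟩ | ⟨y, rfl⟩
        · exact mem_range_bdryInc_first ε d _
        · exact mem_range_bdryInc_inner.2
            ((h ε d y).2 ⟨x, mem_range_bdryInc_inner.1 hx, inner_mem_fv_rename_inl.1 hxy⟩)
        · rw [eq_first_of_right_mem_fv_rename_inl hxy]
          exact mem_range_bdryInc_right.2 (mem_range_bdryInc_first ε d _)
      · rw [h2, Tm.fv, Set.mem_singleton_iff] at hxy
        subst hxy
        exact mem_range_bdryInc_right.2 (mem_range_bdryInc_right.1 hx)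

theorem BdryCompat.cons_right {S Ss Xs : Tree} {κ₁ : Sub Ss.size Xs.size} (h : BdryCompat κ₁)
    {κ : Sub (Tree.cons S Ss).size (Tree.cons S Xs).size} (h0 : κ (first _) = .var (first _))
    (hl : κ (lastObj _) = .var (lastObj _)) (h1 : ∀ i, κ (inner i) = .var (inner i))
    (h2 : ∀ j, κ (right j) = (κ₁ j).rename right) : BdryCompat κ := by
  intro ε d y
  cases d with
  | zero => exact bdryCompat_zero h0 hl ε y
  | succ d =>
    constructor
    · intro hy
      rcases var_cases y with rfl | ⟨y, rfl⟩ | ⟨y, rfl⟩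
      · exact ⟨_, mem_range_bdryInc_first ε d _, by rw [h0, Tm.fv]; rfl⟩
      · exact ⟨inner y, mem_range_bdryInc_inner.2 (mem_range_bdryInc_inner.1 hy),
          by rw [h1, Tm.fv]; rfl⟩
      · obtain ⟨x, hx, hxy⟩ := (h ε (d + 1) y).1 (mem_range_bdryInc_right.1 hy)
        refine ⟨right x, mem_range_bdryInc_right.2 hx, ?_⟩
        rw [h2]
        exact (Tm.mem_fv_rename _ _ _).2 ⟨y, hxy, rfl⟩
    · rintro ⟨x, hx, hxy⟩
      rcases var_cases x with rfl | ⟨x, rfl⟩ | ⟨x, rfl⟩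
      · rw [h0, Tm.fv, Set.mem_singleton_iff] at hxy
        subst hxy
        exact mem_range_bdryInc_first ε d _
      · rw [h1, Tm.fv, Set.mem_singleton_iff] at hxy
        subst hxy
        exact mem_range_bdryInc_inner.2 (mem_range_bdryInc_inner.1 hx)
      · rw [h2] at hxy
        obtain ⟨z, hz, rfl⟩ := (Tm.mem_fv_rename _ _ _).1 hxy
        exact mem_range_bdryInc_right.2
          ((h ε (d + 1) z).2 ⟨x, mem_range_bdryInc_right.1 hx, hz⟩)

/-- The substitution `Dⁿ⁺¹ → Dⁿ` classifying the identity of the top variable is compatible with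
boundaries, being an iterated suspension of the one for `n = 0`. -/
theorem bdryCompat_disc : (n : ℕ) → BdryCompat (S := disc (n + 1)) (X := disc n)
    (discSub (n + 1) (unbiasedTy (n + 1) (disc n)) (unbiasedCoh (n + 1) (disc n)))
  | 0 => by
      obtain ⟨h0, h1⟩ := discSub_unbiasedTy_objects 0 (disc 0) (unbiasedCoh 1 (disc 0))
      intro ε d y
      cases d with
      | zero => exact bdryCompat_zero h0 h1 ε y
      | succ d =>
        obtain rfl : y = (disc 0).first := nil_var y
        refine ⟨fun _ => ⟨_, mem_range_bdryInc_first ε d _, ?_⟩,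
          fun _ => mem_range_bdryInc_first ε d _⟩
        rw [h0, Tm.fv]
        rfl
  | n + 1 => by
      have key : discSub (n + 2) (unbiasedTy (n + 2) (disc (n + 1)))
          (unbiasedCoh (n + 2) (disc (n + 1))) =
          Sub.susp (discSub (n + 1) (unbiasedTy (n + 1) (disc n))
            (unbiasedCoh (n + 1) (disc n))) := by
        rw [discSub_susp _ (dim_unbiasedTy _ _), unbiasedTy_susp, unbiasedCoh_susp]
        rfl
      rw [key]
      refine BdryCompat.cons (S := disc (n + 1)) (X := disc n) (Ss := nil) (bdryCompat_disc n)
        rfl (fun i => ?_) (fun j => ?_)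
      · exact (Tm.sub_var _).symm
      · rw [nil_var j]
        rfl

/-- For `bh(P) < N`, the disc inserted at the end of `P` is a suspension. The exterior substitution
is then built from that of `bdryCompat_disc` by suspensions and wedge sums that keep the first and
the last object. -/
theorem bdryCompat_exterior : {S : Tree} → (P : Branch S) → (N : ℕ) →
    (h : P.bh ≤ (disc N).th) → P.bh < N → P.lh = N + 1 → BdryCompat (exterior P (disc N) h)
  | _, .here (Ss := Ss) m rfl, N + 1, h, _, hl => by
      obtain rfl : m = N + 1 := Nat.succ.inj hl
      refine BdryCompat.cons (S := disc (N + 1)) (X := disc N) (Ss := Ss) (bdryCompat_disc N)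
        (exterior_first _ _ _) (fun i => ?_) (fun j => exterior_here_right (N + 1) _ h j)
      refine (exterior_here_inl (N + 1) (disc (N + 1)) h (i.addNat 2)).trans ?_
      have key : discSub (N + 2) (unbiasedTy (N + 2) (disc (N + 1)))
          (unbiasedCoh (N + 2) (disc (N + 1))) =
          Sub.susp (discSub (N + 1) (unbiasedTy (N + 1) (disc N))
            (unbiasedCoh (N + 1) (disc N))) := by
        rw [discSub_susp _ (dim_unbiasedTy _ _), unbiasedTy_susp, unbiasedCoh_susp]
        rfl
      rw [key]
      refine congrArg (fun f => Tm.rename f _) ?_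
      refine varCases_ext (T := disc N) (Ts := nil) (varCases_first _ _ _)
        (fun i => varCases_inner _ _ _ i) (fun j => ?_)
      rw [nil_var j]
      exact varCases_right _ _ _ _
  | _, .here _ _, 0, _, hb, _ => absurd hb (Nat.not_lt_zero _)
  | _, .skip (S := S) P, N, h, hb, hl =>
      BdryCompat.cons_right (bdryCompat_exterior P N h hb hl)
        (exterior_first (.skip (S := S) P) (disc N) h)
        (exterior_lastObj (.skip (S := S) P) (disc N) h)
        (exterior_skip_inner P (disc N) h) (exterior_skip_right P (disc N) h)
  | _, .down (Ss := Ss) P, N + 1, h, hb, hl => by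
      have h' := Nat.le_of_succ_le_succ h
      exact BdryCompat.cons
        (bdryCompat_exterior P N h' (Nat.lt_of_succ_lt_succ hb) (Nat.succ.inj hl))
        (exterior_down_first P (disc N) h') (exterior_down_inner P (disc N) h')
        (exterior_down_right P (disc N) h')
  | _, .down _, 0, _, hb, _ => absurd hb (Nat.not_lt_zero _)

/-! ### Insertion after insertion of a disc -/

section Cast

variable {A B C : Tree}

theorem cast_inner (e : A = B) (h : (cons A C).size = (cons B C).size) (i : Fin A.size) :
    Fin.cast h (inner i) = inner (Fin.cast (congrArg size e) i) := by
  subst e; rfl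

theorem cast_right_left (e : A = B) (h : (cons A C).size = (cons B C).size) (i : Fin C.size) :
    Fin.cast h (right i) = right i := by
  subst e; rfl

theorem cast_inner_right (e : A = B) (h : (cons C A).size = (cons C B).size) (i : Fin C.size) :
    Fin.cast h (inner i) = inner i := by
  subst e; rfl

theorem cast_right (e : A = B) (h : (cons C A).size = (cons C B).size) (i : Fin A.size) :
    Fin.cast h (right i) = right (Fin.cast (congrArg size e) i) := by
  subst e; rfl

end Cast

/-- Inserting a disc and then a tree at the pruned branch yields the same tree as inserting the tree
directly. -/
theorem insTree_prune : {S : Tree} → (P : Branch S) → (N : ℕ) → (h : P.bh ≤ (disc N).th) →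
    (hb : P.bh < N) → (T : Tree) → (hT : P.bh ≤ T.th) → (hT' : (prune P N h hb).bh ≤ T.th) →
    insTree (prune P N h hb) T hT' = insTree P T hT
  | _, .here _ _, _ + 1, _, _, _, _, _ => rfl
  | _, .here _ _, 0, _, hb, _, _, _ => absurd hb (Nat.not_lt_zero _)
  | _, .skip (S := S) P, N, h, hb, T, hT, hT' =>
      congrArg (cons S) (insTree_prune P N h hb T hT hT')
  | _, .down (Ss := Ss) P, _ + 1, h, hb, .cons T .nil, hT, hT' =>
      congrArg (fun X => cons X Ss) (insTree_prune P _ (Nat.le_of_succ_le_succ h)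
        (Nat.lt_of_succ_lt_succ hb) T (Nat.le_of_succ_le_succ hT) (Nat.le_of_succ_le_succ hT'))
  | _, .down _, 0, _, hb, _, _, _ => absurd hb (Nat.not_lt_zero _)
  | _, .down _, _, _, _, .nil, h, _ => absurd h (Nat.not_succ_le_zero _)
  | _, .down _, _, _, _, .cons _ (.cons _ _), h, _ => absurd h (Nat.not_succ_le_zero _)

theorem cast_intVar_prune : {S : Tree} → (P : Branch S) → (N : ℕ) → (h : P.bh ≤ (disc N).th) →
    (hb : P.bh < N) → (T : Tree) → (hT : P.bh ≤ T.th) → (hT' : (prune P N h hb).bh ≤ T.th) →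
    (e : (insTree (prune P N h hb) T hT').size = (insTree P T hT).size) → (i : Fin T.size) →
    Fin.cast e (intVar (prune P N h hb) T hT' i) = intVar P T hT i
  | _, .here _ _, _ + 1, _, _, _, _, _, _, _ => rfl
  | _, .here _ _, 0, _, hb, _, _, _, _, _ => absurd hb (Nat.not_lt_zero _)
  | _, .skip (S := S) P, N, h, hb, T, hT, hT', e, i =>
      (cast_right (insTree_prune P N h hb T hT hT') e _).trans
        (congrArg right (cast_intVar_prune P N h hb T hT hT' _ i))
  | _, .down (Ss := Ss) P, N + 1, h, hb, .cons T .nil, hT, hT', e, i => by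
      have h1 := Nat.le_of_succ_le_succ h
      have hb1 := Nat.lt_of_succ_lt_succ hb
      have hT1 := Nat.le_of_succ_le_succ hT
      have hT1' : (prune P N h1 hb1).bh ≤ T.th := Nat.le_of_succ_le_succ hT'
      have e1 := insTree_prune P N h1 hb1 T hT1 hT1'
      rcases var_cases i with rfl | ⟨i, rfl⟩ | ⟨i, rfl⟩
      · exact (congrArg (Fin.cast e) (intVar_down_first (prune P N h1 hb1) T hT1')).trans
          (intVar_down_first P T hT1).symm
      · exact (congrArg (Fin.cast e) (intVar_down_inner (prune P N h1 hb1) T hT1' i)).trans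
          ((cast_inner e1 e _).trans ((congrArg inner
            (cast_intVar_prune P N h1 hb1 T hT1 hT1' _ i)).trans
              (intVar_down_inner P T hT1 i).symm))
      · rw [nil_var i]
        exact (congrArg (Fin.cast e) (intVar_down_right (prune P N h1 hb1) T hT1')).trans
          ((cast_right_left e1 e _).trans (intVar_down_right P T hT1).symm)
  | _, .down _, 0, _, hb, _, _, _, _, _ => absurd hb (Nat.not_lt_zero _)
  | _, .down _, _, _, _, .nil, h, _, _, _ => absurd h (Nat.not_succ_le_zero _)
  | _, .down _, _, _, _, .cons _ (.cons _ _), h, _, _, _ => absurd h (Nat.not_succ_le_zero _)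

/-- A variable of `S` is the branch, or occurs in its type, or survives all three insertions: that
of the disc, that of `T` at the pruned branch, and the direct insertion of `T`. It does so as the
same variable of the final tree. -/
theorem survives_prune : {S : Tree} → (P : Branch S) → (N : ℕ) → (h : P.bh ≤ (disc N).th) →
    (hb : P.bh < N) → (T : Tree) → (hT : P.bh ≤ T.th) → (hT' : (prune P N h hb).bh ≤ T.th) →
    (e : (insTree (prune P N h hb) T hT').size = (insTree P T hT).size) → (x : Fin S.size) →
    x = P.var ∨ x ∈ (S.ctx.ty P.var).fv ∨ ∃ j j', Survives P (disc N) h x j ∧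
      Survives (prune P N h hb) T hT' j j' ∧ Survives P T hT x (Fin.cast e j')
  | _, .here (Ss := Ss) m rfl, N + 1, h, hb, T, hT, hT', e, x => by
      rcases var_cases x with rfl | ⟨i, rfl⟩ | ⟨i, rfl⟩
      · exact Or.inr (Or.inl (first_mem_fv_ty_inner _))
      · exact (inl_mem_fv_ty_here m (i.addNat 2)).imp_right Or.inl
      · by_cases hi : i = Ss.first
        · subst hi
          exact Or.inr (Or.inl (right_first_mem_fv_ty_inner _))
        · exact Or.inr (Or.inr ⟨_, _, Survives.here h hi, Survives.here hT' hi,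
            Survives.here hT hi⟩)
  | _, .here _ _, 0, _, hb, _, _, _, _, _ => absurd hb (Nat.not_lt_zero _)
  | _, .skip (S := S) P, N, h, hb, T, hT, hT', e, x => by
      have e1 := insTree_prune P N h hb T hT hT'
      rcases var_cases x with rfl | ⟨i, rfl⟩ | ⟨i, rfl⟩
      · refine Or.inr (Or.inr ⟨_, _, Survives.skip_first, Survives.skip_first, ?_⟩)
        exact Survives.skip_first
      · refine Or.inr (Or.inr ⟨_, _, Survives.skip_inner i, Survives.skip_inner i, ?_⟩)
        have h2 := cast_inner_right e1 e i
        exact h2 ▸ Survives.skip_inner i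
      · rcases survives_prune P N h hb T hT hT' (congrArg size e1) i with
          rfl | hx | ⟨j, j', hj, hj', hx⟩
        · exact Or.inl rfl
        · exact Or.inr (Or.inl (right_mem_fv_ty_right hx))
        · refine Or.inr (Or.inr ⟨_, _, hj.skip_right, hj'.skip_right, ?_⟩)
          have h2 := cast_right e1 e j'
          exact h2 ▸ hx.skip_right
  | _, .down (Ss := Ss) P, N + 1, h, hb, .cons T .nil, hT, hT', e, x => by
      have h1 := Nat.le_of_succ_le_succ h
      have hb1 := Nat.lt_of_succ_lt_succ hb
      have hT1 := Nat.le_of_succ_le_succ hT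
      have hT1' : (prune P N h1 hb1).bh ≤ T.th := Nat.le_of_succ_le_succ hT'
      have e1 := insTree_prune P N h1 hb1 T hT1 hT1'
      rcases var_cases x with rfl | ⟨i, rfl⟩ | ⟨i, rfl⟩
      · exact Or.inr (Or.inl (first_mem_fv_ty_inner _))
      · rcases survives_prune P N h1 hb1 T hT1 hT1' (congrArg size e1) i with
          rfl | hx | ⟨j, j', hj, hj', hx⟩
        · exact Or.inl rfl
        · exact Or.inr (Or.inl (inner_mem_fv_ty_inner hx))
        · refine Or.inr (Or.inr ⟨_, _, hj.down_inner, hj'.down_inner, ?_⟩)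
          have h2 := cast_inner e1 e j'
          exact h2 ▸ hx.down_inner
      · by_cases hi : i = Ss.first
        · subst hi
          exact Or.inr (Or.inl (right_first_mem_fv_ty_inner _))
        · refine Or.inr (Or.inr ⟨_, _, Survives.down_right hi, Survives.down_right hi, ?_⟩)
          have h2 := cast_right_left e1 e i
          exact h2 ▸ Survives.down_right hi
  | _, .down _, 0, _, hb, _, _, _, _, _ => absurd hb (Nat.not_lt_zero _)
  | _, .down _, _, _, _, .nil, h, _, _, _ => absurd h (Nat.not_succ_le_zero _)
  | _, .down _, _, _, _, .cons _ (.cons _ _), h, _, _, _ => absurd h (Nat.not_succ_le_zero _)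

theorem insSub_sub {k l : ℕ} {S : Tree} (P : Branch S) (T : Tree) (h : P.bh ≤ T.th)
    (σ : Sub S.size k) (τ : Sub T.size k) (ρ : Sub k l) :
    (fun j => (insSub P T h σ τ j).sub ρ) =
      insSub P T h (fun i => (σ i).sub ρ) (fun i => (τ i).sub ρ) := by
  funext j
  rcases insTree_var_cases P T h j with ⟨i, rfl⟩ | ⟨x, hx⟩
  · rw [insSub_intVar, insSub_intVar]
  · rw [hx.insSub_eq, hx.insSub_eq]

theorem Survives.ne_var {S : Tree} {P : Branch S} {T : Tree} {h : P.bh ≤ T.th} {x : Fin S.size}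
    {j : Fin (insTree P T h).size} (hx : Survives P T h x j) : x ≠ P.var := by
  rintro rfl
  have := hx.exterior_eq
  rw [exterior_var, unbiasedCoh, Tm.rename, Tm.sub] at this
  cases this

/-- The inserted substitution does not depend on the argument at the branch. -/
theorem insSub_congr {k : ℕ} {S : Tree} (P : Branch S) (T : Tree) (h : P.bh ≤ T.th)
    {σ σ' : Sub S.size k} (τ : Sub T.size k) (hσ : ∀ x, x ≠ P.var → σ x = σ' x) :
    insSub P T h σ τ = insSub P T h σ' τ := by
  funext j
  rcases insTree_var_cases P T h j with ⟨i, rfl⟩ | ⟨x, hx⟩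
  · rw [insSub_intVar, insSub_intVar]
  · rw [hx.insSub_eq, hx.insSub_eq, hσ x hx.ne_var]

theorem mem_fv_sub_exterior {S : Tree} (P : Branch S) (T : Tree) (h : P.bh ≤ T.th)
    {x : Fin S.size} (hx : x ∈ (S.ctx.ty P.var).fv) {j : Fin (insTree P T h).size}
    (hj : j ∈ (exterior P T h x).fv) : ∃ i, j = intVar P T h i := by
  have h1 : j ∈ ((S.ctx.ty P.var).sub (exterior P T h)).fv :=
    (Ty.mem_fv_sub _ _ _).2 ⟨x, hx, hj⟩
  rw [ty_var_sub_exterior, Ty.mem_fv_rename] at h1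
  obtain ⟨i, -, h1⟩ := h1
  exact ⟨i, h1.symm⟩

theorem insSub_prune {k : ℕ} {S : Tree} (P : Branch S) (N : ℕ) (h : P.bh ≤ (disc N).th)
    (hb : P.bh < N) (T : Tree) (hT : P.bh ≤ T.th) (hT' : (prune P N h hb).bh ≤ T.th)
    (e : (insTree (prune P N h hb) T hT').size = (insTree P T hT).size)
    (σ : Sub S.size k) (ρ : Sub (disc N).size k) (τ : Sub T.size k)
    (i : Fin (insTree (prune P N h hb) T hT').size) :
    insSub (prune P N h hb) T hT' (insSub P (disc N) h σ ρ) τ i =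
      insSub P T hT σ τ (Fin.cast e i) := by
  have hint : ∀ i k, Fin.cast e i = intVar P T hT k → i = intVar (prune P N h hb) T hT' k := by
    intro i k hk
    rw [← cast_intVar_prune P N h hb T hT hT' e] at hk
    exact Fin.cast_injective e hk
  rcases insTree_var_cases P T hT (Fin.cast e i) with ⟨k, hk⟩ | ⟨x, hx⟩
  · rw [hk, hint i k hk, insSub_intVar, insSub_intVar]
  · rcases survives_prune P N h hb T hT hT' e x with rfl | hx' | ⟨j, j', hj, hj', hx'⟩
    · exact absurd rfl hx.ne_var
    · obtain ⟨k, hk⟩ := mem_fv_sub_exterior P T hT hx' (j := Fin.cast e i)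
        (by rw [hx.exterior_eq, Tm.fv]; rfl)
      rw [hk, hint i k hk, insSub_intVar, insSub_intVar]
    · have h1 := hx.exterior_eq.symm.trans hx'.exterior_eq
      have h2 : i = j' := Fin.cast_injective e (Tm.var.inj h1)
      rw [hx.insSub_eq, h2, hj'.insSub_eq, hj.insSub_eq]

/-! ### Equality of types and terms -/

section Equality

variable {R : Rules}

mutual
theorem TyEq.refl {n : ℕ} {Γ : Ctx n} : (A : Ty n) → TyEq R Γ A A
  | .star => .star
  | .arr s A t => .arr (TmEq.refl s) (TmEq.refl t) (TyEq.refl A)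
theorem TmEq.refl {n : ℕ} {Γ : Ctx n} : (t : Tm n) → TmEq R Γ t t
  | .var i => .var i
  | .coh _ A σ => .coh (TyEq.refl A) (fun i => TmEq.refl (σ i))
end

theorem TmEq.of_eq {n : ℕ} {Γ : Ctx n} {s t : Tm n} (h : s = t) : TmEq R Γ s t :=
  h ▸ TmEq.refl s

theorem TyEq.symm {n : ℕ} {Γ : Ctx n} : {A B : Ty n} → TyEq R Γ A B → TyEq R Γ B A
  | _, _, .star => .star
  | _, _, .arr hs ht hA => .arr hs.symm ht.symm hA.symm

theorem TyEq.trans {n : ℕ} {Γ : Ctx n} : {A B C : Ty n} → TyEq R Γ A B → TyEq R Γ B C →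
    TyEq R Γ A C
  | _, _, _, .star, .star => .star
  | _, _, _, .arr hs ht hA, .arr hs' ht' hA' => .arr (hs.trans hs') (ht.trans ht') (hA.trans hA')

mutual
theorem TyEq.sub_congr {m n : ℕ} {Γ : Ctx n} {σ τ : Sub m n}
    (h : ∀ i, TmEq R Γ (σ i) (τ i)) : (A : Ty m) → TyEq R Γ (A.sub σ) (A.sub τ)
  | .star => by rw [Ty.sub, Ty.sub]; exact .star
  | .arr s A t => by
      rw [Ty.sub, Ty.sub]
      exact .arr (TmEq.sub_congr h s) (TmEq.sub_congr h t) (TyEq.sub_congr h A)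
theorem TmEq.sub_congr {m n : ℕ} {Γ : Ctx n} {σ τ : Sub m n}
    (h : ∀ i, TmEq R Γ (σ i) (τ i)) : (t : Tm m) → TmEq R Γ (t.sub σ) (t.sub τ)
  | .var i => by rw [Tm.sub, Tm.sub]; exact h i
  | .coh _ A σ => by
      rw [Tm.sub, Tm.sub]
      exact .coh (TyEq.refl A) (fun i => TmEq.sub_congr h (σ i))
end

/-- Two substitutions that agree on a globular type agree on its free variables. -/
theorem Glob.tmEq_of_tyEq {m n : ℕ} {Γ : Ctx m} {Δ : Ctx n} {σ τ : Sub m n} {A : Ty m}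
    (hA : Glob Γ A) : TyEq R Δ (A.sub σ) (A.sub τ) → ∀ x ∈ A.fv, TmEq R Δ (σ x) (τ x) := by
  induction hA with
  | star => intro _ x hx; simp [Ty.fv] at hx
  | arr a b _ _ _ ih =>
      intro h x hx
      simp only [Ty.sub, Tm.sub] at h
      cases h with
      | arr ha hb hA =>
        simp only [Ty.fv, Tm.fv, Set.mem_union, Set.mem_singleton_iff] at hx
        rcases hx with (rfl | hx) | rfl
        exacts [ha, ih hA x hx, hb]

end Equality

/-! ### Typing of substitutions -/

/-- A substitution is well typed if the image of every variable has the expected type. -/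
def SubTy (R : Rules) {m n : ℕ} (Γ : Ctx n) (Δ : Ctx m) (σ : Sub m n) : Prop :=
  ∀ i, HasType R Γ (σ i) ((Δ.ty i).sub σ)

theorem Sub.snoc_sub {l m n : ℕ} (σ : Sub l m) (t : Tm m) (ρ : Sub m n) :
    (fun i => (Sub.snoc σ t i).sub ρ) = Sub.snoc (fun i => (σ i).sub ρ) (t.sub ρ) := by
  funext i
  refine Fin.lastCases ?_ (fun i => ?_) i
  · rw [Sub.snoc_last, Sub.snoc_last]
  · rw [Sub.snoc_castSucc, Sub.snoc_castSucc]

section Typing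

variable {R : Rules}

theorem SubOk.subTy {m n : ℕ} {Γ : Ctx n} {Δ : Ctx m} {σ : Sub m n} :
    SubOk R Γ Δ σ → SubTy R Γ Δ σ
  | .nil => fun i => i.elim0
  | .snoc (A := A) (σ := σ) (t := t) hσ _ ht => by
      have key : ∀ B, (Ty.rename Fin.castSucc B).sub (Sub.snoc σ t) = B.sub σ := by
        intro B
        rw [Ty.rename_sub]
        simp only [Sub.snoc_castSucc]
      intro i
      refine Fin.lastCases ?_ (fun i => ?_) i
      · rw [Sub.snoc_last, Ctx.ty_snoc_last, key]
        exact ht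
      · rw [Sub.snoc_castSucc, Ctx.ty_snoc_castSucc, key]
        exact hσ.subTy i

theorem SubTy.subOk {m n : ℕ} {Γ : Ctx n} {Δ : Ctx m} :
    CtxOk R Δ → {σ : Sub m n} → SubTy R Γ Δ σ → SubOk R Γ Δ σ
  | .nil, _, _ => .nil
  | .snoc (A := A) hΔ hA, σ, h => by
      rw [← Sub.eq_snoc σ]
      refine .snoc (SubTy.subOk hΔ (fun i => ?_)) hA ?_
      · have := h i.castSucc
        rwa [Ctx.ty_snoc_castSucc, Ty.rename_sub] at this
      · have := h (Fin.last _)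
        rwa [Ctx.ty_snoc_last, Ty.rename_sub] at this

/-- Replacing the terms of a well-typed substitution by equal terms of the same types yields a
well-typed substitution. -/
theorem SubTy.congr {m n : ℕ} {Γ : Ctx n} {Δ : Ctx m} {σ σ' : Sub m n}
    (h : ∀ i, TmEq R Γ (σ i) (σ' i)) (h' : ∀ i, HasType R Γ (σ' i) ((Δ.ty i).sub σ)) :
    SubTy R Γ Δ σ' :=
  fun i => .conv (h' i) (TyEq.sub_congr h _)

theorem SubTy.of_tyCompat {m n : ℕ} {Γ : Ctx n} {Δ : Ctx m} (hΓ : CtxOk R Γ)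
    {f : Fin m → Fin n} (hf : TyCompat Δ Γ f) : SubTy R Γ Δ (fun i => .var (f i)) := by
  intro i
  have := HasType.var (f i) hΓ
  rwa [hf] at this

/-- The condition on supports in the typing rules for coherences. -/
def SuppOk (T : Tree) (s t : Tm T.size) : Prop :=
  (∃ d, T.dim = d + 1 ∧
    s.supp T.ctx = Sub.supp T.ctx (fun i => .var (T.bdryInc false d i)) ∧
    t.supp T.ctx = Sub.supp T.ctx (fun i => .var (T.bdryInc true d i))) ∨
  (s.supp T.ctx = Set.univ ∧ t.supp T.ctx = Set.univ)

theorem HasType.coh {n : ℕ} {Γ : Ctx n} {T : Tree} {s t : Tm T.size} {A : Ty T.size}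
    {σ : Sub T.size n} (hA : TyOk R T.ctx (.arr s A t)) (hσ : SubOk R Γ T.ctx σ)
    (h : SuppOk T s t) : HasType R Γ (.coh T.ctx (.arr s A t) σ) ((Ty.arr s A t).sub σ) := by
  rw [Ty.sub]
  rcases h with ⟨d, hd, h1, h2⟩ | ⟨h1, h2⟩
  · exact .comp hd hA hσ h1 h2
  · exact .full hA hσ h1 h2

theorem HasType.coh_inv_aux {n : ℕ} {Γ : Ctx n} {u : Tm n} {B : Ty n} :
    HasType R Γ u B → ∀ (T : Tree) (A : Ty T.size) (σ : Sub T.size n), u = .coh T.ctx A σ →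
      ∃ s A' t, A = .arr s A' t ∧ TyOk R T.ctx A ∧ SubOk R Γ T.ctx σ ∧ SuppOk T s t ∧
        TyEq R Γ (A.sub σ) B
  | .var _ _, _, _, _, e => by cases e
  | .comp (T := U) hd hA hσ h1 h2, T, A, σ, e => by
      obtain ⟨e1, e2, e3, e4⟩ := Tm.coh.inj e
      obtain rfl := ctx_injective e1 e2
      obtain rfl := eq_of_heq e3
      obtain rfl := eq_of_heq e4
      refine ⟨_, _, _, rfl, hA, hσ, Or.inl ⟨_, hd, h1, h2⟩, ?_⟩
      rw [Ty.sub]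
      exact .refl _
  | .full (T := U) hA hσ h1 h2, T, A, σ, e => by
      obtain ⟨e1, e2, e3, e4⟩ := Tm.coh.inj e
      obtain rfl := ctx_injective e1 e2
      obtain rfl := eq_of_heq e3
      obtain rfl := eq_of_heq e4
      refine ⟨_, _, _, rfl, hA, hσ, Or.inr ⟨h1, h2⟩, ?_⟩
      rw [Ty.sub]
      exact .refl _
  | .conv h hAB, T, A, σ, e => by
      obtain ⟨s, A', t, h1, h2, h3, h4, h5⟩ := HasType.coh_inv_aux h T A σ e
      exact ⟨s, A', t, h1, h2, h3, h4, h5.trans hAB⟩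

/-- Inversion of the typing rules for coherences. -/
theorem HasType.coh_inv {n : ℕ} {Γ : Ctx n} {T : Tree} {A : Ty T.size} {σ : Sub T.size n}
    {B : Ty n} (h : HasType R Γ (.coh T.ctx A σ) B) :
    ∃ s A' t, A = .arr s A' t ∧ TyOk R T.ctx A ∧ SubOk R Γ T.ctx σ ∧ SuppOk T s t ∧
      TyEq R Γ (A.sub σ) B :=
  h.coh_inv_aux T A σ rfl

/-- A set of equality generators is stable under substitution. -/
def Rules.Stable (R : Rules) : Prop :=
  ∀ {m n : ℕ} {Γ : Ctx m} {Δ : Ctx n} {s t : Tm m} (ρ : Sub m n), R Γ s t →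
    R Δ (s.sub ρ) (t.sub ρ)

mutual
theorem TyOk.sub (hR : Rules.Stable R) {m n : ℕ} {Γ : Ctx m} {Δ : Ctx n} {ρ : Sub m n}
    (hρ : SubTy R Δ Γ ρ) {A : Ty m} : TyOk R Γ A → TyOk R Δ (A.sub ρ)
  | .star => by rw [Ty.sub]; exact .star
  | .arr hA hs ht => by
      rw [Ty.sub]
      exact .arr (TyOk.sub hR hρ hA) (HasType.sub hR hρ hs) (HasType.sub hR hρ ht)
theorem HasType.sub (hR : Rules.Stable R) {m n : ℕ} {Γ : Ctx m} {Δ : Ctx n} {ρ : Sub m n}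
    (hρ : SubTy R Δ Γ ρ) {t : Tm m} {A : Ty m} :
    HasType R Γ t A → HasType R Δ (t.sub ρ) (A.sub ρ)
  | .var i _ => by rw [Tm.sub]; exact hρ i
  | .comp hd hA hσ h1 h2 => by
      have := HasType.comp hd hA (SubOk.sub hR hρ hσ) h1 h2
      simpa only [Tm.sub, Ty.sub, Tm.sub_sub, Ty.sub_sub] using this
  | .full hA hσ h1 h2 => by
      have := HasType.full hA (SubOk.sub hR hρ hσ) h1 h2
      simpa only [Tm.sub, Ty.sub, Tm.sub_sub, Ty.sub_sub] using this
  | .conv h hAB => .conv (HasType.sub hR hρ h) (TyEq.sub hR hρ hAB)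
theorem SubOk.sub (hR : Rules.Stable R) {l m n : ℕ} {Γ : Ctx m} {Δ : Ctx n} {ρ : Sub m n}
    (hρ : SubTy R Δ Γ ρ) {Θ : Ctx l} {σ : Sub l m} :
    SubOk R Γ Θ σ → SubOk R Δ Θ (fun i => (σ i).sub ρ)
  | .nil => .nil
  | .snoc hσ hA ht => by
      rw [Sub.snoc_sub]
      refine .snoc (SubOk.sub hR hρ hσ) hA ?_
      have := HasType.sub hR hρ ht
      rwa [Ty.sub_sub] at this
theorem TyEq.sub (hR : Rules.Stable R) {m n : ℕ} {Γ : Ctx m} {Δ : Ctx n} {ρ : Sub m n}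
    (hρ : SubTy R Δ Γ ρ) {A B : Ty m} : TyEq R Γ A B → TyEq R Δ (A.sub ρ) (B.sub ρ)
  | .star => by rw [Ty.sub]; exact .star
  | .arr hs ht hA => by
      rw [Ty.sub, Ty.sub]
      exact .arr (TmEq.sub hR hρ hs) (TmEq.sub hR hρ ht) (TyEq.sub hR hρ hA)
theorem TmEq.sub (hR : Rules.Stable R) {m n : ℕ} {Γ : Ctx m} {Δ : Ctx n} {ρ : Sub m n}
    (hρ : SubTy R Δ Γ ρ) {s t : Tm m} : TmEq R Γ s t → TmEq R Δ (s.sub ρ) (t.sub ρ)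
  | .var i => .refl _
  | .symm h => .symm (TmEq.sub hR hρ h)
  | .trans h h' => .trans (TmEq.sub hR hρ h) (TmEq.sub hR hρ h')
  | .coh hA h => by
      rw [Tm.sub, Tm.sub]
      exact .coh hA (fun i => TmEq.sub hR hρ (h i))
  | .rule h hs => .rule (hR ρ h) (HasType.sub hR hρ hs)
end

/-- The substitution from a disc classifying a well-typed term is well typed. -/
theorem SubTy.discSub {k : ℕ} {Γ : Ctx k} : {n : ℕ} → {A : Ty k} → {t : Tm k} → A.dim = n →
    TyOk R Γ A → HasType R Γ t A → SubTy R Γ (disc n).ctx (discSub n A t)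
  | 0, .star, t, _, _, ht => by
      intro i
      rw [nil_var i]
      have h : (disc 0).ctx.ty (Tree.first nil) = .star := ty_first nil
      rw [h, Ty.sub]
      exact ht
  | 0, .arr _ _ _, _, h, _, _ => by simp [Ty.dim] at h
  | _ + 1, .star, _, h, _, _ => by simp [Ty.dim] at h
  | n + 1, .arr s A u, t, h, hA, ht => by
      have h' : A.dim = n := Nat.succ.inj h
      cases hA with
      | arr hA hs hu =>
        intro x
        rcases disc_var_cases x with rfl | rfl | ⟨y, rfl⟩
        · rw [ty_disc_top_sub_discSub t h, discSub_top t h]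
          exact ht
        · rw [ty_discTgt, Ty.rename_sub, discSub_succ_tgt]
          simp only [discSub_succ_src]
          exact (ty_disc_top_sub_discSub s h').symm ▸ hu
        · rw [ty_discSrc, Ty.rename_sub, discSub_succ_src]
          simp only [discSub_succ_src]
          exact SubTy.discSub h' hA hs y

end Typing

/-! ### Stability of the generators -/

theorem Sua.discRemoval_of_dim_eq {n k : ℕ} {Γ : Ctx n} (A : Ty n) (s : Tm n) (h : A.dim = k) :
    Sua Γ ((unbiasedCoh k (disc k)).sub (discSub k A s)) s := by
  subst h
  exact .discRemoval A s

theorem Sua.endo_of_dim_eq {m n k : ℕ} {Γ : Ctx n} (Δ : Ctx m) (s : Tm m) (A : Ty m)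
    (σ : Sub m n) (h : A.dim = k) (hi : ¬ IsIdentity (.coh Δ (.arr s A s) σ)) :
    Sua Γ (.coh Δ (.arr s A s) σ)
      ((unbiasedCoh (k + 1) (disc k)).sub (discSub k (A.sub σ) (s.sub σ))) := by
  subst h
  exact .endo Δ s A σ hi

theorem IsInsertionRedex.sub {k l : ℕ} {S : Tree} {P : Branch S} {T : Tree} {σ : Sub S.size k}
    {τ : Sub T.size k} (h : IsInsertionRedex S P T σ τ) (ρ : Sub k l) :
    IsInsertionRedex S P T (fun i => (σ i).sub ρ) (fun i => (τ i).sub ρ) where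
  height := h.height
  arg := by rw [h.arg, Tm.sub_sub]

theorem Sua.stable : Rules.Stable Sua := by
  intro m n Γ Δ s t ρ h
  cases h with
  | discRemoval A s =>
      rw [Tm.sub_sub, discSub_sub ρ _ rfl]
      exact Sua.discRemoval_of_dim_eq _ _ (A.dim_sub ρ)
  | endo Θ s A σ hi =>
      rw [Tm.sub_sub, discSub_sub ρ _ (A.dim_sub σ), Ty.sub_sub, Tm.sub_sub, Tm.sub]
      exact Sua.endo_of_dim_eq _ _ _ _ rfl (fun h => hi (h.congr _))
  | insertion S P T σ τ hr A hP hi =>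
      rw [Tm.sub, Tm.sub, insSub_sub]
      exact Sua.insertion S P T _ _ (hr.sub ρ) A hP (fun h => hi (h.congr _))

/-! ### Typing of unbiased coherences and of identities -/

theorem Sub.supp_var {m n : ℕ} (Γ : Ctx n) (f : Fin m → Fin n) :
    Sub.supp Γ (fun i => .var (f i)) = Γ.downClosure (Set.range f) := by
  rw [Sub.supp]
  congr 1
  ext x
  simp only [Tm.fv, Set.mem_singleton_iff, Set.mem_ofPred_eq, Set.mem_range, eq_comm]

theorem fv_unbiasedCoh (n : ℕ) (T : Tree) : (unbiasedCoh n T).fv = Set.univ := by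
  refine Set.eq_univ_of_forall fun x => ?_
  rw [unbiasedCoh, Tm.fv]
  exact ⟨x, by rw [Sub.id, Tm.fv]; rfl⟩

theorem mem_fv_unbiasedCoh_rename {n m : ℕ} (T : Tree) (f : Fin T.size → Fin m) (x : Fin m) :
    x ∈ ((unbiasedCoh n T).rename f).fv ↔ ∃ i, f i = x := by
  simp only [Tm.mem_fv_rename, fv_unbiasedCoh, Set.mem_univ, true_and]

/-- If the unbiased coherence of dimension `n + 1` over `T` is well typed, then `T` has dimension at
most `n + 1`: otherwise the support of its source, which has dimension `n`, is too small. -/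
theorem dim_le_of_suppOk {n : ℕ} {T : Tree} {s t : Tm T.size} {A : Ty T.size}
    (hU : unbiasedTy (n + 1) T = .arr s A t) (h : SuppOk T s t) : T.dim ≤ n + 1 := by
  by_contra hlt
  have hs : s.supp T.ctx ⊆ {x | (T.ctx.ty x).dim ≤ n} := by
    refine Ctx.downClosure_subset (T.downClosed_dim_le n) ?_
    rw [unbiasedTy] at hU
    cases hU
    refine (fv_unbiasedTmOf_rename_subset _ _ _).trans ?_
    rintro _ ⟨i, rfl⟩
    exact dim_ty_bdryInc_le false n T i
  rcases h with ⟨d, hd, h1, -⟩ | ⟨h1, -⟩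
  · obtain ⟨i, hi⟩ := exists_dim_ty_bdryInc_eq false d T (by omega)
    rw [h1, Sub.supp_var] at hs
    have h2 : (T.ctx.ty (bdryInc false d T i)).dim ≤ n :=
      hs (Ctx.subset_downClosure _ _ ⟨i, rfl⟩)
    omega
  · obtain ⟨i, hi⟩ := exists_dim_ty_bdryInc_eq false T.dim T le_rfl
    have h2 : (T.ctx.ty (bdryInc false T.dim T i)).dim ≤ n := hs (h1 ▸ Set.mem_univ _)
    omega

theorem SubTy.id {R : Rules} {n : ℕ} {Γ : Ctx n} (hΓ : CtxOk R Γ) : SubTy R Γ Γ Tm.var :=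
  SubTy.of_tyCompat hΓ (tyCompat_id Γ)

theorem SuppOk.of_fv_eq_univ {T : Tree} {s t : Tm T.size} (hs : s.fv = Set.univ)
    (ht : t.fv = Set.univ) : SuppOk T s t :=
  Or.inr ⟨Set.eq_univ_of_univ_subset (hs ▸ Ctx.subset_downClosure _ _),
    Set.eq_univ_of_univ_subset (ht ▸ Ctx.subset_downClosure _ _)⟩

theorem supp_top_disc (n : ℕ) :
    (Tm.var (disc n).top).supp (disc n).ctx = Set.univ := by
  refine Set.eq_univ_of_forall fun x => ?_
  have htop : (disc n).top ∈ (Tm.var (disc n).top).supp (disc n).ctx :=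
    Ctx.subset_downClosure _ _ (by rw [Tm.fv]; rfl)
  rcases mem_fv_ty_disc_top n x with rfl | hx
  · exact htop
  · exact Ctx.downClosed_downClosure _ _ _ htop hx

/-- The identity of a well-typed term is well typed. -/
theorem HasType.identity {R : Rules} {k n : ℕ} {Γ : Ctx k} {B : Ty k} {s : Tm k}
    (hd : B.dim = n) (hB : TyOk R Γ B) (hs : HasType R Γ s B) :
    HasType R Γ ((unbiasedCoh (n + 1) (disc n)).sub (discSub n B s)) (.arr s B s) := by
  have htop := HasType.var (disc n).top (ctxOk R (disc n))
  have h := HasType.coh (T := disc n)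
    (.arr (.of_glob (ctxOk R (disc n)) ((disc n).glob _)) htop htop)
    ((SubTy.discSub hd hB hs).subOk (ctxOk R (disc n)))
    (Or.inr ⟨supp_top_disc n, supp_top_disc n⟩)
  rw [Ty.sub, Tm.sub, discSub_top s hd, ty_disc_top_sub_discSub s hd] at h
  rw [unbiasedCoh_sub, unbiasedTy_succ_disc]
  exact h

/-- Two substitutions from a disc are definitionally equal if they are so on the top variable and on
its type. -/
theorem tmEq_of_disc {R : Rules} {k n : ℕ} {Γ : Ctx k} {σ θ : Sub (disc n).size k}
    (h : TmEq R Γ (σ (disc n).top) (θ (disc n).top))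
    (h' : TyEq R Γ (((disc n).ctx.ty (disc n).top).sub σ)
      (((disc n).ctx.ty (disc n).top).sub θ)) (i : Fin (disc n).size) :
    TmEq R Γ (σ i) (θ i) := by
  rcases mem_fv_ty_disc_top n i with rfl | hi
  · exact h
  · exact ((disc n).glob _).tmEq_of_tyEq h' i hi

theorem not_isIdentity_of_coh {k m : ℕ} {T : Tree} {Δ : Ctx m} {A : Ty m} {ρ : Sub m T.size}
    {B : Ty T.size} {t : Tm T.size} {σ : Sub T.size k} :
    ¬ IsIdentity (.coh T.ctx (.arr (.coh Δ A ρ) B t) σ) := by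
  intro h
  obtain ⟨n, h⟩ := isIdentity_coh _ _ _ h
  obtain ⟨rfl, h⟩ := Sigma.mk.inj_iff.1 h
  have h := eq_of_heq h
  rw [unbiasedTy_succ_disc] at h
  cases h

/-! ### Insertion into identities -/

/-- Inserting a tree into a disc yields the tree. -/
theorem insTree_disc : {S : Tree} → (P : Branch S) → (T : Tree) → (h : P.bh ≤ T.th) →
    (m : ℕ) → S = disc m → P.lh = m ∧ P.var = S.top ∧
      (⟨insTree P T h, intVar P T h⟩ : Σ X : Tree, Fin T.size → Fin X.size) = ⟨T, id⟩
  | _, .here k rfl, T, h, m + 1, e => by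
      obtain ⟨e1, rfl⟩ := Tree.cons.inj e
      refine ⟨?_, (top_disc_succ k).symm, append_nil T⟩
      have h1 := congrArg dim e1
      rw [dim_disc, dim_disc] at h1
      exact congrArg (· + 1) h1
  | _, .skip P, _, _, m + 1, e => by
      obtain ⟨-, rfl⟩ := Tree.cons.inj e
      cases P
  | _, .down (S := S) (Ss := Ss) P, .cons T .nil, h, m + 1, e => by
      obtain ⟨e1, rfl⟩ := Tree.cons.inj e
      have h' := Nat.le_of_succ_le_succ h
      obtain ⟨h1, h2, h3⟩ := insTree_disc P T h' m e1
      subst e1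
      refine ⟨congrArg (· + 1) h1, (congrArg inner h2).trans (top_disc_succ m).symm, ?_⟩
      let G : (Σ X : Tree, Fin T.size → Fin X.size) →
          Σ X : Tree, Fin (cons T nil).size → Fin X.size := fun X =>
        ⟨cons X.1 nil, varCases (Ts := nil) (first _) (fun i => inner (X.2 i))
          (fun _ => right nil.first)⟩
      refine Eq.trans (congrArg G h3) ?_
      have : varCases (first (cons T nil)) (fun i => inner i) (fun _ => right nil.first) = id :=
        varCases_ext (varCases_first _ _ _) (fun i => varCases_inner _ _ _ i)
          (fun i => (varCases_right _ _ _ i).trans (congrArg right (nil_var i).symm))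
      exact congrArg (Sigma.mk (cons T nil)) this
  | _, .here _ _, _, _, 0, e => by cases e
  | _, .skip _, _, _, 0, e => by cases e
  | _, .down _, _, _, 0, e => by cases e
  | _, .down _, .nil, h, _, _ => absurd h (Nat.not_succ_le_zero _)
  | _, .down _, .cons _ (.cons _ _), h, _, _ => absurd h (Nat.not_succ_le_zero _)

/-- Insertion into an identity. The reduct is a coherence over a tree `X` isomorphic to `T`, with
type `𝒞 → 𝒞` for the unbiased coherence `𝒞` of `X`. It is not itself an identity, since `𝒞` is not a
variable, so its endo-coherence can be removed. This gives the identity on the argument of the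
redex. -/
theorem insertion_of_isIdentity {n : ℕ} (Γ : Ctx n) (S : Tree) (P : Branch S) (T : Tree)
    (σ : Sub S.size n) (τ : Sub T.size n) (h : IsInsertionRedex S P T σ τ)
    (A : Ty S.size) (B : Ty n) (hA : HasType Sua Γ (.coh S.ctx A σ) B)
    (hid : IsIdentity (.coh S.ctx A σ)) :
    TmEq Sua Γ (.coh S.ctx A σ)
      (.coh (insTree P T h.height).ctx (A.sub (exterior P T h.height))
        (insSub P T h.height σ τ)) := by
  obtain ⟨m, hid⟩ := isIdentity_coh _ _ _ hid
  obtain ⟨rfl, hid⟩ := Sigma.mk.inj_iff.1 hid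
  obtain rfl := eq_of_heq hid
  obtain ⟨hl, hv, hX⟩ := insTree_disc P T h.height m rfl
  -- Only these properties of the inserted tree and of its maps are used below. The equality of the
  -- tree with `T` enters through the surjectivity of `intVar`, which avoids transporting along it.
  have hL1 := exterior_var P T h.height
  have hL2 := ty_var_sub_exterior P T h.height
  have hL3 := insSub_intVar P T h.height σ τ
  have harg := h.arg
  have hc := tyCompat_intVar P T h.height
  have hsurj : Function.Surjective (intVar P T h.height) := by
    have key : ∀ Y : (Σ X : Tree, Fin T.size → Fin X.size), Y = ⟨T, id⟩ →
        Function.Surjective Y.2 := by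
      rintro _ rfl
      exact Function.surjective_id
    exact key _ hX
  rw [hv, hl] at hL1 hL2 harg
  generalize insSub P T h.height σ τ = s at *
  generalize exterior P T h.height = κ at *
  generalize intVar P T h.height = ι at *
  generalize insTree P T h.height = X at *
  obtain ⟨_, _, _, -, -, hσ, -, -⟩ := hA.coh_inv
  have hσ := hσ.subTy
  have htop := hσ (disc m).top
  rw [harg, unbiasedCoh_sub] at htop
  obtain ⟨a, U, b, hU, hTU, hτ, hsupp, hty⟩ := htop.coh_inv
  have hC : HasType Sua T.ctx (unbiasedCoh m T) (unbiasedTy m T) := by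
    rw [unbiasedCoh, hU]
    have := HasType.coh (hU ▸ hTU) ((SubTy.id (ctxOk Sua T)).subOk (ctxOk Sua T)) hsupp
    rwa [Ty.sub_var] at this
  have hι : SubTy Sua X.ctx T.ctx (fun i => .var (ι i)) := .of_tyCompat (ctxOk Sua X) hc
  have hs : SubTy Sua Γ X.ctx s := by
    intro j
    obtain ⟨i, rfl⟩ := hsurj j
    rw [hc, Ty.rename_sub, hL3, funext hL3]
    exact hτ.subTy i
  have hfv : ((unbiasedCoh m T).rename ι).fv = Set.univ :=
    Set.eq_univ_of_forall fun x => (mem_fv_unbiasedCoh_rename T ι x).2 (hsurj x)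
  have hCX := hC.sub Sua.stable hι
  have hX := HasType.coh (.arr (hTU.sub Sua.stable hι) hCX hCX) (hs.subOk (ctxOk Sua X))
    (SuppOk.of_fv_eq_univ hfv hfv)
  have hnot : ¬ IsIdentity (.coh X.ctx (.arr ((unbiasedCoh m T).rename ι)
      ((unbiasedTy m T).rename ι) ((unbiasedCoh m T).rename ι)) s) := by
    rw [unbiasedCoh, Tm.rename, Tm.sub]
    exact not_isIdentity_of_coh
  have hend := TmEq.rule (Sua.endo_of_dim_eq (Γ := Γ) (k := m) X.ctx _ _ s
    (by rw [Ty.dim_rename, dim_unbiasedTy]) hnot) hX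
  rw [Ty.rename_sub, Tm.rename_sub, funext hL3, unbiasedCoh_sub] at hend
  have hdim : ((unbiasedTy m T).sub τ).dim = m := by rw [Ty.dim_sub, dim_unbiasedTy]
  have hκ : (unbiasedTy (m + 1) (disc m)).sub κ = .arr ((unbiasedCoh m T).rename ι)
      ((unbiasedTy m T).rename ι) ((unbiasedCoh m T).rename ι) := by
    rw [unbiasedTy_succ_disc, Ty.sub, Tm.sub, hL1, hL2]
  rw [hκ]
  refine TmEq.trans (.coh (.refl _) (fun i => ?_)) hend.symm
  refine tmEq_of_disc ?_ ?_ i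
  · rw [discSub_top _ hdim, harg]
    exact .refl _
  · rw [ty_disc_top_sub_discSub _ hdim]
    exact hty.symm

/-! ### Typing of the reduct of the insertion of a disc -/

theorem Glob.exists_of_sub {m n : ℕ} {Γ : Ctx m} {Δ : Ctx n} {κ : Sub m n} {A : Ty m}
    (hA : Glob Γ A) : Glob Δ (A.sub κ) →
      ∀ x ∈ A.fv, ∃ j, κ x = .var j ∧ Δ.ty j = (Γ.ty x).sub κ := by
  induction hA with
  | star => intro _ x hx; simp [Ty.fv] at hx
  | @arr A a b ha hb _ ih =>
      intro h x hx
      simp only [Ty.sub, Tm.sub] at h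
      generalize hs : κ a = s at h
      generalize ht : κ b = t at h
      generalize hB : A.sub κ = B at h ih
      cases h with
      | arr a' b' ha' hb' hB' =>
        simp only [Ty.fv, Tm.fv, Set.mem_union, Set.mem_singleton_iff] at hx
        rcases hx with (rfl | hx) | rfl
        · exact ⟨a', hs, by rw [ha', ha, hB]⟩
        · exact ih hB' x hx
        · exact ⟨b', ht, by rw [hb', hb, hB]⟩

theorem discSub_intVar {S : Tree} (P : Branch S) {N : ℕ} (h : P.bh ≤ (disc N).th) :
    discSub N ((insTree P (disc N) h).ctx.ty (intVar P (disc N) h (disc N).top))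
      (.var (intVar P (disc N) h (disc N).top)) = fun i => .var (intVar P (disc N) h i) := by
  rw [tyCompat_intVar]
  exact discSub_eq N (fun i => .var (intVar P (disc N) h i))

theorem ty_var_sub_exterior_disc {S : Tree} (P : Branch S) {N : ℕ} (h : P.bh ≤ (disc N).th)
    (hl : P.lh = N + 1) : (S.ctx.ty P.var).sub (exterior P (disc N) h) =
    .arr (.var (intVar P (disc N) h (disc N).top))
      ((insTree P (disc N) h).ctx.ty (intVar P (disc N) h (disc N).top))
      (.var (intVar P (disc N) h (disc N).top)) := by
  rw [ty_var_sub_exterior, hl, unbiasedTy_succ_disc, Ty.rename_arr, tyCompat_intVar,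
    Tm.rename_var]

/-- Away from the branch, the exterior substitution for the insertion of a disc sends variables to
variables, respecting their types. -/
theorem exterior_disc_of_ne {S : Tree} (P : Branch S) {N : ℕ} (h : P.bh ≤ (disc N).th)
    (hl : P.lh = N + 1) {x : Fin S.size} (hx : x ≠ P.var) :
    ∃ j, exterior P (disc N) h x = .var j ∧
      (insTree P (disc N) h).ctx.ty j = (S.ctx.ty x).sub (exterior P (disc N) h) := by
  rcases survives_cases P (disc N) h x with rfl | hx | ⟨j, hj⟩
  · exact absurd rfl hx
  · refine (S.glob P.var).exists_of_sub ?_ x hx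
    rw [ty_var_sub_exterior_disc P h hl]
    exact .arr _ _ rfl rfl (Tree.glob _ _)
  · exact ⟨j, hj.exterior_eq, hj.ty_eq⟩

theorem subTy_exterior_disc (R : Rules) {S : Tree} (P : Branch S) {N : ℕ}
    (h : P.bh ≤ (disc N).th) (hl : P.lh = N + 1) :
    SubTy R (insTree P (disc N) h).ctx S.ctx (exterior P (disc N) h) := by
  intro x
  have hX := ctxOk R (insTree P (disc N) h)
  by_cases hx : x = P.var
  · subst hx
    rw [ty_var_sub_exterior_disc P h hl, exterior_var, hl, Tm.rename, ← discSub_intVar]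
    refine HasType.identity ?_ (.of_glob hX (Tree.glob _ _)) (.var _ hX)
    rw [tyCompat_intVar, Ty.dim_rename, dim_ty_disc_top]
  · obtain ⟨j, h1, h2⟩ := exterior_disc_of_ne P h hl hx
    rw [h1, ← h2]
    exact .var j hX

theorem fv_exterior_disc_subset {S : Tree} (P : Branch S) {N : ℕ} (h : P.bh ≤ (disc N).th)
    (hl : P.lh = N + 1) {x y : Fin S.size} (hy : y ∈ (S.ctx.ty x).fv) :
    (exterior P (disc N) h y).fv ⊆
      (insTree P (disc N) h).ctx.downClosure (exterior P (disc N) h x).fv := by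
  intro z hz
  by_cases hx : x = P.var
  · subst hx
    obtain ⟨i, rfl⟩ := mem_fv_sub_exterior P (disc N) h hy hz
    refine Ctx.subset_downClosure _ _ ?_
    rw [exterior_var, mem_fv_unbiasedCoh_rename]
    exact ⟨i, rfl⟩
  · obtain ⟨j, h1, h2⟩ := exterior_disc_of_ne P h hl hx
    rw [h1]
    refine Ctx.downClosed_downClosure _ _ j (Ctx.subset_downClosure _ _ (by rw [Tm.fv]; rfl)) ?_
    rw [h2]
    exact (Ty.mem_fv_sub _ _ _).2 ⟨y, hy, hz⟩

/-- The free variables of the images of a set of variables. -/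
def Sub.image {m n : ℕ} (κ : Sub m n) (X : Set (Fin m)) : Set (Fin n) :=
  {y | ∃ x ∈ X, y ∈ (κ x).fv}

theorem Sub.image_mono {m n : ℕ} (κ : Sub m n) {X Y : Set (Fin m)} (h : X ⊆ Y) :
    κ.image X ⊆ κ.image Y :=
  fun _ ⟨x, hx, hy⟩ => ⟨x, h hx, hy⟩

/-- Support is computed from any generating set of variables, for a substitution that sends the
variables of the type of `x` into the support of the image of `x`. -/
theorem Sub.downClosure_image {m n : ℕ} {Γ : Ctx m} {Δ : Ctx n} {κ : Sub m n}
    (hκ : ∀ x, ∀ y ∈ (Γ.ty x).fv, (κ y).fv ⊆ Δ.downClosure (κ x).fv) (X : Set (Fin m)) :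
    Δ.downClosure (κ.image (Γ.downClosure X)) = Δ.downClosure (κ.image X) := by
  refine Set.Subset.antisymm (Ctx.downClosure_subset (Ctx.downClosed_downClosure _ _) ?_)
    (Ctx.downClosure_mono _ (κ.image_mono (Ctx.subset_downClosure _ _)))
  have key : Γ.downClosure X ⊆ {x | (κ x).fv ⊆ Δ.downClosure (κ.image X)} := by
    refine Ctx.downClosure_subset ?_ ?_
    · intro x hx y hy
      exact (hκ x y hy).trans (Ctx.downClosure_subset (Ctx.downClosed_downClosure _ _) hx)
    · intro x hx y hy
      exact Ctx.subset_downClosure _ _ ⟨x, hx, hy⟩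
  rintro y ⟨x, hx, hy⟩
  exact key hx hy

/-- Inserting `Dᴺ` at a branch of leaf height `N + 1` preserves the support condition: supports that
are boundaries of `S` become the corresponding boundaries of the inserted tree, whose dimension is
at most that of `S`. -/
theorem suppOk_exterior_disc {S : Tree} (P : Branch S) {N : ℕ} (h : P.bh ≤ (disc N).th)
    (hb : P.bh < N) (hl : P.lh = N + 1) {s t : Tm S.size} (hst : SuppOk S s t) :
    SuppOk (insTree P (disc N) h) (s.sub (exterior P (disc N) h))
      (t.sub (exterior P (disc N) h)) := by
  have hdim := dim_insTree_disc_le P N h hb hl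
  have hbd : ∀ ε d, (exterior P (disc N) h).image (Set.range (bdryInc ε d S)) =
      Set.range (bdryInc ε d (insTree P (disc N) h)) := fun ε d =>
    Set.ext fun y => (bdryCompat_exterior P N h hb hl ε d y).symm
  have hfv : ∀ u : Tm S.size, (u.sub (exterior P (disc N) h)).supp (insTree P (disc N) h).ctx =
      (insTree P (disc N) h).ctx.downClosure
        ((exterior P (disc N) h).image (u.supp S.ctx)) := by
    intro u
    rw [Tm.supp, Tm.supp, Sub.downClosure_image
      (fun x y hy => fv_exterior_disc_subset P h hl hy)]
    congr 1
    exact Set.ext fun y => Tm.mem_fv_sub _ _ _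
  have hcomp : ∀ ε d (u : Tm S.size),
      u.supp S.ctx = Sub.supp S.ctx (fun i => .var (S.bdryInc ε d i)) →
      (u.sub (exterior P (disc N) h)).supp (insTree P (disc N) h).ctx =
        Sub.supp (insTree P (disc N) h).ctx
          (fun i => .var ((insTree P (disc N) h).bdryInc ε d i)) := by
    intro ε d u hu
    rw [hfv, hu, Sub.supp_var, Sub.supp_var, Sub.downClosure_image
      (fun x y hy => fv_exterior_disc_subset P h hl hy), hbd]
  have huniv : ∀ ε d, (insTree P (disc N) h).dim ≤ d →
      Sub.supp (insTree P (disc N) h).ctx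
        (fun i => .var ((insTree P (disc N) h).bdryInc ε d i)) = Set.univ := by
    intro ε d hd
    rw [Sub.supp_var, range_bdryInc_of_dim_le ε hd]
    exact Set.eq_univ_of_univ_subset (Ctx.subset_downClosure _ _)
  rcases hst with ⟨d, hd, h1, h2⟩ | ⟨h1, h2⟩
  · by_cases hd' : (insTree P (disc N) h).dim = d + 1
    · exact Or.inl ⟨d, hd', hcomp _ _ _ h1, hcomp _ _ _ h2⟩
    · -- The insertion has lowered the dimension, so that the boundaries become full.
      exact Or.inr ⟨(hcomp _ _ _ h1).trans (huniv _ _ (by omega)),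
        (hcomp _ _ _ h2).trans (huniv _ _ (by omega))⟩
  · have hu : ∀ u : Tm S.size, u.supp S.ctx = Set.univ →
        (u.sub (exterior P (disc N) h)).supp (insTree P (disc N) h).ctx = Set.univ := by
      intro u hu
      have hS : u.supp S.ctx = Sub.supp S.ctx (fun i => .var (S.bdryInc false S.dim i)) := by
        rw [hu, Sub.supp_var, range_bdryInc_of_dim_le false le_rfl]
        exact (Set.eq_univ_of_univ_subset (Ctx.subset_downClosure _ _)).symm
      exact (hcomp _ _ _ hS).trans (huniv _ _ hdim)
    exact Or.inr ⟨hu _ h1, hu _ h2⟩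

/-- The exterior substitution followed by the inserted substitution is the original substitution, up
to equality of terms. -/
theorem tmEq_exterior_insSub {R : Rules} {k : ℕ} {Γ : Ctx k} {S : Tree} (P : Branch S) (T : Tree)
    (h : P.bh ≤ T.th) {σ : Sub S.size k} {τ : Sub T.size k}
    (harg : σ P.var = (unbiasedCoh P.lh T).sub τ)
    (hty : TyEq R Γ ((unbiasedTy P.lh T).sub τ) ((S.ctx.ty P.var).sub σ)) (x : Fin S.size) :
    TmEq R Γ ((exterior P T h x).sub (insSub P T h σ τ)) (σ x) := by
  have hint := insSub_intVar P T h σ τ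
  rcases survives_cases P T h x with rfl | hx | ⟨j, hj⟩
  · rw [exterior_var, Tm.rename_sub, funext hint, harg]
    exact .refl _
  · refine (S.glob P.var).tmEq_of_tyEq (σ := fun x => (exterior P T h x).sub (insSub P T h σ τ))
      ?_ x hx
    rw [← Ty.sub_sub, ty_var_sub_exterior, Ty.rename_sub, funext hint]
    exact hty
  · rw [hj.exterior_eq, Tm.sub, hj.insSub_eq]
    exact .refl _

/-- The inserted substitution is well typed. A surviving variable has its type substituted along the
exterior substitution, so its value is converted along `tmEq_exterior_insSub`. -/
theorem subTy_insSub {R : Rules} {k : ℕ} {Γ : Ctx k} {S : Tree} (P : Branch S) (T : Tree)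
    (h : P.bh ≤ T.th) {σ : Sub S.size k} {τ : Sub T.size k}
    (harg : σ P.var = (unbiasedCoh P.lh T).sub τ)
    (hty : TyEq R Γ ((unbiasedTy P.lh T).sub τ) ((S.ctx.ty P.var).sub σ))
    (hσ : SubTy R Γ S.ctx σ) (hτ : SubTy R Γ T.ctx τ) :
    SubTy R Γ (insTree P T h).ctx (insSub P T h σ τ) := by
  have hint := insSub_intVar P T h σ τ
  intro j
  rcases insTree_var_cases P T h j with ⟨i, rfl⟩ | ⟨x, hx⟩
  · rw [hint, tyCompat_intVar, Ty.rename_sub, funext hint]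
    exact hτ i
  · rw [hx.insSub_eq, hx.ty_eq, Ty.sub_sub]
    exact .conv (hσ x) (TyEq.sub_congr (tmEq_exterior_insSub P T h harg hty) _).symm

/-! ### Comparison of the two insertions -/

theorem SubTy.intVar (R : Rules) {S : Tree} (P : Branch S) (T : Tree) (h : P.bh ≤ T.th) :
    SubTy R (insTree P T h).ctx T.ctx (fun i => .var (intVar P T h i)) :=
  .of_tyCompat (ctxOk R _) (tyCompat_intVar P T h)

/-- An unbiased coherence above the dimension of a tree is equal to the identity on the unbiased
coherence of one dimension less. -/
theorem tmEq_unbiasedCoh_succ {k N : ℕ} {Γ : Ctx k} {T : Tree} (hd : T.dim ≤ N)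
    (hT : T ≠ disc N) {τ : Sub T.size k} {B : Ty k}
    (h : HasType Sua Γ ((unbiasedCoh (N + 1) T).sub τ) B) :
    TmEq Sua Γ ((unbiasedCoh (N + 1) T).sub τ) ((unbiasedCoh (N + 1) (disc N)).sub
      (discSub N ((unbiasedTy N T).sub τ) ((unbiasedCoh N T).sub τ))) := by
  rw [unbiasedCoh_sub, unbiasedTy_succ_of_ne hd hT] at h ⊢
  exact .rule (Sua.endo_of_dim_eq _ _ _ _ (dim_unbiasedTy N T) not_isIdentity_of_coh) h

/-- Up to equality, inserting the disc and then the tree `T` has the same exterior substitution as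
inserting `T`. -/
theorem tmEq_exterior_prune {S : Tree} (P : Branch S) (N : ℕ) (h : P.bh ≤ (disc N).th)
    (hb : P.bh < N) (hl : P.lh = N + 1) (T : Tree) (hT : P.bh ≤ T.th)
    (hT' : (prune P N h hb).bh ≤ T.th)
    (e : (insTree (prune P N h hb) T hT').size = (insTree P T hT).size)
    (hd : T.dim ≤ N) (hne : T ≠ disc N)
    (hC : HasType Sua T.ctx (unbiasedCoh (N + 1) T) (unbiasedTy (N + 1) T)) (x : Fin S.size) :
    TmEq Sua (insTree P T hT).ctx
      (((exterior P (disc N) h x).sub (exterior (prune P N h hb) T hT')).rename (Fin.cast e))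
      (exterior P T hT x) := by
  have hι := funext (cast_intVar_prune P N h hb T hT hT' e)
  -- The composite of the exterior substitutions restricts on the disc to the substitution
  -- classifying the unbiased coherence of dimension `N` over `T`.
  have hθ : (fun i => ((exterior (prune P N h hb) T hT' (intVar P (disc N) h i)).rename
      (Fin.cast e))) = discSub N ((unbiasedTy N T).rename (intVar P T hT))
        ((unbiasedCoh N T).rename (intVar P T hT)) := by
    rw [← discSub_eq N (fun i => ((exterior (prune P N h hb) T hT' (intVar P (disc N) h i)).rename
      (Fin.cast e)))]
    have hv := var_prune P N h hb
    have h1 := exterior_var (prune P N h hb) T hT'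
    have h2 := ty_var_sub_exterior (prune P N h hb) T hT'
    rw [lh_prune, hv] at h1 h2
    rw [tyCompat_intVar, Ty.rename_sub] at h2
    refine congrArg₂ (discSub N) ?_ ?_
    · rw [← Ty.sub_rename, h2, Ty.rename_rename, hι]
    · rw [h1, Tm.rename_rename, hι]
  rcases survives_prune P N h hb T hT hT' e x with rfl | hx | ⟨j, j', hj, hj', hx⟩
  · rw [exterior_var, exterior_var, hl, Tm.rename_sub, Tm.sub_rename, hθ]
    have h1 := hC.sub Sua.stable (SubTy.intVar Sua P T hT)
    exact (tmEq_unbiasedCoh_succ hd hne h1).symm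
  · refine (S.glob P.var).tmEq_of_tyEq (σ := fun x => ((exterior P (disc N) h x).sub
      (exterior (prune P N h hb) T hT')).rename (Fin.cast e)) ?_ x hx
    rw [ty_var_sub_exterior, hl, ← Ty.sub_rename, ← Ty.sub_sub, ty_var_sub_exterior, hl,
      Ty.rename_sub, Ty.sub_rename, hθ, unbiasedTy_succ_disc, unbiasedTy_succ_of_ne hd hne,
      Ty.sub, Ty.rename_arr, Tm.sub]
    have hdim : ((unbiasedTy N T).rename (intVar P T hT)).dim = N := by
      rw [Ty.dim_rename, dim_unbiasedTy]
    rw [discSub_top _ hdim, ty_disc_top_sub_discSub _ hdim]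
    exact .refl _
  · rw [hj.exterior_eq, Tm.sub, hj'.exterior_eq, hx.exterior_eq, Tm.rename_var]
    exact .refl _

/-- Congruence for coherences over two trees that are only propositionally equal. -/
theorem tmEq_coh_of_cast {R : Rules} {m k : ℕ} {Γ : Ctx k} {X Y : Tree} (e : X = Y) (A : Ty m)
    {κ : Sub m X.size} {κ' : Sub m Y.size} {s : Sub X.size k} {s' : Sub Y.size k}
    (hκ : ∀ x, TmEq R Y.ctx ((κ x).rename (Fin.cast (congrArg size e))) (κ' x))
    (hs : ∀ i, s i = s' (Fin.cast (congrArg size e) i)) :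
    TmEq R Γ (.coh X.ctx (A.sub κ) s) (.coh Y.ctx (A.sub κ') s') := by
  subst e
  refine .coh (TyEq.sub_congr (fun x => ?_) A) (fun i => .of_eq (hs i))
  have h := hκ x
  have h' : (κ x).rename (Fin.cast rfl) = κ x := Tm.sub_var _
  rwa [h'] at h

theorem Branch.bh_lt_lh : {S : Tree} → (P : Branch S) → P.bh < P.lh
  | _, .here _ _ => Nat.succ_pos _
  | _, .skip P => bh_lt_lh P
  | _, .down P => Nat.succ_lt_succ (bh_lt_lh P)

/-- Insertion along an unbiased coherence of arbitrary dimension, by induction on the leaf height of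
the branch. -/
theorem insertion_of_lh_eq : (n : ℕ) → {k : ℕ} → (Γ : Ctx k) → (S : Tree) → (P : Branch S) →
    (T : Tree) → (σ : Sub S.size k) → (τ : Sub T.size k) → (h : IsInsertionRedex S P T σ τ) →
    (A : Ty S.size) → (B : Ty k) → P.lh = n → HasType Sua Γ (.coh S.ctx A σ) B →
    TmEq Sua Γ (.coh S.ctx A σ)
      (.coh (insTree P T h.height).ctx (A.sub (exterior P T h.height))
        (insSub P T h.height σ τ))
  | 0, _, _, _, P, _, _, _, _, _, _, hl, _ =>
      absurd (hl ▸ P.bh_lt_lh) (Nat.not_lt_zero _)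
  | N + 1, k, Γ, S, P, T, σ, τ, h, A, B, hl, hA => by
      by_cases hid : IsIdentity (.coh S.ctx A σ)
      · exact insertion_of_isIdentity Γ S P T σ τ h A B hA hid
      obtain ⟨s₀, A₀, t₀, rfl, hTA, hσ, hsupp, -⟩ := hA.coh_inv
      have harg := h.arg
      rw [hl] at harg
      have hPty := hσ.subTy P.var
      have hCty := hPty
      rw [harg, unbiasedCoh_sub] at hCty
      obtain ⟨s₁, A₁, t₁, hU, hTU, hτ, hTsupp, hty⟩ := hCty.coh_inv
      have hdim := dim_le_of_suppOk hU hTsupp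
      by_cases hd : T.dim = N + 1
      · exact .rule (.insertion S P T σ τ h _ (Or.inl (by rw [hl, hd])) hid) hA
      by_cases hne : T = disc N
      · refine .rule (.insertion S P T σ τ h _ (Or.inr ?_) hid) hA
        subst hne
        rw [hl]
        exact isIdentity_unbiasedCoh_disc N _
      have hd : T.dim ≤ N := by omega
      have hCT : HasType Sua T.ctx (unbiasedCoh (N + 1) T) (unbiasedTy (N + 1) T) := by
        rw [unbiasedCoh, hU]
        have := HasType.coh (hU ▸ hTU) ((SubTy.id (ctxOk Sua T)).subOk (ctxOk Sua T)) hTsupp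
        rwa [Ty.sub_var] at this
      -- The argument of the branch is replaced by an identity.
      have hρ : TyOk Sua Γ ((unbiasedTy N T).sub τ) ∧
          HasType Sua Γ ((unbiasedCoh N T).sub τ) ((unbiasedTy N T).sub τ) := by
        rw [unbiasedTy_succ_of_ne hd hne] at hTU
        cases hTU with
        | arr h1 h2 _ => exact ⟨h1.sub Sua.stable hτ.subTy, h2.sub Sua.stable hτ.subTy⟩
      have hρdim : ((unbiasedTy N T).sub τ).dim = N := by rw [Ty.dim_sub, dim_unbiasedTy]
      let ρ : Sub (disc N).size k := discSub N ((unbiasedTy N T).sub τ) ((unbiasedCoh N T).sub τ)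
      let t : Tm k := (unbiasedCoh (N + 1) (disc N)).sub ρ
      have ht : HasType Sua Γ t ((unbiasedTy (N + 1) T).sub τ) := by
        rw [unbiasedTy_succ_of_ne hd hne, Ty.sub]
        exact HasType.identity hρdim hρ.1 hρ.2
      let σ' : Sub S.size k := Function.update σ P.var t
      have hσ'P : σ' P.var = t := Function.update_self _ _ _
      have hσ'ne : ∀ x, x ≠ P.var → σ' x = σ x := fun x hx => Function.update_of_ne hx _ _
      have hσσ' : ∀ x, TmEq Sua Γ (σ x) (σ' x) := by
        intro x
        by_cases hx : x = P.var
        · subst hx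
          rw [hσ'P, harg]
          exact tmEq_unbiasedCoh_succ hd hne (harg ▸ hPty)
        · exact .of_eq (hσ'ne x hx).symm
      have hσ' : SubTy Sua Γ S.ctx σ' := by
        refine SubTy.congr hσσ' (fun x => ?_)
        by_cases hx : x = P.var
        · subst hx
          rw [hσ'P]
          exact .conv ht hty
        · rw [hσ'ne x hx]
          exact hσ.subTy x
      have hA' := HasType.coh hTA (hσ'.subOk (ctxOk Sua S)) hsupp
      -- The branch height is less than `N`, as `T` would otherwise be the disc `Dᴺ`.
      have hb : P.bh < N := by
        have h1 := h.height
        have h2 := th_le_dim T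
        by_contra h3
        have h4 : T.dim = N := by omega
        exact hne (h4 ▸ eq_disc_of_dim_le_th T (by omega))
      have hD : P.bh ≤ (disc N).th := by rw [th_disc]; exact hb.le
      have hredex : IsInsertionRedex S P (disc N) σ' ρ := ⟨hD, by rw [hl]; exact hσ'P⟩
      have hstep : TmEq Sua Γ (.coh S.ctx (.arr s₀ A₀ t₀) σ') _ :=
        .rule (.insertion S P (disc N) σ' ρ hredex _
          (Or.inr (hl ▸ isIdentity_unbiasedCoh_disc N _)) (fun h => hid (h.congr σ))) hA'
      -- The reduct is well typed.
      have hUρ : (unbiasedTy P.lh (disc N)).sub ρ = (unbiasedTy (N + 1) T).sub τ := by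
        rw [hl, unbiasedTy_succ_disc, unbiasedTy_succ_of_ne hd hne]
        have h1 : ρ (disc N).top = (unbiasedCoh N T).sub τ := discSub_top _ hρdim
        have h2 : ((disc N).ctx.ty (disc N).top).sub ρ = (unbiasedTy N T).sub τ :=
          ty_disc_top_sub_discSub _ hρdim
        simp only [Ty.sub, Tm.sub]
        rw [h1, h2]
      have hins : SubTy Sua Γ (insTree P (disc N) hD).ctx (insSub P (disc N) hD σ' ρ) := by
        refine subTy_insSub P (disc N) hD hredex.arg ?_ hσ' (SubTy.discSub hρdim hρ.1 hρ.2)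
        rw [hUρ]
        exact hty.trans (TyEq.sub_congr hσσ' _)
      have hTA' := hTA.sub Sua.stable (subTy_exterior_disc Sua P hD hl)
      rw [Ty.sub] at hTA'
      have hred := HasType.coh hTA' (hins.subOk (ctxOk Sua _))
        (suppOk_exterior_disc P hD hb hl hsupp)
      have hT' : (prune P N hD hb).bh ≤ T.th := by rw [bh_prune]; exact h.height
      have hredex' : IsInsertionRedex (insTree P (disc N) hD) (prune P N hD hb) T
          (insSub P (disc N) hD σ' ρ) τ := by
        refine ⟨hT', ?_⟩
        rw [lh_prune, var_prune, insSub_intVar]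
        exact discSub_top _ hρdim
      have hrec := insertion_of_lh_eq N Γ _ (prune P N hD hb) T _ τ hredex' _ _
        (lh_prune P N hD hb) hred
      have e := insTree_prune P N hD hb T h.height hT'
      refine .trans (.coh (.refl _) hσσ') (.trans hstep ?_)
      rw [Ty.sub]
      refine .trans hrec ?_
      rw [← Ty.sub, Ty.sub_sub]
      refine tmEq_coh_of_cast e _
        (tmEq_exterior_prune P N hD hb hl T h.height hT' _ hd hne hCT) (fun i => ?_)
      rw [insSub_prune P N hD hb T h.height hT' (congrArg size e),
        insSub_congr P T h.height τ (fun x hx => hσ'ne x hx)]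

end Catt

theorem mainTheorem6 {n : ℕ} (Γ : Catt.Ctx n) (S : Catt.Tree) (P : Catt.Branch S) (T : Catt.Tree)
    (σ : Catt.Sub S.size n) (τ : Catt.Sub T.size n) (h : Catt.IsInsertionRedex S P T σ τ)
    (A : Catt.Ty S.size) (B : Catt.Ty n)
    (hA : Catt.HasType Catt.Sua Γ (.coh S.ctx A σ) B) :
    Catt.TmEq Catt.Sua Γ (.coh S.ctx A σ)
      (.coh (Catt.insTree P T h.height).ctx (A.sub (Catt.exterior P T h.height))
        (Catt.insSub P T h.height σ τ)) :=
  Catt.insertion_of_lh_eq P.lh Γ S P T σ τ h A B rfl hA
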